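/- There is a polynomial-time algorithm that, given a weighted graph $(G,w)$, that is, a finite simple undirected graph $G=(V,E)$ together with a weight function $w\colon V\to\mathbb{Q}_{\ge 0}$, computes a vertex cover $X\subseteq V$ of $G$ of weight $$w(X)\;\le\;\mathrm{OPT}_{\mathrm{WVC}}(G,w)+4\cdot\mathrm{OPT}_{\mathrm{IVD}}(G,w).$$ Here $w(Y)=\sum_{v\in Y}w(v)$ for $Y\subseteq V$; $\mathrm{OPT}_{\mathrm{WVC}}(G,w)$ is the minimum of $w(Y)$ over all vertex covers $Y$ of $G$, i.e. over all $Y\subseteq V$ such that $G-Y$ has no edges; and $\mathrm{OPT}_{\mathrm{IVD}}(G,w)$ is the minimum of $w(M)$ over all $M\subseteq V$ such that $G-M$ is an interval graph, i.e. such that the vertices of $G-M$ correspond bijectively to a set of intervals on the real line, two distinct vertices being adjacent if and only if their intervals intersect. The algorithm receives only $G$ and $w$ (no modulator); its running time is bounded by a polynomial in the number of bits of the input, the weights being given as fractions of integers written in binary. -/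

import Mathlib

open scoped NNRat

/-! ### Random access machines under the logarithmic cost criterion -/

namespace RAM

/-- The memory of a random access machine: natural-number registers and arrays (indirectly
addressable memory) of natural numbers. Registers and arrays are named by numbers; a program is a
finite text, so it can only use a fixed finite number of registers and arrays. -/
structure Store where
  reg : ℕ → ℕ
  arr : ℕ → ℕ → ℕ

/-- The arithmetic operations: truncated subtraction, integer division (with `a / 0 = 0`), and
comparisons with result `1` (true) or `0` (false). -/
inductive Op
  | add | sub | mul | div | lt | eq

def Op.eval : Op → ℕ → ℕ → ℕ
  | .add, a, b => a + b
  | .sub, a, b => a - b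
  | .mul, a, b => a * b
  | .div, a, b => a / b
  | .lt, a, b => if a < b then 1 else 0
  | .eq, a, b => if a = b then 1 else 0

/-- Expressions: numerals, registers, array cells `a[e]`, and arithmetic. -/
inductive Expr
  | lit (k : ℕ)
  | reg (x : ℕ)
  | read (a : ℕ) (e : Expr)
  | op (o : Op) (e f : Expr)

def Expr.eval (s : Store) : Expr → ℕ
  | .lit k => k
  | .reg x => s.reg x
  | .read a e => s.arr a (e.eval s)
  | .op o e f => o.eval (e.eval s) (f.eval s)

/-- Logarithmic cost of evaluating an expression: every number that is read or computed on the way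
(operands, addresses and results) is charged its binary length, plus one. -/
def Expr.cost (s : Store) : Expr → ℕ
  | .lit k => 1 + Nat.size k
  | .reg x => 1 + Nat.size (s.reg x)
  | .read a e => e.cost s + (1 + Nat.size ((Expr.read a e).eval s))
  | .op o e f => e.cost s + f.cost s + (1 + Nat.size ((Expr.op o e f).eval s))

/-- Structured programs: `skip`, `x := e`, `a[e] := f`, `c; d`, `if e ≠ 0 then c else d`,
`while e ≠ 0 do c`. -/
inductive Prog
  | skip
  | assign (x : ℕ) (e : Expr)
  | store (a : ℕ) (e f : Expr)
  | seq (c d : Prog)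
  | ite (e : Expr) (c d : Prog)
  | loop (e : Expr) (c : Prog)

def Store.setReg (s : Store) (x v : ℕ) : Store :=
  { s with reg := Function.update s.reg x v }

def Store.setArr (s : Store) (a i v : ℕ) : Store :=
  { s with arr := Function.update s.arr a (Function.update (s.arr a) i v) }

/-- `Exec c s t s'`: started on the store `s`, the program `c` halts, with running time exactly `t`
(logarithmic cost), in the store `s'`. -/
inductive Exec : Prog → Store → ℕ → Store → Prop
  | skip (s : Store) : Exec .skip s 1 s
  | assign (s : Store) (x : ℕ) (e : Expr) :
      Exec (.assign x e) s (1 + e.cost s) (s.setReg x (e.eval s))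
  | store (s : Store) (a : ℕ) (e f : Expr) :
      Exec (.store a e f) s (1 + e.cost s + f.cost s) (s.setArr a (e.eval s) (f.eval s))
  | seq {s s' s'' : Store} {c d : Prog} {t t' : ℕ} (h : Exec c s t s') (h' : Exec d s' t' s'') :
      Exec (.seq c d) s (t + t') s''
  | ite_true {s s' : Store} {e : Expr} {c d : Prog} {t : ℕ} (he : e.eval s ≠ 0)
      (h : Exec c s t s') : Exec (.ite e c d) s (1 + e.cost s + t) s'
  | ite_false {s s' : Store} {e : Expr} {c d : Prog} {t : ℕ} (he : e.eval s = 0)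
      (h : Exec d s t s') : Exec (.ite e c d) s (1 + e.cost s + t) s'
  | loop_done {s : Store} {e : Expr} {c : Prog} (he : e.eval s = 0) :
      Exec (.loop e c) s (1 + e.cost s) s
  | loop_step {s s' s'' : Store} {e : Expr} {c : Prog} {t t' : ℕ} (he : e.eval s ≠ 0)
      (h : Exec c s t s') (h' : Exec (.loop e c) s' t' s'') :
      Exec (.loop e c) s (1 + e.cost s + t + t') s''

/-- The machine is deterministic. -/
theorem Exec.unique {c : Prog} {s s₁ s₂ : Store} {t₁ t₂ : ℕ} (h₁ : Exec c s t₁ s₁)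
    (h₂ : Exec c s t₂ s₂) : t₁ = t₂ ∧ s₁ = s₂ := by
  induction h₁ generalizing t₂ s₂ with
  | skip | assign | store => cases h₂; exact ⟨rfl, rfl⟩
  | seq _ _ ih ih' =>
    cases h₂ with
    | seq k k' =>
      obtain ⟨rfl, rfl⟩ := ih k
      obtain ⟨rfl, rfl⟩ := ih' k'
      exact ⟨rfl, rfl⟩
  | ite_true he _ ih =>
    cases h₂ with
    | ite_true _ k => obtain ⟨rfl, rfl⟩ := ih k; exact ⟨rfl, rfl⟩
    | ite_false he' _ => exact absurd he' he
  | ite_false he _ ih =>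
    cases h₂ with
    | ite_true he' _ => exact absurd he he'
    | ite_false _ k => obtain ⟨rfl, rfl⟩ := ih k; exact ⟨rfl, rfl⟩
  | loop_done he =>
    cases h₂ with
    | loop_done => exact ⟨rfl, rfl⟩
    | loop_step he' => exact absurd he he'
  | loop_step he _ _ ih ih' =>
    cases h₂ with
    | loop_done he' => exact absurd he' he
    | loop_step _ k k' =>
      obtain ⟨rfl, rfl⟩ := ih k
      obtain ⟨rfl, rfl⟩ := ih' k'
      exact ⟨rfl, rfl⟩

end RAM

/-! ### Weighted graphs as inputs and vertex sets as outputs -/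

open Classical in
/-- The initial memory for a weighted graph on the vertices `0, …, n - 1`: register `0` holds `n`,
array `0` holds the adjacency matrix (row by row), arrays `1` and `2` hold the numerators and the
denominators of the weights in lowest terms, and everything else is `0`. -/
noncomputable def inputStore {n : ℕ} (G : SimpleGraph (Fin n)) (w : Fin n → ℚ≥0) : RAM.Store where
  reg x := if x = 0 then n else 0
  arr a k :=
    if a = 0 then (if ∃ i j : Fin n, G.Adj i j ∧ k = i * n + j then 1 else 0)
    else if a = 1 then (if h : k < n then (w ⟨k, h⟩).num else 0)
    else if a = 2 then (if h : k < n then (w ⟨k, h⟩).den else 0)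
    else 0

/-- The size of the input in bits: the adjacency matrix and the binary lengths of the numerators
and denominators of the weights. -/
def inputSize {n : ℕ} (w : Fin n → ℚ≥0) : ℕ :=
  n * n + ∑ v, (Nat.size (w v).num + Nat.size (w v).den)

/-- The vertex set that a final memory describes: array `3` holds `1` at its members. -/
def outputSet (n : ℕ) (s : RAM.Store) : Finset (Fin n) :=
  Finset.univ.filter fun v => s.arr 3 v = 1

/-! ### Vertex covers, interval graphs, modulators -/

/-- An interval graph: its vertices correspond bijectively to a set of (nonempty, closed, bounded)
intervals of the real line such that two different vertices are adjacent if and only if their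
intervals intersect. -/
def IsIntervalGraph {V : Type} (G : SimpleGraph V) : Prop :=
  ∃ τ : V → NonemptyInterval ℝ, Function.Injective τ ∧
    ∀ u v, u ≠ v → (G.Adj u v ↔ ((τ u : Set ℝ) ∩ (τ v : Set ℝ)).Nonempty)

/-- `M` is a modulator to an interval graph: deleting `M` leaves an interval graph. -/
def IsIntervalModulator {V : Type} (G : SimpleGraph V) (M : Set V) : Prop :=
  IsIntervalGraph (G.induce Mᶜ)

/-- The weight `w(X) = ∑_{v ∈ X} w(v)` of a vertex set. -/
def weight {V : Type} (w : V → ℚ≥0) (X : Finset V) : ℚ≥0 := ∑ v ∈ X, w v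

theorem isIntervalModulator_univ {V : Type} (G : SimpleGraph V) :
    IsIntervalModulator G Set.univ := by
  have h : IsEmpty ↥((Set.univ : Set V)ᶜ) := ⟨fun x => x.2 trivial⟩
  exact ⟨fun x => h.elim x, fun x => h.elim x, fun x => h.elim x⟩

open Classical in
/-- The minimum weight of a vertex cover. -/
noncomputable def optWVC {V : Type} [Fintype V] (G : SimpleGraph V) (w : V → ℚ≥0) : ℚ≥0 :=
  ((Finset.univ : Finset (Finset V)).filter fun X : Finset V => G.IsVertexCover (X : Set V)).inf'
    ⟨Finset.univ, by simp⟩ (weight w)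

open Classical in
/-- The minimum weight of a modulator to an interval graph. -/
noncomputable def optIVD {V : Type} [Fintype V] (G : SimpleGraph V) (w : V → ℚ≥0) : ℚ≥0 :=
  ((Finset.univ : Finset (Finset V)).filter fun M : Finset V => IsIntervalModulator G (M : Set V)).inf'
    ⟨Finset.univ, by simpa using isIntervalModulator_univ G⟩ (weight w)

/-!
The algorithm combines the local ratio technique with an exact algorithm for a class of graphs.

*Local ratio.* The six `patterns` (the cycles of length four and five, the long claw, the net, the
tent, and a graph on seven vertices called umbrella here) are not interval graphs (`not_isRep`),
and each has a matching that misses at most four of its vertices. So subtracting the same amount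
`ε` from the weights of all vertices of an induced pattern with `m` vertices lowers the weight of
any vertex set by at most `m * ε`, of any vertex cover by at least `(m - 4) * ε`, and of any
modulator by at least `ε`: a vertex cover that satisfies the claim for the smaller weights
satisfies it for the original ones (`Approx.of_occurs`). Taking `ε` as large as possible kills a
vertex of the pattern, and a single pass over all tuples of at most seven vertices leaves a support
without patterns. There, an optimal vertex cover, the complement of an independent set of maximum
weight, suffices (`approx_compl`).

*Graphs without patterns.* A clique module of `S` is a nonempty set `R` such that every vertex of
`S` outside `R` with a neighbour in `R` is adjacent to all other vertices of the closed
neighbourhood of `R`. An independent set meets that neighbourhood either within `R` only or in at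
most one vertex outside `R`, so the maximum weight `α` of an independent set in `R` can be split
off: subtract `α` from the weights on the closed neighbourhood of `R` and delete `R`
(`IsCliqueModule.wis_eq`). Clique modules are closed sets of a closure operator, so
inclusion-minimal ones are easy to find. If there are no patterns, then every hole in a minimal
clique module dominates it: otherwise a component of what the hole and its neighbours leave of the
module is a smaller clique module, as other vertices would produce a pattern. Hence the
non-neighbours of a vertex in a minimal clique module span no hole
(`IsMinCliqueModule.holeFree_nonNbrs`), and `α` can be found by guessing one vertex of the
independent set and recursing into a chordal graph. In a chordal graph a simplicial vertex is a
clique module by itself (Dirac's theorem), and the same elimination ends there. Self-reduction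
turns the optimal weight into an optimal set.

*Polynomial time.* The algorithm is written in a language whose loops run over the vertices and
whose sums and products are capped at a number `cap` with polynomially many digits. All numbers in
memory stay below the cap, so the logarithmic cost of a compiled program is bounded by a polynomial
that depends on its syntax only (`St.compile_spec`, `St.polyBounded_time`), and correctness is
proved for the denotational semantics `St.run`. The rational weights are multiplied by the product
of all denominators; the cap, a product over the vertices, is computed by the machine beforehand.
-/

/-! ### A small language of bounded loops and its compiler -/

namespace Bounded

open RAM

/-- Terms: the numerals `0` and `1`, variables, matrix cells `a[t * n + u]`, arithmetic,
conditionals, and the maximum of a term as a variable ranges over `0, …, n - 1`. -/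
inductive Tm
  | lit (b : Bool)
  | var (x : ℕ)
  | read (a : ℕ) (t u : Tm)
  | op (o : Op) (t u : Tm)
  | cond (t u v : Tm)
  | sup (x : ℕ) (t : Tm)

/-- Arithmetic in which sums and products are capped. No other operation exceeds the maximum of its
arguments and `1`, so no value ever computed exceeds the cap and the values in memory; this makes
the running time of a program a matter of its syntax only. -/
def satOp (cap : ℕ) : Op → ℕ → ℕ → ℕ
  | .add, a, b => min (a + b) cap
  | .mul, a, b => min (a * b) cap
  | o, a, b => o.eval a b

/-- The value of a term in an environment `η` (values of variables) and a memory `σ`. -/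
def Tm.eval (n cap : ℕ) (σ : ℕ → ℕ → ℕ) : Tm → (ℕ → ℕ) → ℕ
  | .lit b, _ => b.toNat
  | .var x, η => η x
  | .read a t u, η => σ a (t.eval n cap σ η * n + u.eval n cap σ η)
  | .op o t u, η => satOp cap o (t.eval n cap σ η) (u.eval n cap σ η)
  | .cond t u v, η => if t.eval n cap σ η ≠ 0 then u.eval n cap σ η else v.eval n cap σ η
  | .sup x t, η => (Finset.range n).sup fun i => t.eval n cap σ (Function.update η x i)

/-- Statements: `a[t * n + u] := v`, sequences, case distinctions, and loops in which a variable
ranges over `0, …, n - 1`. -/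
inductive St
  | skip
  | set (a : ℕ) (t u v : Tm)
  | seq (c d : St)
  | ite (t : Tm) (c d : St)
  | loop (x : ℕ) (c : St)

/-- `iter f k s` is `f (k - 1) (… (f 1 (f 0 s)))`. -/
def iter {α : Type} (f : ℕ → α → α) : ℕ → α → α
  | 0, s => s
  | k + 1, s => f k (iter f k s)

/-- The effect of a statement on the memory. -/
def St.run (n cap : ℕ) : St → (ℕ → ℕ) → (ℕ → ℕ → ℕ) → (ℕ → ℕ → ℕ)
  | .skip, _, σ => σ
  | .set a t u v, η, σ => Function.update σ a (Function.update (σ a)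
      (t.eval n cap σ η * n + u.eval n cap σ η) (v.eval n cap σ η))
  | .seq c d, η, σ => d.run n cap η (c.run n cap η σ)
  | .ite t c d, η, σ => if t.eval n cap σ η ≠ 0 then c.run n cap η σ else d.run n cap η σ
  | .loop x c, η, σ => iter (fun i σ => c.run n cap (Function.update η x i) σ) n σ

/-! Register `0` holds `n`, register `1` the cap, register `2 * x + 2` the variable `x`, and register
`2 * j + 3` the temporary `j`. Code compiled at depth `d` uses the temporaries from `d` on. -/

/-- The register of the temporary `j`, as an expression. -/
def tmp (j : ℕ) : Expr := .reg (2 * j + 3)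

/-- `satOp` as an expression; `min e cap` is `e - (e - cap)` in truncated subtraction. -/
def satExpr : Op → Expr → Expr → Expr
  | .add, e, f => .op .sub (.op .add e f) (.op .sub (.op .add e f) (.reg 1))
  | .mul, e, f => .op .sub (.op .mul e f) (.op .sub (.op .mul e f) (.reg 1))
  | o, e, f => .op o e f

/-- `while reg c < reg 0 do (body; reg c := reg c + 1)`. -/
def countLoop (c : ℕ) (body : Prog) : Prog :=
  .loop (.op .lt (.reg c) (.reg 0)) (.seq body (.assign c (.op .add (.reg c) (.lit 1))))

/-- Code that leaves the value of a term in the temporary `d`. The bound variable of a maximum is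
saved and restored. -/
def Tm.compile : Tm → ℕ → Prog
  | .lit b, d => .assign (2 * d + 3) (.lit b.toNat)
  | .var x, d => .assign (2 * d + 3) (.reg (2 * x + 2))
  | .read a t u, d => .seq (t.compile d) (.seq (u.compile (d + 1))
      (.assign (2 * d + 3) (.read a (.op .add (.op .mul (tmp d) (.reg 0)) (tmp (d + 1))))))
  | .op o t u, d => .seq (t.compile d) (.seq (u.compile (d + 1))
      (.assign (2 * d + 3) (satExpr o (tmp d) (tmp (d + 1)))))
  | .cond t u v, d => .seq (t.compile d) (.ite (tmp d) (u.compile d) (v.compile d))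
  | .sup x t, d =>
      .seq (.assign (2 * d + 3) (.lit 0)) (.seq (.assign (2 * (d + 1) + 3) (.lit 0))
      (.seq (.assign (2 * (d + 2) + 3) (.reg (2 * x + 2)))
      (.seq (countLoop (2 * (d + 1) + 3)
        (.seq (.assign (2 * x + 2) (tmp (d + 1))) (.seq (t.compile (d + 3))
          (.ite (.op .lt (tmp d) (tmp (d + 3))) (.assign (2 * d + 3) (tmp (d + 3))) .skip))))
      (.assign (2 * x + 2) (tmp (d + 2))))))

/-- Code for a statement. The counter of a loop is a temporary, and the loop variable is saved and
restored. -/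
def St.compile : St → ℕ → Prog
  | .skip, _ => .skip
  | .set a t u v, d => .seq (t.compile d) (.seq (u.compile (d + 1)) (.seq (v.compile (d + 2))
      (.store a (.op .add (.op .mul (tmp d) (.reg 0)) (tmp (d + 1))) (tmp (d + 2)))))
  | .seq c e, d => .seq (c.compile d) (e.compile d)
  | .ite t c e, d => .seq (t.compile d) (.ite (tmp d) (c.compile d) (e.compile d))
  | .loop x c, d =>
      .seq (.assign (2 * d + 3) (.lit 0))
      (.seq (.assign (2 * (d + 1) + 3) (.reg (2 * x + 2)))
      (.seq (countLoop (2 * d + 3) (.seq (.assign (2 * x + 2) (tmp d)) (c.compile (d + 2))))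
      (.assign (2 * x + 2) (tmp (d + 1)))))

/-! #### Running times -/

/-- A bound for the cost of one assignment or test when all numbers in memory have at most `B`
bits. -/
def unit (B : ℕ) : ℕ := 500 * (B + 1)

/-- A bound for the running time of a term if `n ≤ B` and all numbers in memory have at most `B`
bits. -/
def Tm.time (B : ℕ) : Tm → ℕ
  | .lit _ => unit B
  | .var _ => unit B
  | .read _ t u => t.time B + (u.time B + unit B)
  | .op _ t u => t.time B + (u.time B + unit B)
  | .cond t u v => t.time B + (unit B + (u.time B + v.time B))
  | .sup _ t => unit B + (unit B + (unit B + (((B + 1) * ((unit B + (t.time B + (unit B +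
      (unit B + unit B)))) + unit B + unit B)) + unit B)))

/-- A bound for the running time of a statement. -/
def St.time (B : ℕ) : St → ℕ
  | .skip => unit B
  | .set _ t u v => t.time B + (u.time B + (v.time B + unit B))
  | .seq c d => c.time B + d.time B
  | .ite t c d => t.time B + (unit B + (c.time B + d.time B))
  | .loop _ c => unit B + (unit B + ((B + 1) * ((unit B + c.time B) + unit B + unit B) + unit B))

/-- `f` is bounded by a polynomial. -/
def PolyBounded (f : ℕ → ℕ) : Prop := ∃ p : Polynomial ℕ, ∀ B, f B ≤ p.eval B

theorem PolyBounded.const (k : ℕ) : PolyBounded fun _ => k := ⟨Polynomial.C k, by simp⟩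

theorem PolyBounded.id : PolyBounded fun B => B := ⟨Polynomial.X, by simp⟩

theorem PolyBounded.add {f g : ℕ → ℕ} (hf : PolyBounded f) (hg : PolyBounded g) :
    PolyBounded fun B => f B + g B := by
  obtain ⟨p, hp⟩ := hf
  obtain ⟨q, hq⟩ := hg
  exact ⟨p + q, fun B => by simpa using Nat.add_le_add (hp B) (hq B)⟩

theorem PolyBounded.mul {f g : ℕ → ℕ} (hf : PolyBounded f) (hg : PolyBounded g) :
    PolyBounded fun B => f B * g B := by
  obtain ⟨p, hp⟩ := hf
  obtain ⟨q, hq⟩ := hg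
  exact ⟨p * q, fun B => by simpa using Nat.mul_le_mul (hp B) (hq B)⟩

theorem PolyBounded.unit : PolyBounded unit :=
  (PolyBounded.const 500).mul (PolyBounded.id.add (.const 1))

theorem Tm.polyBounded_time : ∀ t : Tm, PolyBounded fun B => t.time B
  | .lit _ | .var _ => .unit
  | .read _ t u | .op _ t u => t.polyBounded_time.add (u.polyBounded_time.add .unit)
  | .cond t u v =>
    t.polyBounded_time.add (PolyBounded.unit.add (u.polyBounded_time.add v.polyBounded_time))
  | .sup _ t => PolyBounded.unit.add (PolyBounded.unit.add (PolyBounded.unit.add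
      (((PolyBounded.id.add (.const 1)).mul (((PolyBounded.unit.add (t.polyBounded_time.add
        (PolyBounded.unit.add (PolyBounded.unit.add .unit)))).add .unit).add .unit)).add .unit)))

theorem St.polyBounded_time : ∀ c : St, PolyBounded fun B => c.time B
  | .skip => .unit
  | .set _ t u v =>
    t.polyBounded_time.add (u.polyBounded_time.add (v.polyBounded_time.add .unit))
  | .seq c d => c.polyBounded_time.add d.polyBounded_time
  | .ite t c d =>
    t.polyBounded_time.add (PolyBounded.unit.add (c.polyBounded_time.add d.polyBounded_time))
  | .loop _ c => PolyBounded.unit.add (PolyBounded.unit.add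
      (((PolyBounded.id.add (.const 1)).mul (((PolyBounded.unit.add c.polyBounded_time).add
        .unit).add .unit)).add .unit))

/-- All numbers in the memory are at most `M`. -/
def Bd (M : ℕ) (s : Store) : Prop := (∀ x, s.reg x ≤ M) ∧ ∀ a i, s.arr a i ≤ M

theorem Bd.setReg {M : ℕ} {s : Store} (h : Bd M s) {x v : ℕ} (hv : v ≤ M) : Bd M (s.setReg x v) := by
  refine ⟨fun y => ?_, h.2⟩
  by_cases hy : y = x
  · subst hy; simpa [Store.setReg] using hv
  · simpa [Store.setReg, hy] using h.1 y

theorem Bd.setArr {M : ℕ} {s : Store} (h : Bd M s) {a i v : ℕ} (hv : v ≤ M) :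
    Bd M (s.setArr a i v) := by
  refine ⟨h.1, fun b j => ?_⟩
  by_cases hb : b = a
  · subst hb
    by_cases hj : j = i
    · subst hj; simpa [Store.setArr] using hv
    · simpa [Store.setArr, hj] using h.2 b j
  · simpa [Store.setArr, hb] using h.2 b j

/-- The number of nodes of an expression, a numeral counting with its binary length. -/
def nodes : Expr → ℕ
  | .lit k => 1 + Nat.size k
  | .reg _ => 1
  | .read _ e => nodes e + 1
  | .op _ e f => nodes e + nodes f + 1

theorem size_op_le (o : Op) (a b : ℕ) : Nat.size (o.eval a b) ≤ Nat.size a + Nat.size b + 1 := by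
  have ha := Nat.lt_size_self a
  have hb := Nat.lt_size_self b
  have hpa : 2 ^ Nat.size a ≤ 2 ^ (Nat.size a + Nat.size b) :=
    Nat.pow_le_pow_right (by norm_num) (by omega)
  have hpb : 2 ^ Nat.size b ≤ 2 ^ (Nat.size a + Nat.size b) :=
    Nat.pow_le_pow_right (by norm_num) (by omega)
  have h1 : 1 ≤ 2 ^ (Nat.size a + Nat.size b) := Nat.one_le_two_pow
  rw [Nat.size_le, pow_succ]
  cases o with
  | add => simp only [Op.eval]; omega
  | sub => simp only [Op.eval]; omega
  | mul =>
    simp only [Op.eval]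
    have : a * b < 2 ^ Nat.size a * 2 ^ Nat.size b := Nat.mul_lt_mul'' ha hb
    rw [← pow_add] at this
    omega
  | div =>
    simp only [Op.eval]
    have := Nat.div_le_self a b
    omega
  | lt => simp only [Op.eval]; split_ifs <;> omega
  | eq => simp only [Op.eval]; split_ifs <;> omega

theorem size_eval_le {M B : ℕ} (hB : Nat.size M ≤ B) {s : Store} (hs : Bd M s) :
    ∀ e : Expr, Nat.size (e.eval s) ≤ nodes e * (B + 1)
  | .lit k => by
    simp only [Expr.eval, nodes]
    nlinarith [Nat.zero_le (Nat.size k), Nat.zero_le B, Nat.zero_le (Nat.size k * B)]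
  | .reg x => by
    have := Nat.size_le_size (hs.1 x)
    simp only [Expr.eval, nodes]; omega
  | .read a e => by
    have := Nat.size_le_size (hs.2 a (e.eval s))
    simp only [Expr.eval, nodes]
    nlinarith [Nat.zero_le (nodes e * (B + 1))]
  | .op o e f => by
    have := size_op_le o (e.eval s) (f.eval s)
    have he := size_eval_le hB hs e
    have hf := size_eval_le hB hs f
    simp only [Expr.eval, nodes]
    nlinarith

theorem cost_le {M B : ℕ} (hB : Nat.size M ≤ B) {s : Store} (hs : Bd M s) :
    ∀ e : Expr, e.cost s ≤ nodes e * (1 + nodes e * (B + 1))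
  | .lit k => by
    simp only [Expr.cost, nodes]
    nlinarith [Nat.zero_le (Nat.size k), Nat.zero_le B, Nat.zero_le (Nat.size k * B),
      Nat.zero_le ((1 + Nat.size k) * (1 + Nat.size k) * (B + 1))]
  | .reg x => by
    have := Nat.size_le_size (hs.1 x)
    simp only [Expr.cost, nodes]; omega
  | .read a e => by
    have h := size_eval_le hB hs (.read a e)
    have he := cost_le hB hs e
    simp only [Expr.cost]
    simp only [nodes] at h ⊢
    nlinarith [Nat.zero_le (nodes e * (B + 1))]
  | .op o e f => by
    have h := size_eval_le hB hs (.op o e f)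
    have he := cost_le hB hs e
    have hf := cost_le hB hs f
    simp only [Expr.cost]
    simp only [nodes] at h ⊢
    nlinarith [Nat.zero_le (nodes e * (B + 1)), Nat.zero_le (nodes f * (B + 1)),
      Nat.zero_le (nodes e * (nodes f * (B + 1)))]

theorem cost_le_unit {M B : ℕ} (hB : Nat.size M ≤ B) {s : Store} (hs : Bd M s) (e : Expr)
    (he : nodes e ≤ 14) : e.cost s ≤ 210 * (B + 1) := by
  refine (cost_le hB hs e).trans ?_
  calc nodes e * (1 + nodes e * (B + 1)) ≤ 14 * (1 + 14 * (B + 1)) := by gcongr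
    _ ≤ _ := by omega

/-- `Run c s t s'`: started on `s`, the program `c` halts in `s'` after at most `t` steps. -/
def Run (c : Prog) (s : Store) (t : ℕ) (s' : Store) : Prop := ∃ t' ≤ t, Exec c s t' s'

theorem Run.seq {c d : Prog} {s s' s'' : Store} {t t' : ℕ} (h : Run c s t s')
    (h' : Run d s' t' s'') : Run (.seq c d) s (t + t') s'' := by
  obtain ⟨k, hk, h⟩ := h
  obtain ⟨k', hk', h'⟩ := h'
  exact ⟨k + k', by omega, .seq h h'⟩

theorem Run.mono {c : Prog} {s s' : Store} {t t' : ℕ} (h : Run c s t s') (ht : t ≤ t') :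
    Run c s t' s' := by
  obtain ⟨k, hk, h⟩ := h
  exact ⟨k, hk.trans ht, h⟩

theorem Run.skip (B : ℕ) (s : Store) : Run .skip s (unit B) s :=
  ⟨1, by unfold unit; omega, .skip s⟩

section
variable {M B : ℕ} {s : Store}

theorem Run.assign (hB : Nat.size M ≤ B) (hs : Bd M s) (x : ℕ) (e : Expr)
    (he : nodes e ≤ 14) : Run (.assign x e) s (unit B) (s.setReg x (e.eval s)) :=
  ⟨_, by have := cost_le_unit hB hs e he; unfold unit; omega, .assign s x e⟩

theorem Run.store (hB : Nat.size M ≤ B) (hs : Bd M s) (a : ℕ) (e f : Expr)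
    (he : nodes e ≤ 14) (hf : nodes f ≤ 14) :
    Run (.store a e f) s (unit B) (s.setArr a (e.eval s) (f.eval s)) :=
  ⟨_, by
    have := cost_le_unit hB hs e he
    have := cost_le_unit hB hs f hf
    unfold unit; omega, .store s a e f⟩

theorem Run.ite (hB : Nat.size M ≤ B) (hs : Bd M s) {e : Expr}
    (he : nodes e ≤ 14) {c d : Prog} {t t' : ℕ} {s' : Store}
    (h : e.eval s ≠ 0 → Run c s t s') (h' : e.eval s = 0 → Run d s t' s') :
    Run (.ite e c d) s (unit B + (t + t')) s' := by
  have hc := cost_le_unit hB hs e he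
  by_cases h0 : e.eval s = 0
  · obtain ⟨k, hk, h⟩ := h' h0
    exact ⟨_, by unfold unit; omega, .ite_false h0 h⟩
  · obtain ⟨k, hk, h⟩ := h h0
    exact ⟨_, by unfold unit; omega, .ite_true h0 h⟩

/-- The rule for counting loops: an invariant `I i` that fixes the counter at `i`. -/
theorem Run.countLoop (hB : Nat.size M ≤ B) {n : ℕ} (hn : n ≤ B) {c : ℕ}
    {body : Prog} {τ : ℕ} {I : ℕ → Store → Prop}
    (hI : ∀ i s, I i s → s.reg 0 = n ∧ s.reg c = i ∧ Bd M s)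
    (hbody : ∀ i < n, ∀ s, I i s → ∃ s', Run body s τ s' ∧ s'.reg 0 = n ∧ s'.reg c = i ∧ Bd M s' ∧
      I (i + 1) (s'.setReg c (i + 1))) (h0 : I 0 s) :
    ∃ s', Run (countLoop c body) s ((B + 1) * (τ + unit B + unit B)) s' ∧ I n s' := by
  have key : ∀ k i s, i + k = n → I i s →
      ∃ s', Run (Bounded.countLoop c body) s (k * (τ + unit B + unit B) + unit B) s' ∧ I n s' := by
    intro k
    induction k with
    | zero =>
      intro i s hi h
      obtain ⟨h1, h2, h3⟩ := hI i s h
      have hcost := cost_le_unit hB h3 (.op .lt (.reg c) (.reg 0)) (by simp [nodes])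
      refine ⟨s, ⟨_, ?_, .loop_done ?_⟩, ?_⟩
      · unfold unit; omega
      · simp [Expr.eval, Op.eval, h1, h2]; omega
      · have : i = n := by omega
        exact this ▸ h
    | succ k ih =>
      intro i s hi h
      obtain ⟨h1, h2, h3⟩ := hI i s h
      have hcost := cost_le_unit hB h3 (.op .lt (.reg c) (.reg 0)) (by simp [nodes])
      obtain ⟨s', ⟨t', ht', hr⟩, g1, g2, g3, g4⟩ := hbody i (by omega) s h
      obtain ⟨t'', ht'', hr'⟩ := Run.assign hB g3 c (.op .add (.reg c) (.lit 1))
        (by simp [nodes])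
      have e1 : (Expr.op .add (.reg c) (.lit 1)).eval s' = i + 1 := by
        simp [Expr.eval, Op.eval, g2]
      rw [e1] at hr'
      obtain ⟨s'', ⟨k', hk', hr''⟩, hI''⟩ := ih (i + 1) _ (by omega) g4
      refine ⟨s'', ⟨_, ?_, .loop_step ?_ (.seq hr hr') hr''⟩, hI''⟩
      · have : (k + 1) * (τ + unit B + unit B) = k * (τ + unit B + unit B) + (τ + unit B + unit B) := by
          ring
        rw [this]
        have : 1 + (Expr.op .lt (.reg c) (.reg 0)).cost s ≤ unit B := by unfold unit; omega
        omega
      · simp [Expr.eval, Op.eval, h1, h2]; omega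
  obtain ⟨s', hr, h⟩ := key n 0 s (by omega) h0
  refine ⟨s', hr.mono ?_, h⟩
  have : n * (τ + unit B + unit B) ≤ B * (τ + unit B + unit B) := Nat.mul_le_mul_right _ hn
  nlinarith [Nat.zero_le (unit B), Nat.zero_le τ]

end

/-! #### Correctness of the compiler -/

/-- Only temporaries from `d` on may differ. -/
def Pres (d : ℕ) (s s' : Store) : Prop :=
  ∀ r, r % 2 = 0 ∨ r < 2 * d + 3 → s'.reg r = s.reg r

theorem Pres.refl (d : ℕ) (s : Store) : Pres d s s := fun _ _ => rfl

theorem Pres.trans {d d' : ℕ} {s s' s'' : Store} (h : Pres d s s') (h' : Pres d' s' s'')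
    (hd : d ≤ d') : Pres d s s'' := fun r hr => (h' r (by omega)).trans (h r hr)

theorem Pres.setReg {d : ℕ} {s s' : Store} (h : Pres d s s') {j v : ℕ} (hj : d ≤ j) :
    Pres d s (s'.setReg (2 * j + 3) v) := fun r hr => by
  have : r ≠ 2 * j + 3 := by omega
  simpa [Store.setReg, this] using h r hr

/-- The environment that the registers of the variables describe. -/
def envOf (s : Store) : ℕ → ℕ := fun x => s.reg (2 * x + 2)

theorem Pres.envOf {d : ℕ} {s s' : Store} (h : Pres d s s') : envOf s' = envOf s :=
  funext fun x => h _ (by omega)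

theorem envOf_setReg_var (s : Store) (x v : ℕ) :
    envOf (s.setReg (2 * x + 2) v) = Function.update (envOf s) x v := by
  funext y
  by_cases h : y = x
  · subst h; simp [envOf, Store.setReg]
  · have : 2 * y + 2 ≠ 2 * x + 2 := by omega
    simp [envOf, Store.setReg, h]

@[simp] theorem setReg_arr (s : Store) (x v : ℕ) : (s.setReg x v).arr = s.arr := rfl

@[simp] theorem setReg_reg_self (s : Store) (x v : ℕ) : (s.setReg x v).reg x = v := by
  simp [Store.setReg]

theorem setReg_reg_ne (s : Store) {x y : ℕ} (v : ℕ) (h : y ≠ x) :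
    (s.setReg x v).reg y = s.reg y := by
  simp [Store.setReg, h]

theorem satExpr_eval (o : Op) (e f : Expr) (s : Store) :
    (satExpr o e f).eval s = satOp (s.reg 1) o (e.eval s) (f.eval s) := by
  cases o <;> simp [satExpr, satOp, Expr.eval, Op.eval] <;> omega

theorem satOp_le {M cap a b : ℕ} (o : Op) (hcap : cap ≤ M) (h1 : 1 ≤ M) (ha : a ≤ M) :
    satOp cap o a b ≤ M := by
  cases o with
  | add | mul => simp only [satOp]; omega
  | sub => simp only [satOp, Op.eval]; omega
  | div => exact (Nat.div_le_self a b).trans ha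
  | lt | eq => simp only [satOp, Op.eval]; split_ifs <;> omega

theorem nodes_satExpr (o : Op) (i j : ℕ) : nodes (satExpr o (tmp i) (tmp j)) ≤ 14 := by
  cases o <;> simp [satExpr, nodes, tmp]

theorem Tm.compile_spec {M B n cap : ℕ} (hB : Nat.size M ≤ B) (hn : n ≤ B) (hnM : n ≤ M)
    (h1 : 1 ≤ M) : ∀ (t : Tm) (d : ℕ) (s : Store), Bd M s → s.reg 0 = n → s.reg 1 = cap →
    ∃ s', Run (t.compile d) s (t.time B) s' ∧ s'.reg (2 * d + 3) = t.eval n cap s.arr (envOf s) ∧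
      Pres d s s' ∧ s'.arr = s.arr ∧ Bd M s'
  | .lit b, d, s, hs, _, _ =>
    ⟨_, Run.assign hB hs _ _ (by cases b <;> decide), by simp [Expr.eval, Tm.eval],
      (Pres.refl d s).setReg le_rfl, rfl, hs.setReg (by cases b <;> simp [Expr.eval, h1])⟩
  | .var x, d, s, hs, _, _ =>
    ⟨_, Run.assign hB hs _ _ (by simp [nodes]), by simp [Expr.eval, Tm.eval, envOf],
      (Pres.refl d s).setReg le_rfl, rfl, hs.setReg (hs.1 _)⟩
  | .read a t u, d, s, hs, h0, hc => by
    obtain ⟨s₁, r₁, e₁, p₁, a₁, b₁⟩ := Tm.compile_spec hB hn hnM h1 t d s hs h0 hc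
    have h0' : s₁.reg 0 = n := (p₁ 0 (by omega)).trans h0
    obtain ⟨s₂, r₂, e₂, p₂, a₂, b₂⟩ := Tm.compile_spec hB hn hnM h1 u (d + 1) s₁ b₁ h0'
      ((p₁ 1 (by omega)).trans hc)
    have h0'' : s₂.reg 0 = n := (p₂ 0 (by omega)).trans h0'
    refine ⟨_, r₁.seq (r₂.seq (Run.assign hB b₂ _ _ (by simp [nodes, tmp]))), ?_,
      (p₁.trans p₂ (by omega)).setReg le_rfl, a₂.trans a₁, b₂.setReg (b₂.2 _ _)⟩
    simp [Expr.eval, Op.eval, tmp, Tm.eval, e₂, p₂ (2 * d + 3) (by omega), e₁, h0'', a₂, a₁,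
      p₁.envOf]
  | .op o t u, d, s, hs, h0, hc => by
    obtain ⟨s₁, r₁, e₁, p₁, a₁, b₁⟩ := Tm.compile_spec hB hn hnM h1 t d s hs h0 hc
    have h0' : s₁.reg 0 = n := (p₁ 0 (by omega)).trans h0
    have hc' : s₁.reg 1 = cap := (p₁ 1 (by omega)).trans hc
    obtain ⟨s₂, r₂, e₂, p₂, a₂, b₂⟩ := Tm.compile_spec hB hn hnM h1 u (d + 1) s₁ b₁ h0' hc'
    have hc'' : s₂.reg 1 = cap := (p₂ 1 (by omega)).trans hc'
    refine ⟨_, r₁.seq (r₂.seq (Run.assign hB b₂ _ _ (nodes_satExpr _ _ _))), ?_,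
      (p₁.trans p₂ (by omega)).setReg le_rfl, a₂.trans a₁, b₂.setReg ?_⟩
    · simp [Expr.eval, satExpr_eval, tmp, Tm.eval, e₂, p₂ (2 * d + 3) (by omega), e₁, hc'', a₁,
        p₁.envOf]
    · rw [satExpr_eval]
      exact satOp_le o (b₂.1 1) h1 (b₂.1 _)
  | .cond t u v, d, s, hs, h0, hc => by
    obtain ⟨s₁, r₁, e₁, p₁, a₁, b₁⟩ := Tm.compile_spec hB hn hnM h1 t d s hs h0 hc
    have h0' : s₁.reg 0 = n := (p₁ 0 (by omega)).trans h0
    have hc' : s₁.reg 1 = cap := (p₁ 1 (by omega)).trans hc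
    by_cases ht : t.eval n cap s.arr (envOf s) = 0
    · obtain ⟨s₂, r₂, e₂, p₂, a₂, b₂⟩ := Tm.compile_spec hB hn hnM h1 v d s₁ b₁ h0' hc'
      refine ⟨s₂, r₁.seq (Run.ite hB b₁ (by simp [nodes, tmp]) (fun h => ?_) fun _ => r₂), ?_,
        p₁.trans p₂ le_rfl, a₂.trans a₁, b₂⟩
      · exact absurd (e₁.trans ht) h
      · simp [Tm.eval, ht, e₂, a₁, p₁.envOf]
    · obtain ⟨s₂, r₂, e₂, p₂, a₂, b₂⟩ := Tm.compile_spec hB hn hnM h1 u d s₁ b₁ h0' hc'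
      refine ⟨s₂, r₁.seq (Run.ite hB b₁ (by simp [nodes, tmp]) (fun _ => r₂) fun h => ?_), ?_,
        p₁.trans p₂ le_rfl, a₂.trans a₁, b₂⟩
      · exact absurd (e₁.symm.trans h) ht
      · simp [Tm.eval, ht, e₂, a₁, p₁.envOf]
  | .sup x t, d, s, hs, h0, hc => by
    have b₁ : Bd M (s.setReg (2 * d + 3) 0) := hs.setReg (Nat.zero_le _)
    have b₂ : Bd M ((s.setReg (2 * d + 3) 0).setReg (2 * (d + 1) + 3) 0) :=
      b₁.setReg (Nat.zero_le _)
    have b₃ := b₂.setReg (x := 2 * (d + 2) + 3) (v := s.reg (2 * x + 2)) (hs.1 _)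
    set s₃ := ((s.setReg (2 * d + 3) 0).setReg (2 * (d + 1) + 3) 0).setReg (2 * (d + 2) + 3)
      (s.reg (2 * x + 2)) with hs₃
    have r₁ := Run.assign hB hs (2 * d + 3) (.lit 0) (by decide)
    have r₂ := Run.assign hB b₁ (2 * (d + 1) + 3) (.lit 0) (by decide)
    have r₃ := Run.assign hB b₂ (2 * (d + 2) + 3) (.reg (2 * x + 2)) (by simp [nodes])
    have ex : (Expr.reg (2 * x + 2)).eval
        ((s.setReg (2 * d + 3) 0).setReg (2 * (d + 1) + 3) 0) = s.reg (2 * x + 2) := by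
      simp only [Expr.eval]
      rw [setReg_reg_ne _ _ (by omega), setReg_reg_ne _ _ (by omega)]
    rw [ex] at r₃
    let f : ℕ → ℕ := fun i => t.eval n cap s.arr (Function.update (envOf s) x i)
    -- after `i` rounds the temporary `d` holds the maximum of the first `i` values
    let I : ℕ → Store → Prop := fun i s' => Bd M s' ∧ s'.arr = s.arr ∧
      (∀ r, r ≠ 2 * x + 2 → (r % 2 = 0 ∨ r < 2 * d + 3) → s'.reg r = s.reg r) ∧
      s'.reg (2 * d + 3) = (Finset.range i).sup f ∧ s'.reg (2 * (d + 1) + 3) = i ∧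
      s'.reg (2 * (d + 2) + 3) = s.reg (2 * x + 2)
    have hI0 : I 0 s₃ := by
      refine ⟨b₃, rfl, fun r _ hr => ?_, ?_, ?_, ?_⟩
      · rw [hs₃, setReg_reg_ne _ _ (by omega), setReg_reg_ne _ _ (by omega),
          setReg_reg_ne _ _ (by omega)]
      · rw [hs₃, setReg_reg_ne _ _ (by omega), setReg_reg_ne _ _ (by omega)]; simp
      · rw [hs₃, setReg_reg_ne _ _ (by omega)]; simp
      · rw [hs₃]; simp
    have hbody : ∀ i < n, ∀ s', I i s' → ∃ s'', Run (.seq (.assign (2 * x + 2) (tmp (d + 1)))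
        (.seq (t.compile (d + 3))
          (.ite (.op .lt (tmp d) (tmp (d + 3))) (.assign (2 * d + 3) (tmp (d + 3))) .skip)))
        s' (unit B + (t.time B + (unit B + (unit B + unit B)))) s'' ∧ s''.reg 0 = n ∧
        s''.reg (2 * (d + 1) + 3) = i ∧ Bd M s'' ∧
        I (i + 1) (s''.setReg (2 * (d + 1) + 3) (i + 1)) := by
      rintro i hi s' ⟨hb, ha, hp, hmax, hcnt, hsave⟩
      have q₁ := Run.assign hB hb (2 * x + 2) (tmp (d + 1)) (by simp [nodes, tmp])
      have e₁ : (tmp (d + 1)).eval s' = i := by simpa [tmp, Expr.eval] using hcnt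
      rw [e₁] at q₁
      have c₁ := hb.setReg (x := 2 * x + 2) (v := i) (by omega)
      obtain ⟨s₄, q₂, e₂, p₂, a₂, c₂⟩ := Tm.compile_spec hB hn hnM h1 t (d + 3) _ c₁
        (by rw [setReg_reg_ne _ _ (by omega), hp 0 (by omega) (by omega), h0])
        (by rw [setReg_reg_ne _ _ (by omega), hp 1 (by omega) (by omega), hc])
      have henv : envOf (s'.setReg (2 * x + 2) i) = Function.update (envOf s) x i := by
        rw [envOf_setReg_var]
        funext y
        by_cases hy : y = x
        · subst hy; simp
        · simp only [Function.update_of_ne hy]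
          exact hp _ (by omega) (by omega)
      rw [henv, setReg_arr, ha] at e₂
      have g : ∀ r, r ≠ 2 * x + 2 → (r % 2 = 0 ∨ r < 2 * (d + 3) + 3) → s₄.reg r = s'.reg r :=
        fun r hr hr' => by rw [p₂ r hr', setReg_reg_ne _ _ hr]
      have e₃ : (Expr.op .lt (tmp d) (tmp (d + 3))).eval s₄ =
          if (Finset.range i).sup f < f i then 1 else 0 := by
        simp only [Expr.eval, tmp, Op.eval, e₂]
        rw [g _ (by omega) (by omega), hmax]
      have hsup : (Finset.range (i + 1)).sup f = max (f i) ((Finset.range i).sup f) := by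
        rw [Finset.range_add_one, Finset.sup_insert]
      by_cases hlt : (Finset.range i).sup f < f i
      · have q₃ := Run.assign hB c₂ (2 * d + 3) (tmp (d + 3)) (by simp [nodes, tmp])
        have e₄ : (tmp (d + 3)).eval s₄ = f i := by simpa [tmp, Expr.eval] using e₂
        rw [e₄] at q₃
        have hfM : f i ≤ M := e₂.symm.le.trans (c₂.1 _)
        refine ⟨_, q₁.seq (q₂.seq (Run.ite hB c₂ (by simp [nodes, tmp]) (fun _ => q₃) fun h => ?_)),
          ?_, ?_, c₂.setReg hfM, (c₂.setReg hfM).setReg (by omega), ?_, fun r hr hr' => ?_, ?_,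
          ?_, ?_⟩
        · rw [e₃, if_pos hlt] at h; omega
        · rw [setReg_reg_ne _ _ (by omega), g _ (by omega) (by omega), hp _ (by omega) (by omega), h0]
        · rw [setReg_reg_ne _ _ (by omega), g _ (by omega) (by omega), hcnt]
        · simpa using a₂.trans ha
        · rw [setReg_reg_ne _ _ (by omega), setReg_reg_ne _ _ (by omega), g _ hr (by omega),
            hp _ hr hr']
        · rw [setReg_reg_ne _ _ (by omega), setReg_reg_self, hsup]; omega
        · simp
        · rw [setReg_reg_ne _ _ (by omega), setReg_reg_ne _ _ (by omega), g _ (by omega) (by omega),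
            hsave]
      · refine ⟨s₄, q₁.seq (q₂.seq (Run.ite hB c₂ (by simp [nodes, tmp]) (fun h => ?_)
          fun _ => Run.skip B _)), ?_, ?_, c₂, c₂.setReg (by omega), ?_, fun r hr hr' => ?_, ?_,
          ?_, ?_⟩
        · rw [e₃, if_neg hlt] at h; omega
        · rw [g _ (by omega) (by omega), hp _ (by omega) (by omega), h0]
        · rw [g _ (by omega) (by omega), hcnt]
        · simpa using a₂.trans ha
        · rw [setReg_reg_ne _ _ (by omega), g _ hr (by omega), hp _ hr hr']
        · rw [setReg_reg_ne _ _ (by omega), g _ (by omega) (by omega), hmax, hsup]; omega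
        · simp
        · rw [setReg_reg_ne _ _ (by omega), g _ (by omega) (by omega), hsave]
    obtain ⟨s₅, r₅, hb, ha, hp, hmax, -, hsave⟩ := Run.countLoop (I := I) hB hn
      (fun i s' h => ⟨(h.2.2.1 0 (by omega) (by omega)).trans h0, h.2.2.2.2.1, h.1⟩) hbody hI0
    have r₆ := Run.assign hB hb (2 * x + 2) (tmp (d + 2)) (by simp [nodes, tmp])
    refine ⟨_, r₁.seq (r₂.seq (r₃.seq (r₅.seq r₆))), ?_, fun r hr => ?_, ha,
      hb.setReg (hb.1 _)⟩
    · rw [setReg_reg_ne _ _ (by omega), hmax]; rfl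
    · by_cases hx : r = 2 * x + 2
      · subst hx
        rw [setReg_reg_self]
        simpa [tmp, Expr.eval] using hsave
      · rw [setReg_reg_ne _ _ hx, hp r hx hr]

theorem St.compile_spec {M B n cap : ℕ} (hB : Nat.size M ≤ B) (hn : n ≤ B) (hnM : n ≤ M)
    (h1 : 1 ≤ M) : ∀ (c : St) (d : ℕ) (s : Store), Bd M s → s.reg 0 = n → s.reg 1 = cap →
    ∃ s', Run (c.compile d) s (c.time B) s' ∧ s'.arr = c.run n cap (envOf s) s.arr ∧
      Pres d s s' ∧ Bd M s'
  | .skip, d, s, hs, _, _ => ⟨s, Run.skip B s, rfl, Pres.refl d s, hs⟩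
  | .set a t u v, d, s, hs, h0, hc => by
    obtain ⟨s₁, r₁, e₁, p₁, a₁, b₁⟩ := Tm.compile_spec hB hn hnM h1 t d s hs h0 hc
    have h0₁ : s₁.reg 0 = n := (p₁ 0 (by omega)).trans h0
    have hc₁ : s₁.reg 1 = cap := (p₁ 1 (by omega)).trans hc
    obtain ⟨s₂, r₂, e₂, p₂, a₂, b₂⟩ := Tm.compile_spec hB hn hnM h1 u (d + 1) s₁ b₁ h0₁ hc₁
    have h0₂ : s₂.reg 0 = n := (p₂ 0 (by omega)).trans h0₁
    have hc₂ : s₂.reg 1 = cap := (p₂ 1 (by omega)).trans hc₁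
    obtain ⟨s₃, r₃, e₃, p₃, a₃, b₃⟩ := Tm.compile_spec hB hn hnM h1 v (d + 2) s₂ b₂ h0₂ hc₂
    have h0₃ : s₃.reg 0 = n := (p₃ 0 (by omega)).trans h0₂
    refine ⟨_, r₁.seq (r₂.seq (r₃.seq (Run.store hB b₃ _ _ _ (by simp [nodes, tmp])
      (by simp [nodes, tmp])))), ?_, ?_, b₃.setArr (b₃.1 _)⟩
    · have f₁ : s₃.reg (2 * d + 3) = t.eval n cap s.arr (envOf s) := by
        rw [p₃ _ (by omega), p₂ _ (by omega), e₁]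
      have f₂ : s₃.reg (2 * (d + 1) + 3) = u.eval n cap s.arr (envOf s) := by
        rw [p₃ _ (by omega), e₂, a₁, p₁.envOf]
      rw [a₂, a₁, p₂.envOf, p₁.envOf] at e₃
      simp only [Store.setArr, Expr.eval, Op.eval, tmp, St.run, f₁, f₂, e₃, h0₃, a₃, a₂, a₁]
    · exact (p₁.trans p₂ (by omega)).trans p₃ (by omega)
  | .seq c e, d, s, hs, h0, hc => by
    obtain ⟨s₁, r₁, a₁, p₁, b₁⟩ := St.compile_spec hB hn hnM h1 c d s hs h0 hc
    obtain ⟨s₂, r₂, a₂, p₂, b₂⟩ := St.compile_spec hB hn hnM h1 e d s₁ b₁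
      ((p₁ 0 (by omega)).trans h0) ((p₁ 1 (by omega)).trans hc)
    exact ⟨s₂, r₁.seq r₂, by rw [a₂, a₁, p₁.envOf, St.run], p₁.trans p₂ le_rfl, b₂⟩
  | .ite t c e, d, s, hs, h0, hc => by
    obtain ⟨s₁, r₁, e₁, p₁, a₁, b₁⟩ := Tm.compile_spec hB hn hnM h1 t d s hs h0 hc
    have h0₁ : s₁.reg 0 = n := (p₁ 0 (by omega)).trans h0
    have hc₁ : s₁.reg 1 = cap := (p₁ 1 (by omega)).trans hc
    by_cases ht : t.eval n cap s.arr (envOf s) = 0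
    · obtain ⟨s₂, r₂, a₂, p₂, b₂⟩ := St.compile_spec hB hn hnM h1 e d s₁ b₁ h0₁ hc₁
      refine ⟨s₂, r₁.seq (Run.ite hB b₁ (by simp [nodes, tmp]) (fun h => ?_) fun _ => r₂), ?_,
        p₁.trans p₂ le_rfl, b₂⟩
      · exact absurd (e₁.trans ht) h
      · simp [St.run, ht, a₂, a₁, p₁.envOf]
    · obtain ⟨s₂, r₂, a₂, p₂, b₂⟩ := St.compile_spec hB hn hnM h1 c d s₁ b₁ h0₁ hc₁
      refine ⟨s₂, r₁.seq (Run.ite hB b₁ (by simp [nodes, tmp]) (fun _ => r₂) fun h => ?_), ?_,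
        p₁.trans p₂ le_rfl, b₂⟩
      · exact absurd (e₁.symm.trans h) ht
      · simp [St.run, ht, a₂, a₁, p₁.envOf]
  | .loop x c, d, s, hs, h0, hc => by
    have b₁ : Bd M (s.setReg (2 * d + 3) 0) := hs.setReg (Nat.zero_le _)
    have b₂ := b₁.setReg (x := 2 * (d + 1) + 3) (v := s.reg (2 * x + 2)) (hs.1 _)
    set s₂ := (s.setReg (2 * d + 3) 0).setReg (2 * (d + 1) + 3) (s.reg (2 * x + 2)) with hs₂
    have r₁ := Run.assign hB hs (2 * d + 3) (.lit 0) (by decide)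
    have r₂ := Run.assign hB b₁ (2 * (d + 1) + 3) (.reg (2 * x + 2)) (by simp [nodes])
    have ex : (Expr.reg (2 * x + 2)).eval (s.setReg (2 * d + 3) 0) = s.reg (2 * x + 2) := by
      simp only [Expr.eval]
      rw [setReg_reg_ne _ _ (by omega)]
    rw [ex] at r₂
    let f : ℕ → (ℕ → ℕ → ℕ) → (ℕ → ℕ → ℕ) := fun i σ => c.run n cap (Function.update (envOf s) x i) σ
    let I : ℕ → Store → Prop := fun i s' => Bd M s' ∧ s'.arr = iter f i s.arr ∧
      (∀ r, r ≠ 2 * x + 2 → (r % 2 = 0 ∨ r < 2 * d + 3) → s'.reg r = s.reg r) ∧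
      s'.reg (2 * d + 3) = i ∧ s'.reg (2 * (d + 1) + 3) = s.reg (2 * x + 2)
    have hI0 : I 0 s₂ := by
      refine ⟨b₂, rfl, fun r _ hr => ?_, ?_, ?_⟩
      · rw [hs₂, setReg_reg_ne _ _ (by omega), setReg_reg_ne _ _ (by omega)]
      · rw [hs₂, setReg_reg_ne _ _ (by omega)]; simp
      · rw [hs₂]; simp
    have hbody : ∀ i < n, ∀ s', I i s' → ∃ s'', Run (.seq (.assign (2 * x + 2) (tmp d))
        (c.compile (d + 2))) s' (unit B + c.time B) s'' ∧ s''.reg 0 = n ∧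
        s''.reg (2 * d + 3) = i ∧ Bd M s'' ∧ I (i + 1) (s''.setReg (2 * d + 3) (i + 1)) := by
      rintro i hi s' ⟨hb, ha, hp, hcnt, hsave⟩
      have q₁ := Run.assign hB hb (2 * x + 2) (tmp d) (by simp [nodes, tmp])
      have e₁ : (tmp d).eval s' = i := by simpa [tmp, Expr.eval] using hcnt
      rw [e₁] at q₁
      have c₁ := hb.setReg (x := 2 * x + 2) (v := i) (by omega)
      obtain ⟨s₄, q₂, a₂, p₂, c₂⟩ := St.compile_spec hB hn hnM h1 c (d + 2) _ c₁
        (by rw [setReg_reg_ne _ _ (by omega), hp 0 (by omega) (by omega), h0])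
        (by rw [setReg_reg_ne _ _ (by omega), hp 1 (by omega) (by omega), hc])
      have henv : envOf (s'.setReg (2 * x + 2) i) = Function.update (envOf s) x i := by
        rw [envOf_setReg_var]
        funext y
        by_cases hy : y = x
        · subst hy; simp
        · simp only [Function.update_of_ne hy]
          exact hp _ (by omega) (by omega)
      rw [henv, setReg_arr, ha] at a₂
      have g : ∀ r, r ≠ 2 * x + 2 → (r % 2 = 0 ∨ r < 2 * (d + 2) + 3) → s₄.reg r = s'.reg r :=
        fun r hr hr' => by rw [p₂ r hr', setReg_reg_ne _ _ hr]
      refine ⟨s₄, q₁.seq q₂, ?_, ?_, c₂, c₂.setReg (by omega), a₂, fun r hr hr' => ?_, by simp, ?_⟩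
      · rw [g _ (by omega) (by omega), hp _ (by omega) (by omega), h0]
      · rw [g _ (by omega) (by omega), hcnt]
      · rw [setReg_reg_ne _ _ (by omega), g _ hr (by omega), hp _ hr hr']
      · rw [setReg_reg_ne _ _ (by omega), g _ (by omega) (by omega), hsave]
    obtain ⟨s₅, r₅, hb, ha, hp, -, hsave⟩ := Run.countLoop (I := I) hB hn
      (fun i s' h => ⟨(h.2.2.1 0 (by omega) (by omega)).trans h0, h.2.2.2.1, h.1⟩) hbody hI0
    have r₆ := Run.assign hB hb (2 * x + 2) (tmp (d + 1)) (by simp [nodes, tmp])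
    refine ⟨_, r₁.seq (r₂.seq (r₅.seq r₆)), ha, fun r hr => ?_, hb.setReg (hb.1 _)⟩
    by_cases hx : r = 2 * x + 2
    · subst hx
      rw [setReg_reg_self]
      simpa [tmp, Expr.eval] using hsave
    · rw [setReg_reg_ne _ _ hx, hp r hx hr]

end Bounded

/-! ### Holes -/

namespace Graph

open SimpleGraph

variable {V : Type} {G : SimpleGraph V}

/-- The vertices `c 0, …, c (k - 1)` form a hole: an induced cycle, in this cyclic order, of length
`k ≥ 4`. -/
structure IsHole (G : SimpleGraph V) (c : ℕ → V) (k : ℕ) : Prop where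
  four_le : 4 ≤ k
  inj : ∀ i j, i < k → j < k → c i = c j → i = j
  adj_iff : ∀ i j, i < k → j < k →
    (G.Adj (c i) (c j) ↔ j = i + 1 ∨ i = j + 1 ∨ (i = 0 ∧ j + 1 = k) ∨ (j = 0 ∧ i + 1 = k))

theorem IsHole.adj {c : ℕ → V} {k : ℕ} (h : IsHole G c k) (i j : ℕ) (hi : i < k := by omega)
    (hj : j < k := by omega)
    (hij : j = i + 1 ∨ i = j + 1 ∨ (i = 0 ∧ j + 1 = k) ∨ (j = 0 ∧ i + 1 = k) := by omega) :
    G.Adj (c i) (c j) := (h.adj_iff i j hi hj).2 hij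

theorem IsHole.nadj {c : ℕ → V} {k : ℕ} (h : IsHole G c k) (i j : ℕ) (hi : i < k := by omega)
    (hj : j < k := by omega)
    (hij : ¬(j = i + 1 ∨ i = j + 1 ∨ (i = 0 ∧ j + 1 = k) ∨ (j = 0 ∧ i + 1 = k)) := by omega) :
    ¬G.Adj (c i) (c j) := fun h' => hij ((h.adj_iff i j hi hj).1 h')

theorem IsHole.ne {c : ℕ → V} {k : ℕ} (h : IsHole G c k) (i j : ℕ) (hi : i < k := by omega)
    (hj : j < k := by omega) (hij : i ≠ j := by omega) : c i ≠ c j :=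
  fun h' => hij (h.inj i j hi hj h')

/-- The cyclic sequence `c` of length `k`, started at `s`. -/
def rotate (c : ℕ → V) (k s : ℕ) : ℕ → V := fun i => if i + s < k then c (i + s) else c (i + s - k)

theorem IsHole.rotate {c : ℕ → V} {k s : ℕ} (h : IsHole G c k) (hs : s ≤ k) :
    IsHole G (rotate c k s) k := by
  have h4 := h.four_le
  refine ⟨h4, fun i j hi hj hij => ?_, fun i j hi hj => ?_⟩
  · unfold Graph.rotate at hij
    split_ifs at hij <;> have := h.inj _ _ (by omega) (by omega) hij <;> omega
  · unfold Graph.rotate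
    split_ifs <;> rw [h.adj_iff _ _ (by omega) (by omega)] <;> omega

/-- Two cyclic sequences of length `k` with the same members. -/
def SameRange (c c' : ℕ → V) (k : ℕ) : Prop :=
  (∀ i < k, ∃ j < k, c' i = c j) ∧ ∀ i < k, ∃ j < k, c i = c' j

theorem SameRange.trans {c c' c'' : ℕ → V} {k : ℕ} (h : SameRange c c' k)
    (h' : SameRange c' c'' k) : SameRange c c'' k := by
  constructor
  · intro i hi
    obtain ⟨j, hj, e⟩ := h'.1 i hi
    obtain ⟨l, hl, e'⟩ := h.1 j hj
    exact ⟨l, hl, e.trans e'⟩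
  · intro i hi
    obtain ⟨j, hj, e⟩ := h.2 i hi
    obtain ⟨l, hl, e'⟩ := h'.2 j hj
    exact ⟨l, hl, e.trans e'⟩

theorem sameRange_rotate (c : ℕ → V) {k s : ℕ} (hs : s ≤ k) : SameRange c (rotate c k s) k := by
  constructor
  · intro i hi
    unfold rotate
    split_ifs with h
    · exact ⟨_, h, rfl⟩
    · exact ⟨i + s - k, by omega, rfl⟩
  · intro i hi
    unfold rotate
    by_cases h : s ≤ i
    · exact ⟨i - s, by omega, by rw [if_pos (by omega), Nat.sub_add_cancel h]⟩
    · refine ⟨i + k - s, by omega, ?_⟩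
      rw [if_neg (by omega)]
      congr 1; omega

/-- A walk along a relation can be shortened to a path without repetitions and shortcuts. -/
theorem exists_shortest_path {r : V → V → Prop} {x y : V} (h : Relation.ReflTransGen r x y) :
    ∃ (l : ℕ) (f : ℕ → V), f 0 = x ∧ f l = y ∧ (∀ i < l, r (f i) (f (i + 1))) ∧
      (∀ i j, i < j → j ≤ l → f i ≠ f j) ∧ ∀ i j, i + 1 < j → j ≤ l → ¬r (f i) (f j) := by
  classical
  have hex : ∃ l, ∃ f : ℕ → V, f 0 = x ∧ f l = y ∧ ∀ i < l, r (f i) (f (i + 1)) := by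
    induction h with
    | refl => exact ⟨0, fun _ => x, rfl, rfl, fun i hi => absurd hi (Nat.not_lt_zero i)⟩
    | @tail y z _ hyz ih =>
      obtain ⟨l, f, h0, hl, hf⟩ := ih
      refine ⟨l + 1, fun i => if i ≤ l then f i else z, by simp [h0], by simp, fun i hi => ?_⟩
      by_cases hil : i + 1 ≤ l
      · simpa [hil, show i ≤ l by omega] using hf i (by omega)
      · have : i = l := by omega
        subst this
        simpa [hl] using hyz
  obtain ⟨f, h0, hl, hf⟩ := Nat.find_spec hex
  have hmin := fun m hm => Nat.find_min (H := hex) (m := m) hm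
  set l := Nat.find hex
  refine ⟨l, f, h0, hl, hf, fun i j hij hj he => ?_, fun i j hij hj he => ?_⟩
  · refine hmin (l - (j - i)) (by omega) ⟨fun t => if t < i then f t else f (t + (j - i)), ?_, ?_,
      fun t ht => ?_⟩
    · dsimp only
      split_ifs with h
      · exact h0
      · rw [← h0, show 0 + (j - i) = j by omega, ← he]; congr; omega
    · dsimp only
      rw [if_neg (by omega), ← hl]; congr; omega
    · dsimp only
      split_ifs with h1 h2 h2
      · exact hf t (by omega)
      · have : t + 1 = i := by omega
        rw [this, show i + (j - i) = j by omega, ← he, ← this]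
        exact hf t (by omega)
      · omega
      · rw [show t + 1 + (j - i) = t + (j - i) + 1 by omega]
        exact hf _ (by omega)
  · refine hmin (l - (j - i - 1)) (by omega) ⟨fun t => if t ≤ i then f t else f (t + (j - i - 1)),
      by simp [h0], ?_, fun t ht => ?_⟩
    · dsimp only
      rw [if_neg (by omega), ← hl]; congr; omega
    · dsimp only
      split_ifs with h1 h2 h2
      · exact hf t (by omega)
      · have : t = i := by omega
        subst this
        rw [show t + 1 + (j - t - 1) = j by omega]
        exact he
      · omega
      · rw [show t + 1 + (j - i - 1) = t + (j - i - 1) + 1 by omega]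
        exact hf _ (by omega)

/-! ### Clique modules -/

/-- No hole of the graph lies within `S`. -/
def HoleFree (G : SimpleGraph V) (S : Finset V) : Prop :=
  ∀ c k, IsHole G c k → ∃ i < k, c i ∉ S

theorem HoleFree.mono {S T : Finset V} (h : HoleFree G T) (hST : S ⊆ T) : HoleFree G S :=
  fun c k hc => by
    obtain ⟨i, hi, hi'⟩ := h c k hc
    exact ⟨i, hi, fun h => hi' (hST h)⟩

open Classical in
/-- The closed neighbourhood of `R` in the subgraph induced by `S`. -/
noncomputable def closedNbhd (G : SimpleGraph V) (S R : Finset V) : Finset V :=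
  S.filter fun b => ∃ c ∈ R, c = b ∨ G.Adj c b

theorem mem_closedNbhd {S R : Finset V} {b : V} :
    b ∈ closedNbhd G S R ↔ b ∈ S ∧ ∃ c ∈ R, c = b ∨ G.Adj c b := by
  classical
  simp [closedNbhd]

/-- `R` is a clique module of the subgraph induced by `S`: a nonempty set of vertices whose outside
neighbours form a clique and are adjacent to all of `R`. For `R = {v}` this says that `v` is
simplicial. -/
structure IsCliqueModule (G : SimpleGraph V) (S R : Finset V) : Prop where
  sub : R ⊆ S
  ne : R.Nonempty
  adj : ∀ b ∈ closedNbhd G S R, b ∉ R → ∀ y ∈ closedNbhd G S R, y ≠ b → G.Adj b y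

/-- `R` is minimal among the clique modules in `S`. -/
structure IsMinCliqueModule (G : SimpleGraph V) (S R : Finset V) : Prop extends
    IsCliqueModule G S R where
  eq_of_sub : ∀ R', IsCliqueModule G S R' → R' ⊆ R → R' = R

theorem IsCliqueModule.of_adj {S R : Finset V} (hR : R ⊆ S) (hne : R.Nonempty)
    (h₁ : ∀ b ∈ S, b ∉ R → (∃ c ∈ R, G.Adj b c) → ∀ r ∈ R, G.Adj b r)
    (h₂ : ∀ b ∈ S, b ∉ R → ∀ y ∈ S, y ∉ R → (∃ c ∈ R, G.Adj b c) → (∃ c ∈ R, G.Adj y c) → b ≠ y →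
      G.Adj b y) : IsCliqueModule G S R := by
  refine ⟨hR, hne, fun b hb hbR y hy hyb => ?_⟩
  rw [mem_closedNbhd] at hb hy
  have key : ∀ z ∉ R, (∃ c ∈ R, c = z ∨ G.Adj c z) → ∃ c ∈ R, G.Adj z c := by
    rintro z hz ⟨c, hc, rfl | h⟩
    · exact absurd hc hz
    · exact ⟨c, hc, h.symm⟩
  by_cases hyR : y ∈ R
  · exact h₁ b hb.1 hbR (key b hbR hb.2) y hyR
  · exact h₂ b hb.1 hbR y hy.1 hyR (key b hbR hb.2) (key y hyR hy.2) hyb.symm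

/-! ### Simplicial vertices of graphs without holes -/

/-- In a graph without holes, two nonadjacent neighbours of `v` cannot be joined by a path through
non-neighbours of `v`. -/
theorem HoleFree.adj_of_path {S D : Finset V} (hS : HoleFree G S) (hD : D ⊆ S) {v x y : V}
    (hv : v ∈ S) (hvD : v ∉ D) (hDv : ∀ d ∈ D, ¬G.Adj v d) (hx : x ∈ S) (hy : y ∈ S) (hxv : G.Adj v x)
    (hyv : G.Adj v y) (hxy : x ≠ y)
    (h : Relation.ReflTransGen (fun a b => G.Adj a b ∧ (b ∈ D ∨ b = y)) x y) : G.Adj x y := by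
  by_contra hadj
  obtain ⟨l, f, h0, hl, hf, hinj, hind⟩ := exists_shortest_path h
  have hl0 : l ≠ 0 := by rintro rfl; exact hxy (h0.symm.trans hl)
  have hl1 : l ≠ 1 := by
    rintro rfl
    have := (hf 0 (by omega)).1
    rw [h0, hl] at this
    exact hadj this
  have hint : ∀ i, 0 < i → i < l → f i ∈ D := by
    intro i hi hil
    have := (hf (i - 1) (by omega)).2
    rw [show i - 1 + 1 = i by omega] at this
    rcases this with h | h
    · exact h
    · exact absurd (h.trans hl.symm) (hinj i l hil le_rfl)
  have hlast : ∀ j, 0 < j → j ≤ l → f j ∈ D ∨ f j = y := by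
    intro j hj hjl
    rcases hjl.lt_or_eq with h | h
    · exact .inl (hint j hj h)
    · exact .inr (h ▸ hl)
  have hmem : ∀ i, i ≤ l → f i ∈ S := by
    intro i hi
    rcases Nat.eq_zero_or_pos i with h | h
    · exact h ▸ h0 ▸ hx
    · rcases hlast i h hi with h | h
      · exact hD h
      · exact h ▸ hy
  have hvf : ∀ i, i ≤ l → (G.Adj v (f i) ↔ i = 0 ∨ i = l) := by
    intro i hi
    constructor
    · intro h
      by_contra hcon
      exact hDv _ (hint i (by omega) (by omega)) h
    · rintro (rfl | rfl)
      · rwa [h0]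
      · rwa [hl]
  have hvne : ∀ i, i ≤ l → v ≠ f i := by
    intro i hi he
    by_cases h : i = 0 ∨ i = l
    · exact G.loopless.irrefl v (he ▸ (hvf i hi).2 h)
    · exact hvD (he ▸ hint i (by omega) (by omega))
  have hff : ∀ i j, i < j → j ≤ l → (G.Adj (f i) (f j) ↔ j = i + 1) := by
    intro i j hij hj
    constructor
    · intro h
      by_contra hcon
      exact hind i j (by omega) hj ⟨h, hlast j (by omega) hj⟩
    · rintro rfl
      exact (hf i (by omega)).1
  let c : ℕ → V := fun t => if t = 0 then v else f (t - 1)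
  have hc : IsHole G c (l + 2) := by
    refine ⟨by omega, fun i j hi hj hij => ?_, fun i j hi hj => ?_⟩
    · simp only [c] at hij
      split_ifs at hij with h1 h2 h2
      · omega
      · exact absurd hij (hvne _ (by omega))
      · exact absurd hij.symm (hvne _ (by omega))
      · rcases lt_trichotomy i j with h | h | h
        · exact absurd hij (hinj _ _ (by omega) (by omega))
        · exact h
        · exact absurd hij.symm (hinj _ _ (by omega) (by omega))
    · simp only [c]
      split_ifs with h1 h2 h2
      · simp; omega
      · rw [hvf _ (by omega)]; omega
      · rw [G.adj_comm, hvf _ (by omega)]; omega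
      · rcases lt_trichotomy i j with h | h | h
        · rw [hff _ _ (by omega) (by omega)]; omega
        · subst h; simp; omega
        · rw [G.adj_comm, hff _ _ (by omega) (by omega)]; omega
  obtain ⟨i, hi, hiS⟩ := hS c _ hc
  apply hiS
  simp only [c]
  split_ifs
  · exact hv
  · exact hmem _ (by omega)

/-- Every vertex adjacent to `s` is adjacent to all other neighbours of `s` in `S`. -/
def IsSimplicial (G : SimpleGraph V) (S : Finset V) (s : V) : Prop :=
  ∀ a ∈ S, ∀ b ∈ S, G.Adj s a → G.Adj s b → a ≠ b → G.Adj a b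

theorem reflTransGen_symm {r : V → V → Prop} (hr : ∀ a b, r a b → r b a) {x y : V}
    (h : Relation.ReflTransGen r x y) : Relation.ReflTransGen r y x := by
  induction h with
  | refl => exact .refl
  | tail _ hyz ih => exact .head (hr _ _ hyz) ih

/-- A strengthening of Dirac's theorem that can be proved by induction: the simplicial vertex can be
found among the non-neighbours of any given vertex that has some. -/
theorem HoleFree.exists_isSimplicial_not_adj (S : Finset V) (hS : HoleFree G S) (v : V) (hv : v ∈ S)
    (hu : ∃ u ∈ S, u ≠ v ∧ ¬G.Adj v u) : ∃ s ∈ S, s ≠ v ∧ ¬G.Adj v s ∧ IsSimplicial G S s := by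
  classical
  induction S using Finset.strongInduction generalizing v with
  | _ S ih =>
  obtain ⟨u, huS, huv, hadj⟩ := hu
  let r : V → V → Prop := fun a b => G.Adj a b ∧ (a ∈ S ∧ a ≠ v ∧ ¬G.Adj v a) ∧
    (b ∈ S ∧ b ≠ v ∧ ¬G.Adj v b)
  have hsymm : ∀ a b, r a b → r b a := fun a b h => ⟨h.1.symm, h.2.2, h.2.1⟩
  let D : Finset V := S.filter fun z => Relation.ReflTransGen r u z
  have hD : ∀ z, z ∈ D ↔ z ∈ S ∧ Relation.ReflTransGen r u z := fun z => Finset.mem_filter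
  have huD : u ∈ D := (hD u).2 ⟨huS, .refl⟩
  have hDv : ∀ z ∈ D, z ∈ S ∧ z ≠ v ∧ ¬G.Adj v z := by
    intro z hz
    rcases Relation.ReflTransGen.cases_tail ((hD z).1 hz).2 with h | ⟨y, _, h⟩
    · exact h ▸ ⟨huS, huv, hadj⟩
    · exact h.2.2
  have hstep : ∀ z ∈ D, ∀ q ∈ S, G.Adj z q → q ≠ v → ¬G.Adj v q → q ∈ D := by
    intro z hz q hq hzq hqv hvq
    exact (hD q).2 ⟨hq, ((hD z).1 hz).2.tail ⟨hzq, hDv z hz, hq, hqv, hvq⟩⟩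
  let Q : Finset V := S.filter fun q => q ∉ D ∧ ∃ d ∈ D, G.Adj d q
  have hQ : ∀ z, z ∈ Q ↔ z ∈ S ∧ z ∉ D ∧ ∃ d ∈ D, G.Adj d z := fun z => Finset.mem_filter
  have hQv : ∀ q ∈ Q, G.Adj v q := by
    intro q hq
    obtain ⟨hqS, hqD, d, hd, hdq⟩ := (hQ q).1 hq
    by_contra hcon
    refine hqD (hstep d hd q hqS hdq ?_ hcon)
    rintro rfl
    exact (hDv d hd).2.2 hdq.symm
  have hQclique : ∀ x ∈ Q, ∀ y ∈ Q, x ≠ y → G.Adj x y := by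
    intro x hx y hy hxy
    obtain ⟨hxS, hxD, d, hd, hdx⟩ := (hQ x).1 hx
    obtain ⟨hyS, hyD, e, he, hey⟩ := (hQ y).1 hy
    refine hS.adj_of_path (D := D) (fun z hz => (hDv z hz).1) hv (fun h => (hDv v h).2.1 rfl)
      (fun z hz => (hDv z hz).2.2) hxS hyS (hQv x hx) (hQv y hy) hxy ?_
    have hde : Relation.ReflTransGen r d e :=
      (reflTransGen_symm hsymm ((hD d).1 hd).2).trans ((hD e).1 he).2
    have : Relation.ReflTransGen (fun a b => G.Adj a b ∧ (b ∈ D ∨ b = y)) d e := by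
      clear he hey
      induction hde with
      | refl => exact .refl
      | @tail b z hb hbz ih' =>
        refine ih'.tail ⟨hbz.1, .inl ((hD z).2 ⟨hbz.2.2.1, ?_⟩)⟩
        exact (((hD d).1 hd).2.trans hb).tail hbz
    exact (Relation.ReflTransGen.head ⟨hdx.symm, .inl hd⟩ this).tail ⟨hey, .inr rfl⟩
  have hsub : D ∪ Q ⊆ S := by
    intro z hz
    rcases Finset.mem_union.1 hz with h | h
    · exact (hDv z h).1
    · exact ((hQ z).1 h).1
  have hvnot : v ∉ D ∪ Q := by
    intro h
    rcases Finset.mem_union.1 h with h | h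
    · exact (hDv v h).2.1 rfl
    · exact G.loopless.irrefl v (hQv v h)
  have hss : D ∪ Q ⊂ S := Finset.ssubset_iff_subset_ne.2 ⟨hsub, fun h => hvnot (h ▸ hv)⟩
  -- the neighbours of a vertex of `D` lie in `D ∪ Q`
  have hfinish : ∀ s ∈ D, IsSimplicial G (D ∪ Q) s → IsSimplicial G S s := by
    intro s hs hsim a ha b hb hsa hsb hab
    have : ∀ z ∈ S, G.Adj s z → z ∈ D ∪ Q := by
      intro z hz hsz
      by_cases h : z ∈ D
      · exact Finset.mem_union_left _ h
      · exact Finset.mem_union_right _ ((hQ z).2 ⟨hz, h, s, hs, hsz⟩)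
    exact hsim a (this a ha hsa) b (this b hb hsb) hsa hsb hab
  have hD' : ∀ s ∈ D, IsSimplicial G (D ∪ Q) s → ∃ s ∈ S, s ≠ v ∧ ¬G.Adj v s ∧ IsSimplicial G S s :=
    fun s hs hsim => ⟨s, (hDv s hs).1, (hDv s hs).2.1, (hDv s hs).2.2, hfinish s hs hsim⟩
  by_cases hq : ∃ q ∈ Q, ∃ z ∈ D ∪ Q, z ≠ q ∧ ¬G.Adj q z
  · obtain ⟨q, hq, hz⟩ := hq
    obtain ⟨s, hs, hsq, hadj', hsim⟩ := ih _ hss (hS.mono hsub) q (Finset.mem_union_right _ hq) hz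
    rcases Finset.mem_union.1 hs with h | h
    · exact hD' s h hsim
    · exact absurd (hQclique q hq s h hsq.symm) hadj'
  · push Not at hq
    by_cases hd : ∃ d ∈ D, ∃ z ∈ D ∪ Q, z ≠ d ∧ ¬G.Adj d z
    · obtain ⟨d, hd, hz⟩ := hd
      obtain ⟨s, hs, hsd, hadj', hsim⟩ := ih _ hss (hS.mono hsub) d (Finset.mem_union_left _ hd) hz
      rcases Finset.mem_union.1 hs with h | h
      · exact hD' s h hsim
      · exact absurd (hq s h d (Finset.mem_union_left _ hd) hsd.symm).symm hadj'
    · push Not at hd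
      refine hD' u huD fun a ha b hb _ _ hab => ?_
      rcases Finset.mem_union.1 ha with h | h
      · exact hd a h b hb hab.symm
      · exact hq a h b hb hab.symm

/-- Dirac's theorem. -/
theorem HoleFree.exists_isSimplicial {S : Finset V} (hS : HoleFree G S) (hne : S.Nonempty) :
    ∃ s ∈ S, IsSimplicial G S s := by
  by_cases h : ∃ v ∈ S, ∃ u ∈ S, u ≠ v ∧ ¬G.Adj v u
  · obtain ⟨v, hv, hu⟩ := h
    obtain ⟨s, hs, -, -, hsim⟩ := hS.exists_isSimplicial_not_adj S v hv hu
    exact ⟨s, hs, hsim⟩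
  · push Not at h
    obtain ⟨v, hv⟩ := hne
    exact ⟨v, hv, fun a ha b hb _ _ hab => h a ha b hb hab.symm⟩

/-- In a graph without holes the minimal clique modules are the simplicial vertices. -/
theorem IsMinCliqueModule.eq_singleton {S R : Finset V} (hR : IsMinCliqueModule G S R)
    (hS : HoleFree G S) : ∃ v, R = {v} := by
  classical
  obtain ⟨s, hs, hsim⟩ := (hS.mono hR.sub).exists_isSimplicial hR.ne
  refine ⟨s, (hR.eq_of_sub {s} ?_ (by simpa using hs)).symm⟩
  refine .of_adj (by simpa using hR.sub hs) (by simp) (fun b _ _ h => ?_)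
    fun b hb hbs y hy hys h h' hby => ?_
  · simpa using h
  · simp only [Finset.mem_singleton, exists_eq_left] at hbs hys h h'
    have hbR : b ∈ closedNbhd G S R := mem_closedNbhd.2 ⟨hb, s, hs, .inr h.symm⟩
    have hyR : y ∈ closedNbhd G S R := mem_closedNbhd.2 ⟨hy, s, hs, .inr h'.symm⟩
    by_cases h1 : b ∈ R
    · by_cases h2 : y ∈ R
      · exact hsim b h1 y h2 h.symm h'.symm hby
      · exact (hR.adj y hyR h2 b hbR hby).symm
    · exact hR.adj b hbR h1 y hyR hby.symm

end Graph

/-! ### Forbidden patterns -/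

namespace Graph

open SimpleGraph

variable {V : Type} {G : SimpleGraph V}

/-- A small graph on the vertices `0, …, size - 1`, given by the list of its edges `(i, j)`,
`i < j`. -/
structure Pattern where
  size : ℕ
  edges : List (ℕ × ℕ)

/-- The vertices `f 0, f 1, …` are distinct and induce the pattern. -/
def Pattern.Occurs (P : Pattern) (G : SimpleGraph V) (f : ℕ → V) : Prop :=
  ∀ j < P.size, ∀ i < j, f i ≠ f j ∧ (G.Adj (f i) (f j) ↔ (i, j) ∈ P.edges)

def fourCycle : Pattern := ⟨4, [(0, 1), (1, 2), (2, 3), (0, 3)]⟩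

def fiveCycle : Pattern := ⟨5, [(0, 1), (1, 2), (2, 3), (3, 4), (0, 4)]⟩

/-- A claw with centre `6` all of whose edges are subdivided. -/
def longClaw : Pattern := ⟨7, [(0, 1), (2, 3), (4, 5), (0, 6), (2, 6), (4, 6)]⟩

/-- The triangle `0, 2, 4` with one pendant vertex at each vertex. -/
def net : Pattern := ⟨6, [(0, 1), (2, 3), (4, 5), (0, 2), (0, 4), (2, 4)]⟩

/-- The triangle `0, 2, 4` with one triangle attached to each edge. -/
def tent : Pattern :=
  ⟨6, [(0, 1), (1, 2), (2, 3), (3, 4), (4, 5), (0, 5), (0, 2), (2, 4), (0, 4)]⟩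

/-- The path `1, 0, 4, 2, 3`, the vertex `6` adjacent to all of it, and the vertex `5` pendant at
its middle. -/
def umbrella : Pattern :=
  ⟨7, [(0, 1), (2, 3), (4, 5), (0, 4), (2, 4), (0, 6), (1, 6), (2, 6), (3, 6), (4, 6)]⟩

/-- None of these six graphs is an interval graph, and each has a matching that misses at most four
vertices (the edges `(2 * i, 2 * i + 1)` with `i + 4 < size`). -/
def patterns : List Pattern := [fourCycle, fiveCycle, longClaw, net, tent, umbrella]

/-- No pattern occurs in the subgraph induced by `S`. -/
def PatternFree (G : SimpleGraph V) (S : Finset V) : Prop :=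
  ∀ P ∈ patterns, ∀ f : ℕ → V, (∀ i < P.size, f i ∈ S) → ¬P.Occurs G f

theorem PatternFree.mono {S T : Finset V} (h : PatternFree G T) (hST : S ⊆ T) : PatternFree G S :=
  fun P hP f hf => h P hP f fun i hi => hST (hf i hi)

theorem PatternFree.no_fourCycle {S : Finset V} (h : PatternFree G S) {a b c d : V} (ha : a ∈ S)
    (hb : b ∈ S) (hc : c ∈ S) (hd : d ∈ S) (hab : G.Adj a b) (hbc : G.Adj b c) (hcd : G.Adj c d)
    (hda : G.Adj d a) (hac : a ≠ c) (hbd : b ≠ d) (hac' : ¬G.Adj a c) : G.Adj b d := by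
  by_contra hbd'
  refine h fourCycle (by simp [patterns])
    (fun | 0 => a | 1 => b | 2 => c | _ => d) (fun i hi => ?_) (fun j hj i hij => ?_)
  · simp only [fourCycle] at hi
    interval_cases i <;> assumption
  · simp only [fourCycle] at hj
    interval_cases j <;> interval_cases i <;>
      simp [fourCycle, hab, hbc, hcd, hda.symm, hac, hbd, hac', hbd', hab.ne, hbc.ne, hcd.ne,
        hda.ne.symm]

theorem PatternFree.no_fiveCycle {S : Finset V} (h : PatternFree G S) {a b c d e : V} (ha : a ∈ S)
    (hb : b ∈ S) (hc : c ∈ S) (hd : d ∈ S) (he : e ∈ S) (hab : G.Adj a b) (hbc : G.Adj b c)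
    (hcd : G.Adj c d) (hde : G.Adj d e) (hea : G.Adj e a) (hac : ¬G.Adj a c) (hbd : ¬G.Adj b d)
    (hce : ¬G.Adj c e) (hda : ¬G.Adj d a) (heb : ¬G.Adj e b) : False := by
  have n1 : a ≠ c := by rintro rfl; exact hda hcd.symm
  have n2 : b ≠ d := by rintro rfl; exact heb hde.symm
  have n3 : c ≠ e := by rintro rfl; exact hac hea.symm
  have n4 : a ≠ d := by rintro rfl; exact hbd hab.symm
  have n5 : b ≠ e := by rintro rfl; exact hce hbc.symm
  refine h fiveCycle (by simp [patterns])
    (fun | 0 => a | 1 => b | 2 => c | 3 => d | _ => e) (fun i hi => ?_) (fun j hj i hij => ?_)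
  · simp only [fiveCycle] at hi
    interval_cases i <;> assumption
  · simp only [fiveCycle] at hj
    interval_cases j <;> interval_cases i <;>
      simp [fiveCycle, hab, hbc, hcd, hde, hea.symm, hac, hbd, hce, G.adj_comm a d, hda,
        G.adj_comm b e, heb, n1, n2, n3, n4, n5, hab.ne, hbc.ne, hcd.ne, hde.ne, hea.ne.symm]

/-- Three legs `p, p'`, `q, q'` and `r, r'` at a vertex `x`. -/
theorem PatternFree.no_longClaw {S : Finset V} (h : PatternFree G S) {x p p' q q' r r' : V}
    (mx : x ∈ S) (mp : p ∈ S) (mp' : p' ∈ S) (mq : q ∈ S) (mq' : q' ∈ S) (mr : r ∈ S) (mr' : r' ∈ S)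
    (hxp : G.Adj x p) (hxq : G.Adj x q) (hxr : G.Adj x r) (hp : G.Adj p p') (hq : G.Adj q q')
    (hr : G.Adj r r') (hxp' : ¬G.Adj x p') (hxq' : ¬G.Adj x q') (hxr' : ¬G.Adj x r')
    (hpq : ¬G.Adj p q) (hpq' : ¬G.Adj p q') (hpr : ¬G.Adj p r) (hpr' : ¬G.Adj p r')
    (hp'q : ¬G.Adj p' q) (hp'q' : ¬G.Adj p' q') (hp'r : ¬G.Adj p' r) (hp'r' : ¬G.Adj p' r')
    (hqr : ¬G.Adj q r) (hqr' : ¬G.Adj q r') (hq'r : ¬G.Adj q' r) (hq'r' : ¬G.Adj q' r') : False := by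
  have n1 : p' ≠ x := by rintro rfl; exact hp'q hxq
  have n2 : q' ≠ x := by rintro rfl; exact hq'r hxr
  have n3 : r' ≠ x := by rintro rfl; exact hpr' hxp.symm
  have n4 : p ≠ q := by rintro rfl; exact hp'q hp.symm
  have n5 : p ≠ q' := by rintro rfl; exact hxq' hxp
  have n6 : p ≠ r := by rintro rfl; exact hp'r hp.symm
  have n7 : p ≠ r' := by rintro rfl; exact hxr' hxp
  have n8 : p' ≠ q := by rintro rfl; exact hxp' hxq
  have n9 : p' ≠ q' := by rintro rfl; exact hp'q hq.symm
  have n10 : p' ≠ r := by rintro rfl; exact hxp' hxr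
  have n11 : p' ≠ r' := by rintro rfl; exact hp'r hr.symm
  have n12 : q ≠ r := by rintro rfl; exact hq'r hq.symm
  have n13 : q ≠ r' := by rintro rfl; exact hxr' hxq
  have n14 : q' ≠ r := by rintro rfl; exact hxq' hxr
  have n15 : q' ≠ r' := by rintro rfl; exact hq'r hr.symm
  refine h longClaw (by simp [patterns])
    (fun | 0 => p | 1 => p' | 2 => q | 3 => q' | 4 => r | 5 => r' | _ => x) (fun i hi => ?_)
    (fun j hj i hij => ?_)
  · simp only [longClaw] at hi
    interval_cases i <;> assumption
  · simp only [longClaw] at hj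
    interval_cases j <;> interval_cases i <;>
      simp [longClaw, hxp.symm, hxq.symm, hxr.symm, hp, hq, hr, G.adj_comm p' x, hxp',
        G.adj_comm q' x, hxq', G.adj_comm r' x, hxr', hpq, hpq', hpr, hpr', hp'q, hp'q', hp'r,
        hp'r', hqr, hqr', hq'r, hq'r', hxp.ne.symm, hxq.ne.symm, hxr.ne.symm, hp.ne, hq.ne, hr.ne,
        n1, n2, n3, n4, n5, n6, n7, n8, n9, n10, n11, n12, n13, n14, n15]

/-- A triangle `p, q, r` with pendant vertices `p'`, `q'`, `r'`. -/
theorem PatternFree.no_net {S : Finset V} (h : PatternFree G S) {p p' q q' r r' : V}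
    (mp : p ∈ S) (mp' : p' ∈ S) (mq : q ∈ S) (mq' : q' ∈ S) (mr : r ∈ S) (mr' : r' ∈ S)
    (hpq : G.Adj p q) (hpr : G.Adj p r) (hqr : G.Adj q r) (hp : G.Adj p p') (hq : G.Adj q q')
    (hr : G.Adj r r') (hpq' : ¬G.Adj p q') (hpr' : ¬G.Adj p r')
    (hp'q : ¬G.Adj p' q) (hp'q' : ¬G.Adj p' q') (hp'r : ¬G.Adj p' r) (hp'r' : ¬G.Adj p' r')
    (hqr' : ¬G.Adj q r') (hq'r : ¬G.Adj q' r) (hq'r' : ¬G.Adj q' r') : False := by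
  have n5 : p ≠ q' := by rintro rfl; exact hp'q' hp.symm
  have n7 : p ≠ r' := by rintro rfl; exact hp'r' hp.symm
  have n8 : p' ≠ q := by rintro rfl; exact hp'q' hq
  have n9 : p' ≠ q' := by rintro rfl; exact hp'q hq.symm
  have n10 : p' ≠ r := by rintro rfl; exact hp'r' hr
  have n11 : p' ≠ r' := by rintro rfl; exact hp'r hr.symm
  have n13 : q ≠ r' := by rintro rfl; exact hpr' hpq
  have n14 : q' ≠ r := by rintro rfl; exact hq'r' hr
  have n15 : q' ≠ r' := by rintro rfl; exact hq'r hr.symm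
  refine h net (by simp [patterns])
    (fun | 0 => p | 1 => p' | 2 => q | 3 => q' | 4 => r | _ => r') (fun i hi => ?_)
    (fun j hj i hij => ?_)
  · simp only [net] at hi
    interval_cases i <;> assumption
  · simp only [net] at hj
    interval_cases j <;> interval_cases i <;>
      simp [net, hpq, hpr, hqr, hp, hq, hr, hpq', hpr', hp'q, hp'q', hp'r, hp'r', hqr', hq'r, hq'r',
        hpq.ne, hpr.ne, hqr.ne, hp.ne, hq.ne, hr.ne, n5, n7, n8, n9, n10, n11, n13, n14, n15]

/-- A triangle `p, q, r` with further triangles `p, a, q`, `q, b, r` and `r, c, p`. -/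
theorem PatternFree.no_tent {S : Finset V} (h : PatternFree G S) {p a q b r c : V}
    (mp : p ∈ S) (ma : a ∈ S) (mq : q ∈ S) (mb : b ∈ S) (mr : r ∈ S) (mc : c ∈ S)
    (hpq : G.Adj p q) (hpr : G.Adj p r) (hqr : G.Adj q r) (hap : G.Adj a p) (haq : G.Adj a q)
    (hbq : G.Adj b q) (hbr : G.Adj b r) (hcr : G.Adj c r) (hcp : G.Adj c p) (har : ¬G.Adj a r)
    (hbp : ¬G.Adj b p) (hcq : ¬G.Adj c q) (hab : ¬G.Adj a b) (hbc : ¬G.Adj b c)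
    (hac : ¬G.Adj a c) : False := by
  have n1 : a ≠ r := by rintro rfl; exact hac hcr.symm
  have n2 : b ≠ p := by rintro rfl; exact hab hap
  have n3 : c ≠ q := by rintro rfl; exact hbc hbq
  have n4 : a ≠ b := by rintro rfl; exact har hbr
  have n5 : b ≠ c := by rintro rfl; exact hbp hcp
  have n6 : a ≠ c := by rintro rfl; exact har hcr
  refine h tent (by simp [patterns])
    (fun | 0 => p | 1 => a | 2 => q | 3 => b | 4 => r | _ => c) (fun i hi => ?_)
    (fun j hj i hij => ?_)
  · simp only [tent] at hi
    interval_cases i <;> assumption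
  · simp only [tent] at hj
    interval_cases j <;> interval_cases i <;>
      simp [tent, hpq, hpr, hqr, hap.symm, haq, hbq.symm, hbr, hcr.symm, hcp.symm, har,
        G.adj_comm p b, hbp, G.adj_comm q c, hcq, hab, hbc, hac, hpq.ne, hpr.ne, hqr.ne,
        hap.ne.symm, haq.ne, hbq.ne.symm, hbr.ne, hcr.ne.symm, hcp.ne.symm, n1, n2.symm, n3.symm,
        n4, n5, n6]

/-- A path `p', p, x, q, q'`, a vertex `k` adjacent to all of it, and a vertex `d` adjacent to `x`
only. -/
theorem PatternFree.no_umbrella {S : Finset V} (h : PatternFree G S) {x p p' q q' d k : V}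
    (mx : x ∈ S) (mp : p ∈ S) (mp' : p' ∈ S) (mq : q ∈ S) (mq' : q' ∈ S) (md : d ∈ S) (mk : k ∈ S)
    (hxp : G.Adj x p) (hxq : G.Adj x q) (hxd : G.Adj x d) (hp : G.Adj p p') (hq : G.Adj q q')
    (hkx : G.Adj k x) (hkp : G.Adj k p) (hkp' : G.Adj k p') (hkq : G.Adj k q) (hkq' : G.Adj k q')
    (hxp' : ¬G.Adj x p') (hxq' : ¬G.Adj x q') (hpq : ¬G.Adj p q) (hpq' : ¬G.Adj p q')
    (hp'q : ¬G.Adj p' q) (hp'q' : ¬G.Adj p' q') (hdp : ¬G.Adj d p) (hdp' : ¬G.Adj d p')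
    (hdq : ¬G.Adj d q) (hdq' : ¬G.Adj d q') (hkd : k ≠ d) : G.Adj k d := by
  by_contra hkd'
  have n1 : p' ≠ x := by rintro rfl; exact hp'q hxq
  have n2 : q' ≠ x := by rintro rfl; exact hpq' hxp.symm
  have n4 : p ≠ q := by rintro rfl; exact hp'q hp.symm
  have n5 : p ≠ q' := by rintro rfl; exact hxq' hxp
  have n8 : p' ≠ q := by rintro rfl; exact hxp' hxq
  have n9 : p' ≠ q' := by rintro rfl; exact hp'q hq.symm
  have n10 : p ≠ d := by rintro rfl; exact hdp' hp
  have n11 : p' ≠ d := by rintro rfl; exact hxp' hxd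
  have n12 : q ≠ d := by rintro rfl; exact hdq' hq
  have n13 : q' ≠ d := by rintro rfl; exact hxq' hxd
  refine h umbrella (by simp [patterns])
    (fun | 0 => p | 1 => p' | 2 => q | 3 => q' | 4 => x | 5 => d | _ => k) (fun i hi => ?_)
    (fun j hj i hij => ?_)
  · simp only [umbrella] at hi
    interval_cases i <;> assumption
  · simp only [umbrella] at hj
    interval_cases j <;> interval_cases i <;>
      simp [umbrella, hxp.symm, hxq.symm, hxd, hp, hq, hkx.symm, hkp.symm, hkp'.symm, hkq.symm,
        hkq'.symm, G.adj_comm p' x, hxp', G.adj_comm q' x, hxq', hpq, hpq', hp'q, hp'q',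
        G.adj_comm p d, hdp, G.adj_comm p' d, hdp', G.adj_comm q d, hdq, G.adj_comm q' d, hdq',
        G.adj_comm d k, hkd', hkd.symm, hxp.ne.symm, hxq.ne.symm, hxd.ne, hp.ne, hq.ne,
        hkx.ne.symm, hkp.ne.symm, hkp'.ne.symm, hkq.ne.symm, hkq'.ne.symm,
        n1, n2, n4, n5, n8, n9, n10, n11, n12, n13]

end Graph

/-! ### Holes in graphs without the patterns -/

namespace Graph

open SimpleGraph

variable {V : Type} {G : SimpleGraph V} {S : Finset V}

theorem PatternFree.six_le (hS : PatternFree G S) {c : ℕ → V} {k : ℕ} (hc : IsHole G c k)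
    (hcS : ∀ i < k, c i ∈ S) : 6 ≤ k := by
  have h4 := hc.four_le
  by_contra hk
  have : k = 4 ∨ k = 5 := by omega
  rcases this with rfl | rfl
  · exact absurd (hS.no_fourCycle (hcS 0 (by omega)) (hcS 1 (by omega)) (hcS 2 (by omega))
      (hcS 3 (by omega)) (hc.adj 0 1) (hc.adj 1 2) (hc.adj 2 3) (hc.adj 3 0) (hc.ne 0 2) (hc.ne 1 3)
      (hc.nadj 0 2)) (hc.nadj 1 3)
  · exact hS.no_fiveCycle (hcS 0 (by omega)) (hcS 1 (by omega)) (hcS 2 (by omega))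
      (hcS 3 (by omega)) (hcS 4 (by omega)) (hc.adj 0 1) (hc.adj 1 2) (hc.adj 2 3) (hc.adj 3 4)
      (hc.adj 4 0) (hc.nadj 0 2) (hc.nadj 1 3) (hc.nadj 2 4) (hc.nadj 3 0) (hc.nadj 4 1)

/-- The neighbours on a hole of a vertex that has some but not all of the hole as neighbours are
consecutive, and at least three vertices of the hole are not among them. -/
theorem PatternFree.exists_rotation (hS : PatternFree G S) {c : ℕ → V} {k : ℕ} (hc : IsHole G c k)
    (hcS : ∀ i < k, c i ∈ S) {v : V} (hv : v ∈ S) (hvc : ∀ i < k, v ≠ c i)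
    (h1 : ∃ i < k, G.Adj v (c i)) (h0 : ∃ i < k, ¬G.Adj v (c i)) :
    ∃ c' g, IsHole G c' k ∧ SameRange c c' k ∧ 3 ≤ g ∧ g < k ∧
      ∀ i < k, (G.Adj v (c' i) ↔ g ≤ i) := by
  classical
  have h6 := hS.six_le hc hcS
  -- rotate so that the first vertex is not a neighbour and the last one is
  obtain ⟨c', hc', hr, hlast, hfirst⟩ : ∃ c', IsHole G c' k ∧ SameRange c c' k ∧
      G.Adj v (c' (k - 1)) ∧ ¬G.Adj v (c' 0) := by
    obtain ⟨j, hj, hjv⟩ := h0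
    have hd := hc.rotate (s := j) hj.le
    have hdr := sameRange_rotate c (k := k) (s := j) hj.le
    have hd0 : ¬G.Adj v (rotate c k j 0) := by simpa [rotate, hj] using hjv
    set d := rotate c k j
    have hex : ∃ m, m < k ∧ G.Adj v (d (k - 1 - m)) := by
      obtain ⟨i, hi, hiv⟩ := h1
      obtain ⟨l, hl, e⟩ := hdr.2 i hi
      exact ⟨k - 1 - l, by omega, by rw [show k - 1 - (k - 1 - l) = l by omega, ← e]; exact hiv⟩
    obtain ⟨hmk, hm⟩ := Nat.find_spec hex
    have hmin := fun t ht => Nat.find_min (H := hex) (m := t) ht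
    set m := Nat.find hex
    have hne : k - 1 - m ≠ 0 := fun h => hd0 (h ▸ hm)
    refine ⟨rotate d k (k - m), hd.rotate (by omega), hdr.trans (sameRange_rotate d (by omega)), ?_,
      ?_⟩
    · unfold rotate
      split_ifs with h
      · have : m = 0 ∨ m ≠ 0 := by omega
        omega
      · rw [show k - 1 + (k - m) - k = k - 1 - m by omega]
        exact hm
    · unfold rotate
      split_ifs with h
      · have := hmin (m - 1) (by omega)
        rw [show k - 1 - (m - 1) = 0 + (k - m) by omega] at this
        exact fun h => this ⟨by omega, h⟩
      · rw [show 0 + (k - m) - k = 0 by omega]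
        exact hd0
  have hcS' : ∀ i < k, c' i ∈ S := fun i hi => by
    obtain ⟨j, hj, e⟩ := hr.1 i hi
    exact e ▸ hcS j hj
  have hvc' : ∀ i < k, v ≠ c' i := fun i hi => by
    obtain ⟨j, hj, e⟩ := hr.1 i hi
    exact e ▸ hvc j hj
  have hex : ∃ g, g < k ∧ G.Adj v (c' g) := ⟨k - 1, by omega, hlast⟩
  obtain ⟨hgk, hg⟩ := Nat.find_spec hex
  have hgmin : ∀ t < Nat.find hex, ¬G.Adj v (c' t) := fun t ht h =>
    Nat.find_min (H := hex) (m := t) ht ⟨by omega, h⟩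
  set g := Nat.find hex
  have hg0 : g ≠ 0 := fun h => hfirst (h ▸ hg)
  have hg3 : 3 ≤ g := by
    by_contra hlt
    have : g = 1 ∨ g = 2 := by omega
    rcases this with h | h <;> rw [h] at hg hgmin
    · exact hfirst (hS.no_fourCycle (hcS' (k - 1) (by omega)) hv (hcS' 1 (by omega))
        (hcS' 0 (by omega)) hlast.symm hg (hc'.adj 1 0) (hc'.adj 0 (k - 1)) (hc'.ne _ _)
        (hvc' 0 (by omega)) (hc'.nadj _ _))
    · exact hS.no_fiveCycle hv (hcS' (k - 1) (by omega)) (hcS' 0 (by omega))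
        (hcS' 1 (by omega)) (hcS' 2 (by omega)) hlast (hc'.adj _ _) (hc'.adj _ _) (hc'.adj _ _)
        hg.symm hfirst (hc'.nadj _ _) (hc'.nadj _ _) (fun h => hgmin 1 (by omega) h.symm)
        (hc'.nadj _ _)
  refine ⟨c', g, hc', hr, hg3, hgk, fun i hi => ⟨fun h => ?_, fun hgi => ?_⟩⟩
  · by_contra hlt
    exact hgmin i (by omega) h
  by_contra hi0
  -- a second gap, from `a + 1` to `b - 1`, yields three legs
  have hex₂ : ∃ a, g ≤ a ∧ a < k ∧ ¬G.Adj v (c' a) := ⟨i, hgi, hi, hi0⟩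
  obtain ⟨ha1, ha2, ha3⟩ := Nat.find_spec hex₂
  have hamin : ∀ t < Nat.find hex₂, g ≤ t → G.Adj v (c' t) := fun t ht hgt => by
    by_contra h
    exact Nat.find_min (H := hex₂) (m := t) ht ⟨hgt, by omega, h⟩
  set a' := Nat.find hex₂
  have hag : a' ≠ g := fun h => ha3 (h ▸ hg)
  have hex₃ : ∃ b, a' ≤ b ∧ b < k ∧ G.Adj v (c' b) := ⟨k - 1, by omega, by omega, hlast⟩
  obtain ⟨hb1, hb2, hb3⟩ := Nat.find_spec hex₃
  have hbmin : ∀ t < Nat.find hex₃, a' ≤ t → ¬G.Adj v (c' t) := fun t ht hgt h =>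
    Nat.find_min (H := hex₃) (m := t) ht ⟨hgt, by omega, h⟩
  set b := Nat.find hex₃
  have hba : b ≠ a' := fun h => ha3 (h ▸ hb3)
  clear_value b a'
  obtain ⟨a, rfl⟩ : ∃ a, a' = a + 1 := ⟨a' - 1, by omega⟩
  have hva : G.Adj v (c' a) := hamin a (by omega) (by omega)
  have hb4 : a + 4 ≤ b := by
    by_contra hlt
    have : b = a + 2 ∨ b = a + 3 := by omega
    rcases this with h | h <;> rw [h] at hb3 hbmin hb2
    · exact ha3 (hS.no_fourCycle (hcS' a (by omega)) hv (hcS' (a + 2) (by omega))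
        (hcS' (a + 1) (by omega)) hva.symm hb3 (hc'.adj _ _) (hc'.adj _ _) (hc'.ne _ _)
        (hvc' _ (by omega)) (hc'.nadj _ _))
    · exact hS.no_fiveCycle hv (hcS' a (by omega)) (hcS' (a + 1) (by omega))
        (hcS' (a + 2) (by omega)) (hcS' (a + 3) (by omega)) hva (hc'.adj _ _) (hc'.adj _ _)
        (hc'.adj _ _) hb3.symm ha3 (hc'.nadj _ _) (hc'.nadj _ _)
        (fun h => hbmin (a + 2) (by omega) (by omega) h.symm) (hc'.nadj _ _)
  have m := fun i (hi : i < k) => hcS' i hi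
  by_cases hag1 : a = g
  · rw [hag1] at hb4 hbmin hva ha3
    exact hS.no_longClaw (m g hgk) (m (g + 1) (by omega)) (m (g + 2) (by omega))
      (m (g - 1) (by omega)) (m (g - 2) (by omega)) hv (m b hb2) (hc'.adj _ _) (hc'.adj _ _) hg.symm
      (hc'.adj _ _) (hc'.adj _ _) hb3 (hc'.nadj _ _) (hc'.nadj _ _) (hc'.nadj _ _) (hc'.nadj _ _)
      (hc'.nadj _ _) (fun h => ha3 h.symm) (hc'.nadj _ _) (hc'.nadj _ _) (hc'.nadj _ _)
      (fun h => hbmin (g + 2) (by omega) (by omega) h.symm) (hc'.nadj _ _)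
      (fun h => hgmin (g - 1) (by omega) h.symm) (hc'.nadj _ _)
      (fun h => hgmin (g - 2) (by omega) h.symm) (hc'.nadj _ _)
  by_cases hag2 : a = g + 1
  · rw [hag2] at hb4 hbmin hva ha3
    exact hS.no_net (m g hgk) (m (g - 1) (by omega)) (m (g + 1) (by omega)) (m (g + 2) (by omega))
      hv (m b hb2) (hc'.adj _ _) hg.symm hva.symm (hc'.adj _ _) (hc'.adj _ _) hb3 (hc'.nadj _ _)
      (hc'.nadj _ _) (hc'.nadj _ _) (hc'.nadj _ _) (fun h => hgmin (g - 1) (by omega) h.symm)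
      (hc'.nadj _ _) (hc'.nadj _ _) (fun h => ha3 h.symm) (hc'.nadj _ _)
  · exact hS.no_longClaw hv (m g hgk) (m (g - 1) (by omega)) (m a (by omega))
      (m (a + 1) (by omega)) (m b hb2) (m (b - 1) (by omega)) hg hva hb3 (hc'.adj _ _)
      (hc'.adj _ _) (hc'.adj _ _) (hgmin (g - 1) (by omega)) ha3
      (hbmin (b - 1) (by omega) (by omega)) (hc'.nadj _ _) (hc'.nadj _ _) (hc'.nadj _ _)
      (hc'.nadj _ _) (hc'.nadj _ _) (hc'.nadj _ _) (hc'.nadj _ _) (hc'.nadj _ _) (hc'.nadj _ _)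
      (hc'.nadj _ _) (hc'.nadj _ _) (hc'.nadj _ _)

/-- `x` is adjacent to all of the hole. -/
def Complete (G : SimpleGraph V) (c : ℕ → V) (k : ℕ) (x : V) : Prop := ∀ i < k, G.Adj x (c i)

/-- `x` is a vertex of the hole or adjacent to one. -/
def Near (G : SimpleGraph V) (c : ℕ → V) (k : ℕ) (x : V) : Prop :=
  ∃ i < k, x = c i ∨ G.Adj x (c i)

section
variable (hS : PatternFree G S) {c : ℕ → V} {k : ℕ} (hc : IsHole G c k) (hcS : ∀ i < k, c i ∈ S)
include hS hc hcS

theorem PatternFree.adj_of_complete {x y : V} (hx : x ∈ S) (hy : y ∈ S) (hxc : Complete G c k x)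
    (hyc : Complete G c k y) (hxy : x ≠ y) : G.Adj x y := by
  have := hc.four_le
  exact hS.no_fourCycle (hcS 0 (by omega)) hx (hcS 2 (by omega)) hy (hxc 0 (by omega)).symm
    (hxc 2 (by omega)) (hyc 2 (by omega)).symm (hyc 0 (by omega)) (hc.ne 0 2) hxy (hc.nadj 0 2)

/-- A vertex adjacent to all of the hole is adjacent to all vertices near the hole. -/
theorem PatternFree.adj_of_complete_of_near {x v : V} (hx : x ∈ S) (hv : v ∈ S)
    (hxc : Complete G c k x) (hvn : Near G c k v) (hxv : x ≠ v) : G.Adj x v := by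
  by_cases hvc : Complete G c k v
  · exact hS.adj_of_complete hc hcS hx hv hxc hvc hxv
  by_cases hvC : ∃ i < k, v = c i
  · obtain ⟨i, hi, rfl⟩ := hvC
    exact hxc i hi
  push Not at hvC
  have h0 : ∃ i < k, ¬G.Adj v (c i) := by simpa [Complete] using hvc
  have h1 : ∃ i < k, G.Adj v (c i) := by
    obtain ⟨i, hi, h⟩ := hvn
    exact ⟨i, hi, h.resolve_left (hvC i hi)⟩
  obtain ⟨c', g, hc', hr, hg3, hgk, hadj⟩ := hS.exists_rotation hc hcS hv hvC h1 h0
  have m : ∀ i < k, c' i ∈ S := fun i hi => by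
    obtain ⟨j, hj, e⟩ := hr.1 i hi
    exact e ▸ hcS j hj
  have hx' : ∀ i < k, G.Adj x (c' i) := fun i hi => by
    obtain ⟨j, hj, e⟩ := hr.1 i hi
    exact e ▸ hxc j hj
  have h6 := hS.six_le hc hcS
  have yes : ∀ i < k, g ≤ i → G.Adj v (c' i) := fun i hi h => (hadj i hi).2 h
  have no : ∀ i < k, i < g → ¬G.Adj v (c' i) := fun i hi h h' => by
    have := (hadj i hi).1 h'
    omega
  have hg : g = k - 1 ∨ g = k - 2 ∨ g + 3 ≤ k := by omega
  rcases hg with hg | hg | hg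
  · exact hS.no_umbrella (m (k - 1) (by omega)) (m 0 (by omega)) (m 1 (by omega))
      (m (k - 2) (by omega)) (m (k - 3) (by omega)) hv hx (hc'.adj _ _) (hc'.adj _ _)
      (yes _ (by omega) (by omega)).symm (hc'.adj _ _) (hc'.adj _ _) (hx' _ (by omega))
      (hx' _ (by omega)) (hx' _ (by omega)) (hx' _ (by omega)) (hx' _ (by omega)) (hc'.nadj _ _)
      (hc'.nadj _ _) (hc'.nadj _ _) (hc'.nadj _ _) (hc'.nadj _ _) (hc'.nadj _ _)
      (no _ (by omega) (by omega)) (no _ (by omega) (by omega)) (no _ (by omega) (by omega))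
      (no _ (by omega) (by omega)) hxv
  · by_contra hcon
    exact hS.no_tent (m (k - 2) (by omega)) hv (m (k - 1) (by omega)) (m 0 (by omega)) hx
      (m (k - 3) (by omega)) (hc'.adj _ _) (hx' _ (by omega)).symm (hx' _ (by omega)).symm
      (yes _ (by omega) (by omega)) (yes _ (by omega) (by omega)) (hc'.adj _ _)
      (hx' _ (by omega)).symm (hx' _ (by omega)).symm (hc'.adj _ _) (fun h => hcon h.symm)
      (hc'.nadj _ _) (hc'.nadj _ _) (no _ (by omega) (by omega)) (hc'.nadj _ _)
      (no _ (by omega) (by omega))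
  · exact (hS.no_fourCycle (m (k - 1) (by omega)) hv (m g hgk) hx
      (yes _ (by omega) (by omega)).symm (yes _ hgk le_rfl) (hx' _ hgk).symm (hx' _ (by omega))
      (hc'.ne _ _) hxv.symm (hc'.nadj _ _)).symm

/-- If a neighbour `u` of `v` is not near the hole, then `v` has two nonadjacent neighbours `p` and
`q` on the hole from which the hole can be left at `p'` and `q'`. -/
theorem PatternFree.exists_legs {u v : V} (hu : u ∈ S) (hv : v ∈ S) (hvc : ¬Complete G c k v)
    (hvn : Near G c k v) (hun : ¬Near G c k u) (hvu : G.Adj v u) :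
    ∃ p p' q q', (∃ i < k, p = c i) ∧ (∃ i < k, p' = c i) ∧ (∃ i < k, q = c i) ∧
      (∃ i < k, q' = c i) ∧ G.Adj v p ∧ G.Adj v q ∧ G.Adj p p' ∧ G.Adj q q' ∧ ¬G.Adj v p' ∧
      ¬G.Adj v q' ∧ ¬G.Adj p q ∧ ¬G.Adj p q' ∧ ¬G.Adj p' q ∧ ¬G.Adj p' q' := by
  have hvC : ∀ i < k, v ≠ c i := by
    rintro i hi rfl
    exact hun ⟨i, hi, .inr hvu.symm⟩
  have h0 : ∃ i < k, ¬G.Adj v (c i) := by simpa [Complete] using hvc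
  have h1 : ∃ i < k, G.Adj v (c i) := by
    obtain ⟨i, hi, h⟩ := hvn
    exact ⟨i, hi, h.resolve_left (hvC i hi)⟩
  obtain ⟨c', g, hc', hr, hg3, hgk, hadj⟩ := hS.exists_rotation hc hcS hv hvC h1 h0
  have m : ∀ i < k, c' i ∈ S := fun i hi => by
    obtain ⟨j, hj, e⟩ := hr.1 i hi
    exact e ▸ hcS j hj
  have hu' : ∀ i < k, ¬G.Adj (c' i) u := fun i hi h => by
    obtain ⟨j, hj, e⟩ := hr.1 i hi
    exact hun ⟨j, hj, .inr (e ▸ h.symm)⟩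
  have h6 := hS.six_le hc hcS
  have yes : ∀ i < k, g ≤ i → G.Adj v (c' i) := fun i hi h => (hadj i hi).2 h
  have no : ∀ i < k, i < g → ¬G.Adj v (c' i) := fun i hi h h' => by
    have := (hadj i hi).1 h'
    omega
  have hg : g = k - 1 ∨ g = k - 2 ∨ g + 3 ≤ k := by omega
  rcases hg with hg | hg | hg
  · exact (hS.no_longClaw (m (k - 1) (by omega)) (m 0 (by omega)) (m 1 (by omega))
      (m (k - 2) (by omega)) (m (k - 3) (by omega)) hv hu (hc'.adj _ _) (hc'.adj _ _)
      (yes _ (by omega) (by omega)).symm (hc'.adj _ _) (hc'.adj _ _) hvu (hc'.nadj _ _)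
      (hc'.nadj _ _) (hu' _ (by omega)) (hc'.nadj _ _) (hc'.nadj _ _)
      (fun h => no 0 (by omega) (by omega) h.symm) (hu' _ (by omega)) (hc'.nadj _ _) (hc'.nadj _ _)
      (fun h => no 1 (by omega) (by omega) h.symm) (hu' _ (by omega))
      (fun h => no (k - 2) (by omega) (by omega) h.symm) (hu' _ (by omega))
      (fun h => no (k - 3) (by omega) (by omega) h.symm) (hu' _ (by omega))).elim
  · exact (hS.no_net (m (k - 1) (by omega)) (m 0 (by omega)) (m (k - 2) (by omega))
      (m (k - 3) (by omega)) hv hu (hc'.adj _ _) (yes _ (by omega) (by omega)).symm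
      (yes _ (by omega) (by omega)).symm (hc'.adj _ _) (hc'.adj _ _) hvu (hc'.nadj _ _)
      (hu' _ (by omega)) (hc'.nadj _ _) (hc'.nadj _ _)
      (fun h => no 0 (by omega) (by omega) h.symm) (hu' _ (by omega)) (hu' _ (by omega))
      (fun h => no (k - 3) (by omega) (by omega) h.symm) (hu' _ (by omega))).elim
  · exact ⟨c' (k - 1), c' 0, c' g, c' (g - 1), hr.1 _ (by omega), hr.1 _ (by omega),
      hr.1 _ (by omega), hr.1 _ (by omega), yes _ (by omega) (by omega), yes _ hgk le_rfl,
      hc'.adj _ _, hc'.adj _ _, no _ (by omega) (by omega), no _ (by omega) (by omega),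
      hc'.nadj _ _, hc'.nadj _ _, hc'.nadj _ _, hc'.nadj _ _⟩

/-- A vertex that reaches beyond the vertices near the hole is adjacent to a whole component
there. -/
theorem PatternFree.adj_of_not_near {u v z : V} (hu : u ∈ S) (hv : v ∈ S) (hz : z ∈ S)
    (hvc : ¬Complete G c k v) (hvn : Near G c k v) (hun : ¬Near G c k u) (hzn : ¬Near G c k z)
    (hvu : G.Adj v u) (huz : G.Adj u z) : G.Adj v z := by
  by_contra hvz
  obtain ⟨p, p', q, q', ⟨i, hi, ep⟩, ⟨i', hi', ep'⟩, ⟨j, hj, eq⟩, ⟨j', hj', eq'⟩, h⟩ :=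
    hS.exists_legs hc hcS hu hv hvc hvn hun hvu
  have far : ∀ w, ¬Near G c k w → ∀ a, ∀ i < k, a = c i → ¬G.Adj a w := by
    rintro w hw a i hi rfl h
    exact hw ⟨i, hi, .inr h.symm⟩
  have hu' := far u hun
  have hz' := far z hzn
  obtain ⟨a1, a2, a3, a4, a5, a6, a7, a8, a9, a10⟩ := h
  exact hS.no_longClaw hv (ep ▸ hcS i hi) (ep' ▸ hcS i' hi') (eq ▸ hcS j hj) (eq' ▸ hcS j' hj') hu hz
    a1 a2 hvu a3 a4 huz a5 a6 hvz a7 a8 (hu' _ _ hi ep) (hz' _ _ hi ep) a9 a10 (hu' _ _ hi' ep')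
    (hz' _ _ hi' ep') (hu' _ _ hj eq) (hz' _ _ hj eq) (hu' _ _ hj' eq') (hz' _ _ hj' eq')

theorem PatternFree.adj_of_complete_of_not_near {u v x : V} (hu : u ∈ S) (hv : v ∈ S) (hx : x ∈ S)
    (hvc : ¬Complete G c k v) (hvn : Near G c k v) (hun : ¬Near G c k u) (hvu : G.Adj v u)
    (hxc : Complete G c k x) : G.Adj x u := by
  obtain ⟨p, p', q, q', ⟨i, hi, rfl⟩, ⟨i', hi', rfl⟩, ⟨j, hj, rfl⟩, ⟨j', hj', rfl⟩, h⟩ :=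
    hS.exists_legs hc hcS hu hv hvc hvn hun hvu
  have hu' : ∀ i < k, ¬G.Adj u (c i) := fun i hi h => hun ⟨i, hi, .inr h⟩
  have hxv : x ≠ v := by rintro rfl; exact hvc hxc
  have hxu : x ≠ u := by rintro rfl; exact hu' i hi (hxc i hi)
  obtain ⟨a1, a2, a3, a4, a5, a6, a7, a8, a9, a10⟩ := h
  exact hS.no_umbrella hv (hcS _ hi) (hcS _ hi') (hcS _ hj) (hcS _ hj') hu hx a1 a2 hvu a3 a4
    (hS.adj_of_complete_of_near hc hcS hx hv hxc hvn hxv) (hxc _ hi) (hxc _ hi') (hxc _ hj)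
    (hxc _ hj') a5 a6 a7 a8 a9 a10 (hu' _ hi) (hu' _ hi') (hu' _ hj) (hu' _ hj') hxu

theorem PatternFree.adj_of_common_not_near {u v y : V} (hu : u ∈ S) (hv : v ∈ S) (hy : y ∈ S)
    (hvc : ¬Complete G c k v) (hvn : Near G c k v) (hun : ¬Near G c k u) (hvu : G.Adj v u)
    (hyu : G.Adj y u) (hvy : v ≠ y) : G.Adj v y := by
  by_contra hcon
  obtain ⟨p, p', q, q', ⟨i, hi, rfl⟩, ⟨i', hi', rfl⟩, ⟨j, hj, rfl⟩, ⟨j', hj', rfl⟩, h⟩ :=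
    hS.exists_legs hc hcS hu hv hvc hvn hun hvu
  have hu' : ∀ i < k, ¬G.Adj (c i) u := fun i hi h => hun ⟨i, hi, .inr h.symm⟩
  have hu'' : ∀ i < k, c i ≠ u := by rintro i hi rfl; exact hun ⟨i, hi, .inl rfl⟩
  obtain ⟨a1, a2, a3, a4, a5, a6, a7, a8, a9, a10⟩ := h
  have n1 : ∀ i < k, G.Adj v (c i) → ¬G.Adj (c i) y := fun i hi h1 h2 =>
    hu' i hi (hS.no_fourCycle hv (hcS i hi) hy hu h1 h2 hyu hvu.symm hvy (hu'' i hi) hcon)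
  have n2 : ∀ i < k, ∀ j < k, G.Adj v (c i) → G.Adj (c i) (c j) → ¬G.Adj v (c j) →
      ¬G.Adj (c j) y := fun i hi j hj h1 h2 h3 h4 =>
    hS.no_fiveCycle hv (hcS i hi) (hcS j hj) hy hu h1 h2 h4 hyu hvu.symm h3 (n1 i hi h1)
      (hu' j hj) (fun h => hcon h.symm) (fun h => hu' i hi h.symm)
  exact hS.no_longClaw hv (hcS _ hi) (hcS _ hi') (hcS _ hj) (hcS _ hj') hu hy a1 a2 hvu a3 a4
    hyu.symm a5 a6 hcon a7 a8 (hu' _ hi) (n1 _ hi a1) a9 a10 (hu' _ hi') (n2 _ hi _ hi' a1 a3 a5)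
    (hu' _ hj) (n1 _ hj a2) (hu' _ hj') (n2 _ hj _ hj' a2 a4 a6)

end

end Graph

/-! ### Minimal clique modules of graphs without the patterns -/

namespace Graph

open SimpleGraph

variable {V : Type} {G : SimpleGraph V} {S R : Finset V}

/-- In a graph without the patterns, every hole in a minimal clique module `R` dominates `R`.

Let `K` be the set of vertices complete to the hole. The component of the hole in `S \ K` is a
clique module inside `R`, hence equal to `R`. If some `d ∈ R` is not near the hole, then the
component of `d` among the vertices that are not near the hole is a clique module as well, and it
is properly contained in `R`. -/
theorem IsMinCliqueModule.near (hS : PatternFree G S) (hR : IsMinCliqueModule G S R) {c : ℕ → V}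
    {k : ℕ} (hc : IsHole G c k) (hcR : ∀ i < k, c i ∈ R) : ∀ d ∈ R, Near G c k d := by
  classical
  have hcS : ∀ i < k, c i ∈ S := fun i hi => hR.sub (hcR i hi)
  have h4 := hc.four_le
  have hcK : ∀ i < k, ¬Complete G c k (c i) := fun i hi h => G.loopless.irrefl _ (h i hi)
  have hKnear : ∀ x, Complete G c k x → Near G c k x := fun x hx =>
    ⟨0, by omega, .inr (hx 0 (by omega))⟩
  let r : V → V → Prop := fun a b => G.Adj a b ∧ b ∈ S ∧ ¬Complete G c k b
  let Q : Finset V := S.filter fun z => Relation.ReflTransGen r (c 0) z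
  have hQ : ∀ z, z ∈ Q ↔ z ∈ S ∧ Relation.ReflTransGen r (c 0) z := fun z => Finset.mem_filter
  have hQstep : ∀ a ∈ Q, ∀ b ∈ S, G.Adj a b → ¬Complete G c k b → b ∈ Q := fun a ha b hb hab hbK =>
    (hQ b).2 ⟨hb, ((hQ a).1 ha).2.tail ⟨hab, hb, hbK⟩⟩
  have hcQ : ∀ i < k, c i ∈ Q := by
    intro i hi
    induction i with
    | zero => exact (hQ _).2 ⟨hcS 0 hi, .refl⟩
    | succ i ih => exact hQstep _ (ih (by omega)) _ (hcS _ hi) (hc.adj i (i + 1)) (hcK _ hi)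
  have hQK : ∀ z ∈ Q, ¬Complete G c k z := by
    intro z hz
    rcases Relation.ReflTransGen.cases_tail ((hQ z).1 hz).2 with h | ⟨y, _, h⟩
    · exact h ▸ hcK 0 (by omega)
    · exact h.2.2
  -- a vertex of `Q` that is not near the hole has a neighbour near the hole
  have hQnear : ∀ z ∈ Q, Near G c k z ∨
      ∃ v ∈ S, ¬Complete G c k v ∧ Near G c k v ∧ G.Adj v z := by
    intro z hz
    have hz' := ((hQ z).1 hz).2
    clear hz
    induction hz' with
    | refl => exact .inl ⟨0, by omega, .inl rfl⟩
    | @tail y z hy hyz ih =>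
      by_cases hzn : Near G c k z
      · exact .inl hzn
      have hyQ : y ∈ Q := by
        rcases Relation.ReflTransGen.cases_tail hy with h | ⟨w, _, h⟩
        · exact h ▸ hcQ 0 (by omega)
        · exact (hQ y).2 ⟨h.2.1, hy⟩
      have hyS := ((hQ y).1 hyQ).1
      by_cases hyn : Near G c k y
      · exact .inr ⟨y, hyS, hQK y hyQ, hyn, hyz.1⟩
      · obtain ⟨v, hv, hvK, hvn, hvy⟩ := ih.resolve_left hyn
        exact .inr ⟨v, hv, hvK, hvn,
          hS.adj_of_not_near hc hcS hyS hv hyz.2.1 hvK hvn hyn hzn hvy hyz.1⟩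
  have hKQ : ∀ x ∈ S, Complete G c k x → ∀ z ∈ Q, G.Adj x z := by
    intro x hx hxK z hz
    have hzS := ((hQ z).1 hz).1
    have hxz : x ≠ z := by rintro rfl; exact hQK _ hz hxK
    by_cases hzn : Near G c k z
    · exact hS.adj_of_complete_of_near hc hcS hx hzS hxK hzn hxz
    · obtain ⟨v, hv, hvK, hvn, hvz⟩ := (hQnear z hz).resolve_left hzn
      exact hS.adj_of_complete_of_not_near hc hcS hzS hv hx hvK hvn hzn hvz hxK
  have hQmod : IsCliqueModule G S Q := by
    have hK : ∀ b ∈ S, b ∉ Q → (∃ z ∈ Q, G.Adj b z) → Complete G c k b := by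
      rintro b hb hbQ ⟨z, hz, hbz⟩
      by_contra hcon
      exact hbQ (hQstep z hz b hb hbz.symm hcon)
    refine .of_adj (Finset.filter_subset _ _) ⟨c 0, hcQ 0 (by omega)⟩ (fun b hb hbQ h z hz => ?_)
      fun b hb hbQ y hy hyQ h h' hby => ?_
    · exact hKQ b hb (hK b hb hbQ h) z hz
    · exact hS.adj_of_complete hc hcS hb hy (hK b hb hbQ h) (hK y hy hyQ h') hby
  have hQR : Q ⊆ R := by
    intro z hz
    have hz' := ((hQ z).1 hz).2
    clear hz
    induction hz' with
    | refl => exact hcR 0 (by omega)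
    | @tail y z _ hyz ih =>
      by_contra hzR
      have hzn : z ∈ closedNbhd G S R := mem_closedNbhd.2 ⟨hyz.2.1, y, ih, .inr hyz.1⟩
      refine hyz.2.2 fun i hi => hR.adj z hzn hzR (c i) ?_ ?_
      · exact mem_closedNbhd.2 ⟨hcS i hi, c i, hcR i hi, .inl rfl⟩
      · rintro rfl
        exact hzR (hcR i hi)
  have hQeq : Q = R := hR.eq_of_sub Q hQmod hQR
  intro d hd
  by_contra hdn
  have hdQ : d ∈ Q := hQeq ▸ hd
  have hdS := hR.sub hd
  let r' : V → V → Prop := fun a b => G.Adj a b ∧ b ∈ S ∧ ¬Near G c k b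
  let D : Finset V := S.filter fun z => Relation.ReflTransGen r' d z
  have hD : ∀ z, z ∈ D ↔ z ∈ S ∧ Relation.ReflTransGen r' d z := fun z => Finset.mem_filter
  have hdD : d ∈ D := (hD d).2 ⟨hdS, .refl⟩
  have hDn : ∀ z ∈ D, ¬Near G c k z := by
    intro z hz
    rcases Relation.ReflTransGen.cases_tail ((hD z).1 hz).2 with h | ⟨y, _, h⟩
    · exact h ▸ hdn
    · exact h.2.2
  have hDQ : D ⊆ Q := by
    intro z hz
    have hz' := ((hD z).1 hz).2
    clear hz
    induction hz' with
    | refl => exact hdQ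
    | @tail y z _ hyz ih =>
      exact hQstep y ih z hyz.2.1 hyz.1 fun h => hyz.2.2 (hKnear z h)
  -- a vertex near the hole with one neighbour in `D` is adjacent to all of `D`
  have hall : ∀ v ∈ S, ¬Complete G c k v → Near G c k v → ∀ z ∈ D, (G.Adj v z ↔ G.Adj v d) := by
    intro v hv hvK hvn z hz
    have hz' := ((hD z).1 hz).2
    clear hz
    induction hz' with
    | refl => exact Iff.rfl
    | @tail y z hy hyz ih =>
      have hyD : y ∈ D := by
        rcases Relation.ReflTransGen.cases_tail hy with h | ⟨w, _, h⟩
        · exact h ▸ hdD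
        · exact (hD y).2 ⟨h.2.1, hy⟩
      have hyS := ((hD y).1 hyD).1
      refine Iff.trans ?_ ih
      exact ⟨fun h => hS.adj_of_not_near hc hcS hyz.2.1 hv hyS hvK hvn hyz.2.2 (hDn y hyD) h
        hyz.1.symm, fun h => hS.adj_of_not_near hc hcS hyS hv hyz.2.1 hvK hvn (hDn y hyD) hyz.2.2 h
        hyz.1⟩
  have hDmod : IsCliqueModule G S D := by
    have hN : ∀ b ∈ S, b ∉ D → (∃ z ∈ D, G.Adj b z) → Near G c k b := by
      rintro b hb hbD ⟨z, hz, hbz⟩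
      by_contra hcon
      exact hbD ((hD b).2 ⟨hb, ((hD z).1 hz).2.tail ⟨hbz.symm, hb, hcon⟩⟩)
    have hfull : ∀ b ∈ S, b ∉ D → (∃ z ∈ D, G.Adj b z) → ∀ z ∈ D, G.Adj b z := by
      intro b hb hbD h z hz
      by_cases hbK : Complete G c k b
      · exact hKQ b hb hbK z (hDQ hz)
      · obtain ⟨w, hw, hbw⟩ := h
        have := hall b hb hbK (hN b hb hbD ⟨w, hw, hbw⟩)
        exact (this z hz).2 ((this w hw).1 hbw)
    refine .of_adj (Finset.filter_subset _ _) ⟨d, hdD⟩ hfull fun b hb hbD y hy hyD h h' hby => ?_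
    have hbn := hN b hb hbD h
    have hyn := hN y hy hyD h'
    by_cases hbK : Complete G c k b
    · exact hS.adj_of_complete_of_near hc hcS hb hy hbK hyn hby
    · exact hS.adj_of_common_not_near hc hcS hdS hb hy hbK hbn hdn (hfull b hb hbD h d hdD)
        (hfull y hy hyD h' d hdD) hby
  have hDeq := hR.eq_of_sub D hDmod (hDQ.trans hQR)
  exact hDn (c 0) (hDeq ▸ hcR 0 (by omega)) ⟨0, by omega, .inl rfl⟩

open Classical in
/-- The set `R` without the closed neighbourhood of `v`. -/
noncomputable def nonNbrs (G : SimpleGraph V) (R : Finset V) (v : V) : Finset V :=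
  R.filter fun y => y ≠ v ∧ ¬G.Adj v y

theorem mem_nonNbrs {v y : V} : y ∈ nonNbrs G R v ↔ y ∈ R ∧ y ≠ v ∧ ¬G.Adj v y := by
  classical
  simp [nonNbrs]

theorem nonNbrs_subset {v : V} : nonNbrs G R v ⊆ R := fun _ hy => (mem_nonNbrs.1 hy).1

theorem IsMinCliqueModule.holeFree_nonNbrs (hS : PatternFree G S) (hR : IsMinCliqueModule G S R)
    {v : V} (hv : v ∈ R) : HoleFree G (nonNbrs G R v) := by
  intro c k hc
  by_contra! hcon
  obtain ⟨i, hi, h⟩ := hR.near hS hc (fun i hi => (mem_nonNbrs.1 (hcon i hi)).1) v hv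
  have := (mem_nonNbrs.1 (hcon i hi)).2
  rcases h with h | h
  · exact this.1 h.symm
  · exact this.2 h

theorem IsMinCliqueModule.nonNbrs_eq_empty (hS : HoleFree G S) (hR : IsMinCliqueModule G S R)
    {v : V} (hv : v ∈ R) : nonNbrs G R v = ∅ := by
  obtain ⟨u, rfl⟩ := hR.eq_singleton hS
  rw [Finset.mem_singleton] at hv
  subst hv
  ext y
  simp +contextual [mem_nonNbrs]

/-! ### Computing minimal clique modules -/

open Classical in
/-- Add to `R` the vertices that prevent it from being a clique module. -/
noncomputable def moduleStep (G : SimpleGraph V) (S R : Finset V) : Finset V :=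
  R ∪ (closedNbhd G S R).filter fun b => ∃ y ∈ closedNbhd G S R, y ≠ b ∧ ¬G.Adj b y

open Classical in
theorem mem_moduleStep {b : V} : b ∈ moduleStep G S R ↔
    b ∈ R ∨ (b ∈ closedNbhd G S R ∧ ∃ y ∈ closedNbhd G S R, y ≠ b ∧ ¬G.Adj b y) := by
  simp [moduleStep]

theorem closedNbhd_mono {R R' : Finset V} (h : R ⊆ R') :
    closedNbhd G S R ⊆ closedNbhd G S R' := fun b hb => by
  obtain ⟨hb, c, hc, h'⟩ := mem_closedNbhd.1 hb
  exact mem_closedNbhd.2 ⟨hb, c, h hc, h'⟩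

theorem IsCliqueModule.moduleStep_subset {R' : Finset V} (h : IsCliqueModule G S R')
    (hR : R ⊆ R') : moduleStep G S R ⊆ R' := by
  intro b hb
  rcases mem_moduleStep.1 hb with hb | ⟨hb, y, hy, hyb, hadj⟩
  · exact hR hb
  · by_contra hbR
    exact hadj (h.adj b (closedNbhd_mono hR hb) hbR y (closedNbhd_mono hR hy) hyb)

/-- The least clique module in `S` that contains `a ∈ S`. -/
noncomputable def moduleOf [Fintype V] (G : SimpleGraph V) (S : Finset V) (a : V) : Finset V :=
  (moduleStep G S)^[Fintype.card V] {a}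

theorem IsCliqueModule.iterate_subset {R' : Finset V} (h : IsCliqueModule G S R')
    {a : V} (ha : a ∈ R') (m : ℕ) : (moduleStep G S)^[m] {a} ⊆ R' := by
  induction m with
  | zero => simpa using ha
  | succ m ih =>
    rw [Function.iterate_succ_apply']
    exact h.moduleStep_subset ih

theorem subset_moduleStep : R ⊆ moduleStep G S R := fun _ hb => mem_moduleStep.2 (.inl hb)

theorem moduleStep_subset (hR : R ⊆ S) : moduleStep G S R ⊆ S := by
  intro b hb
  rcases mem_moduleStep.1 hb with hb | ⟨hb, -⟩
  · exact hR hb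
  · exact (mem_closedNbhd.1 hb).1

theorem mem_iterate_moduleStep (a : V) (m : ℕ) : a ∈ (moduleStep G S)^[m] {a} := by
  induction m with
  | zero => simp
  | succ m ih =>
    rw [Function.iterate_succ_apply']
    exact subset_moduleStep ih

section
variable [Fintype V] {a b : V}

theorem mem_moduleOf_self : a ∈ moduleOf G S a := mem_iterate_moduleStep a _

theorem IsCliqueModule.moduleOf_subset {R' : Finset V} (h : IsCliqueModule G S R')
    (ha : a ∈ R') : moduleOf G S a ⊆ R' := h.iterate_subset ha _

/-- As long as the iteration is not stationary, the set grows. -/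
theorem isCliqueModule_moduleOf (ha : a ∈ S) : IsCliqueModule G S (moduleOf G S a) := by
  have hsub : ∀ m, (moduleStep G S)^[m] {a} ⊆ S := by
    intro m
    induction m with
    | zero => simpa using ha
    | succ m ih =>
      rw [Function.iterate_succ_apply']
      exact moduleStep_subset ih
  have hfix : moduleStep G S (moduleOf G S a) = moduleOf G S a := by
    have key : ∀ m, m + 1 ≤ ((moduleStep G S)^[m] {a}).card ∨
        moduleStep G S ((moduleStep G S)^[m] {a}) = (moduleStep G S)^[m] {a} := by
      intro m
      induction m with
      | zero => simp
      | succ m ih =>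
        rw [Function.iterate_succ_apply']
        rcases ih with ih | ih
        · by_cases h : moduleStep G S ((moduleStep G S)^[m] {a}) = (moduleStep G S)^[m] {a}
          · right; rw [h, h]
          · left
            have := Finset.card_lt_card (Finset.ssubset_iff_subset_ne.2
              ⟨subset_moduleStep (G := G) (S := S) (R := (moduleStep G S)^[m] {a}), Ne.symm h⟩)
            omega
        · right; rw [ih, ih]
    rcases key (Fintype.card V) with h | h
    · have := Finset.card_le_univ ((moduleStep G S)^[Fintype.card V] {a})
      omega
    · exact h
  refine ⟨hsub _, ⟨a, mem_moduleOf_self⟩, fun b hb hbR y hy hyb => ?_⟩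
  by_contra hadj
  exact hbR (hfix ▸ mem_moduleStep.2 (.inr ⟨hb, y, hy, hyb, hadj⟩))

/-- `a` lies in the least clique module of every member of its own least clique module. -/
def IsGood (G : SimpleGraph V) (S : Finset V) (a : V) : Prop :=
  a ∈ S ∧ ∀ b ∈ moduleOf G S a, a ∈ moduleOf G S b

theorem IsGood.isMinCliqueModule (h : IsGood G S a) : IsMinCliqueModule G S (moduleOf G S a) := by
  refine ⟨isCliqueModule_moduleOf h.1, fun R' hR' hsub => hsub.antisymm ?_⟩
  obtain ⟨b, hb⟩ := hR'.ne
  exact hR'.moduleOf_subset (hR'.moduleOf_subset hb (h.2 b (hsub hb)))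

theorem exists_isGood (hS : S.Nonempty) : ∃ a, IsGood G S a := by
  obtain ⟨a, ha, hmin⟩ := S.exists_min_image (fun a => (moduleOf G S a).card) hS
  refine ⟨a, ha, fun b hb => ?_⟩
  have hbS := (isCliqueModule_moduleOf ha).sub hb
  have hsub := (isCliqueModule_moduleOf (G := G) ha).moduleOf_subset hb
  rw [Finset.eq_of_subset_of_card_le hsub (hmin b hbS)]
  exact mem_moduleOf_self

end

end Graph

/-! ### Weighted independent sets -/

namespace Graph

open SimpleGraph

variable {V : Type} {G : SimpleGraph V} {S R : Finset V}

open Classical in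
/-- The maximum weight of an independent set in `S`. -/
noncomputable def wis (G : SimpleGraph V) (u : V → ℕ) (S : Finset V) : ℕ :=
  (S.powerset.filter fun I : Finset V => G.IsIndepSet (I : Set V)).sup fun I => ∑ v ∈ I, u v

theorem le_wis {u : V → ℕ} {I : Finset V} (hI : I ⊆ S) (hind : G.IsIndepSet (I : Set V)) :
    ∑ v ∈ I, u v ≤ wis G u S := by
  classical
  exact Finset.le_sup (f := fun I => ∑ v ∈ I, u v)
    (Finset.mem_filter.2 ⟨Finset.mem_powerset.2 hI, hind⟩)

theorem wis_le {u : V → ℕ} {b : ℕ}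
    (h : ∀ I ⊆ S, G.IsIndepSet (I : Set V) → ∑ v ∈ I, u v ≤ b) : wis G u S ≤ b := by
  classical
  refine Finset.sup_le fun I hI => ?_
  rw [Finset.mem_filter, Finset.mem_powerset] at hI
  exact h I hI.1 hI.2

theorem exists_eq_wis (G : SimpleGraph V) (u : V → ℕ) (S : Finset V) :
    ∃ I ⊆ S, G.IsIndepSet (I : Set V) ∧ ∑ v ∈ I, u v = wis G u S := by
  classical
  obtain ⟨I, hI, h⟩ := Finset.exists_mem_eq_sup
    (S.powerset.filter fun I : Finset V => G.IsIndepSet (I : Set V))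
    ⟨∅, by simp [SimpleGraph.isIndepSet_iff]⟩ (fun I => ∑ v ∈ I, u v)
  rw [Finset.mem_filter, Finset.mem_powerset] at hI
  exact ⟨I, hI.1, hI.2, h.symm⟩

theorem wis_le_sum (u : V → ℕ) (S : Finset V) : wis G u S ≤ ∑ v ∈ S, u v :=
  wis_le fun _ hI _ => Finset.sum_le_sum_of_subset hI

theorem wis_mono {u : V → ℕ} {T : Finset V} (h : S ⊆ T) : wis G u S ≤ wis G u T :=
  wis_le fun _ hI hind => le_wis (hI.trans h) hind

@[simp] theorem wis_empty (u : V → ℕ) : wis G u ∅ = 0 :=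
  Nat.le_zero.1 (by simpa using wis_le_sum (G := G) u ∅)

theorem indep_mono {I J : Finset V} (hJ : G.IsIndepSet (J : Set V)) (h : I ⊆ J) :
    G.IsIndepSet (I : Set V) := fun _ ha _ hb hab => hJ (h ha) (h hb) hab

theorem wis_erase_le [DecidableEq V] (u : V → ℕ) (S : Finset V) (v : V) :
    wis G u (S.erase v) ≤ wis G u S := wis_mono (Finset.erase_subset v S)

theorem add_wis_nonNbrs_le (u : V → ℕ) {v : V} (hv : v ∈ S) :
    u v + wis G u (nonNbrs G S v) ≤ wis G u S := by
  classical
  obtain ⟨I, hI, hind, h⟩ := exists_eq_wis G u (nonNbrs G S v)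
  have hvI : v ∉ I := fun h => (mem_nonNbrs.1 (hI h)).2.1 rfl
  rw [← h, ← Finset.sum_insert hvI]
  refine le_wis (Finset.insert_subset hv (hI.trans nonNbrs_subset)) ?_
  rw [Finset.coe_insert]
  refine Set.Pairwise.insert hind fun b hb _ => ?_
  have := (mem_nonNbrs.1 (hI hb)).2.2
  exact ⟨this, fun h => this h.symm⟩

theorem sum_le_add_wis_nonNbrs (u : V → ℕ) {v : V} {I : Finset V} (hI : I ⊆ S)
    (hind : G.IsIndepSet (I : Set V)) (hv : v ∈ I) :
    ∑ x ∈ I, u x ≤ u v + wis G u (nonNbrs G S v) := by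
  classical
  rw [← Finset.add_sum_erase _ _ hv]
  refine Nat.add_le_add_left (le_wis (fun y hy => ?_)
    (indep_mono hind (Finset.erase_subset _ _))) _
  obtain ⟨hyv, hyI⟩ := Finset.mem_erase.1 hy
  exact mem_nonNbrs.2 ⟨hI hyI, hyv, hind hv hyI hyv.symm⟩

theorem wis_eq_max [DecidableEq V] (u : V → ℕ) {v : V} (hv : v ∈ S) :
    wis G u S = max (u v + wis G u (nonNbrs G S v)) (wis G u (S.erase v)) := by
  refine le_antisymm (wis_le fun I hI hind => ?_)
    (max_le (add_wis_nonNbrs_le u hv) (wis_erase_le u S v))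
  by_cases hvI : v ∈ I
  · exact (sum_le_add_wis_nonNbrs u hI hind hvI).trans (le_max_left _ _)
  · exact (le_wis (Finset.subset_erase.2 ⟨hI, hvI⟩) hind).trans (le_max_right _ _)

theorem wis_eq_sup (u : V → ℕ) (R : Finset V) :
    wis G u R = R.sup fun v => u v + wis G u (nonNbrs G R v) := by
  refine le_antisymm (wis_le fun I hI hind => ?_)
    (Finset.sup_le fun v hv => add_wis_nonNbrs_le u hv)
  rcases I.eq_empty_or_nonempty with rfl | ⟨v, hv⟩
  · simp
  · exact (sum_le_add_wis_nonNbrs u hI hind hv).trans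
      (Finset.le_sup (f := fun v => u v + wis G u (nonNbrs G R v)) (hI hv))

/-- A clique module `R` can be solved separately: the value `α` of an optimal solution within `R` is
gained in any case, and a neighbour of `R` is worth only what it exceeds `α` by. -/
theorem IsCliqueModule.wis_eq [DecidableEq V] (h : IsCliqueModule G S R) (u : V → ℕ) :
    wis G u S = wis G u R +
      wis G (fun v => if v ∈ closedNbhd G S R then u v - wis G u R else u v) (S \ R) := by
  set α := wis G u R with hα
  set u' : V → ℕ := fun v => if v ∈ closedNbhd G S R then u v - α else u v with hu'
  have hRN : R ⊆ closedNbhd G S R := fun v hv => mem_closedNbhd.2 ⟨h.sub hv, v, hv, .inl rfl⟩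
  have hfar : ∀ I : Finset V, (∀ v ∈ I, v ∉ closedNbhd G S R) → ∑ v ∈ I, u' v = ∑ v ∈ I, u v :=
    fun I hI => Finset.sum_congr rfl fun v hv => by simp [hu', hI v hv]
  have hle : ∀ v, u' v ≤ u v := fun v => by
    simp only [hu']; split_ifs <;> omega
  apply le_antisymm
  · refine wis_le fun I hI hind => ?_
    have hsplit : ∑ v ∈ I, u v = ∑ v ∈ I ∩ R, u v + ∑ v ∈ I \ R, u v :=
      (Finset.sum_inter_add_sum_sdiff I R u).symm
    have hIR : I \ R ⊆ S \ R := Finset.sdiff_subset_sdiff hI le_rfl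
    have h1 := le_wis (G := G) (u := u') hIR (indep_mono hind Finset.sdiff_subset)
    by_cases hk : ∃ b ∈ I \ R, b ∈ closedNbhd G S R
    · obtain ⟨b, hb, hbN⟩ := hk
      obtain ⟨hbI, hbR⟩ := Finset.mem_sdiff.1 hb
      -- an independent set has no other vertex in the closed neighbourhood
      have hno : ∀ y ∈ I, y ≠ b → y ∉ closedNbhd G S R := fun y hy hyb hyN =>
        hind hbI hy hyb.symm (h.adj b hbN hbR y hyN hyb)
      have hempty : I ∩ R = ∅ := by
        ext y
        simp only [Finset.mem_inter, Finset.notMem_empty, iff_false, not_and]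
        intro hy hyR
        exact hno y hy (by rintro rfl; exact hbR hyR) (hRN hyR)
      have h2 : ∑ v ∈ (I \ R).erase b, u' v = ∑ v ∈ (I \ R).erase b, u v :=
        hfar _ fun v hv => by
          obtain ⟨hvb, hv⟩ := Finset.mem_erase.1 hv
          exact hno v (Finset.mem_sdiff.1 hv).1 hvb
      rw [← Finset.add_sum_erase _ _ hb, h2] at h1
      rw [hsplit, hempty, Finset.sum_empty, ← Finset.add_sum_erase _ _ hb]
      have : u' b = u b - α := by simp [hu', hbN]
      omega
    · push Not at hk
      rw [hsplit]
      rw [hfar _ hk] at h1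
      exact Nat.add_le_add (le_wis Finset.inter_subset_right
        (indep_mono hind Finset.inter_subset_left)) h1
  · obtain ⟨I, hI, hind, hIw⟩ := exists_eq_wis G u' (S \ R)
    obtain ⟨J, hJ, hJind, hJw⟩ := exists_eq_wis G u R
    have hIS : I ⊆ S := hI.trans Finset.sdiff_subset
    rw [← hIw]
    by_cases hk : ∃ b ∈ I, b ∈ closedNbhd G S R ∧ α < u b
    · obtain ⟨b, hb, hbN, hbα⟩ := hk
      refine le_trans ?_ (le_wis hIS hind)
      rw [← Finset.add_sum_erase _ _ hb, ← Finset.add_sum_erase _ _ hb]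
      have : u' b = u b - α := by simp [hu', hbN]
      have := Finset.sum_le_sum (s := I.erase b) fun v _ => hle v
      omega
    · push Not at hk
      let I' := I.filter fun v => v ∉ closedNbhd G S R
      have hI' : I' ⊆ I := Finset.filter_subset _ _
      have hsum : ∑ v ∈ I, u' v = ∑ v ∈ I', u v := by
        rw [← hfar I' fun v hv => (Finset.mem_filter.1 hv).2]
        refine (Finset.sum_subset hI' fun v hv hv' => ?_).symm
        have hvN : v ∈ closedNbhd G S R := by
          by_contra hcon
          exact hv' (Finset.mem_filter.2 ⟨hv, hcon⟩)
        have := hk v hv hvN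
        simp only [hu', hvN, if_true]
        omega
      have hdisj : Disjoint J I' := Finset.disjoint_left.2 fun v hv hv' =>
        (Finset.mem_filter.1 hv').2 (hRN (hJ hv))
      rw [hsum, hα, ← hJw, ← Finset.sum_union hdisj]
      refine le_wis (Finset.union_subset (hJ.trans h.sub) (hI'.trans hIS)) ?_
      have hcross : ∀ a ∈ J, ∀ b ∈ I', ¬G.Adj a b := fun a ha b hb hab =>
        (Finset.mem_filter.1 hb).2 (mem_closedNbhd.2 ⟨hIS (hI' hb), a, hJ ha, .inr hab⟩)
      intro a ha b hb hab
      rw [Finset.mem_coe, Finset.mem_union] at ha hb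
      rcases ha with ha | ha <;> rcases hb with hb | hb
      · exact hJind ha hb hab
      · exact hcross a ha b hb
      · exact fun h => hcross b hb a ha h.symm
      · exact hind (hI' ha) (hI' hb) hab

/-! ### The patterns and interval graphs -/

/-- Two intervals `[l i, r i]` and `[l j, r j]` intersect. -/
def Meet (l r : ℕ → ℝ) (i j : ℕ) : Prop := l i ≤ r j ∧ l j ≤ r i

/-- A representation of a pattern by intervals. -/
structure Pattern.IsRep (P : Pattern) (l r : ℕ → ℝ) : Prop where
  le : ∀ i < P.size, l i ≤ r i
  meet_iff : ∀ j < P.size, ∀ i < j, (Meet l r i j ↔ (i, j) ∈ P.edges)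

/-- Intersecting intervals that both avoid a third interval lie on the same side of it. -/
theorem left_iff_left {l r : ℕ → ℝ} {b x y : ℕ} (hb : l b ≤ r b) (hxy : Meet l r x y)
    (hxb : ¬Meet l r x b) (hyb : ¬Meet l r y b) : r x < l b ↔ r y < l b := by
  unfold Meet at *
  rw [not_and_or, not_le, not_le] at hxb hyb
  constructor
  · intro h
    rcases hyb with h' | h'
    · linarith [hxy.2]
    · exact h'
  · intro h
    rcases hxb with h' | h'
    · linarith [hxy.1]
    · exact h'

/-- Of three disjoint intervals one lies between the other two. -/
theorem no_asteroidal_triple {l r : ℕ → ℝ} {a b c : ℕ} (ha : l a ≤ r a) (hb : l b ≤ r b)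
    (hc : l c ≤ r c) (hab : ¬Meet l r a b) (hac : ¬Meet l r a c) (hbc : ¬Meet l r b c)
    (h₁ : r b < l a ↔ r c < l a) (h₂ : r a < l b ↔ r c < l b) (h₃ : r a < l c ↔ r b < l c) :
    False := by
  unfold Meet at *
  rw [not_and_or, not_le, not_le] at hab hac hbc
  rcases hab with h | h
  · have := h₁.1 h
    have := h₃.not.1 (by linarith)
    have := h₂.not.1 (by linarith)
    rcases hbc with h' | h' <;> linarith
  · have := h₂.1 h
    have := h₁.not.1 (by linarith)
    rcases hac with h' | h'
    · linarith
    · have := h₃.1 h'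
      linarith

theorem Meet.symm {l r : ℕ → ℝ} {i j : ℕ} (h : Meet l r i j) : Meet l r j i := ⟨h.2, h.1⟩

/-- Adjacency in a pattern. -/
abbrev Pattern.Adj (P : Pattern) (i j : ℕ) : Prop :=
  i < j ∧ j < P.size ∧ (i, j) ∈ P.edges ∨ j < i ∧ i < P.size ∧ (j, i) ∈ P.edges

/-- Two different vertices of a pattern that are not adjacent. -/
abbrev Pattern.NonAdj (P : Pattern) (i j : ℕ) : Prop :=
  i < j ∧ j < P.size ∧ (i, j) ∉ P.edges ∨ j < i ∧ i < P.size ∧ (j, i) ∉ P.edges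

theorem Pattern.IsRep.meet {P : Pattern} {l r : ℕ → ℝ} (h : P.IsRep l r) (i j : ℕ)
    (hij : P.Adj i j) : Meet l r i j := by
  rcases hij with ⟨h1, h2, h3⟩ | ⟨h1, h2, h3⟩
  · exact (h.meet_iff j h2 i h1).2 h3
  · exact ((h.meet_iff i h2 j h1).2 h3).symm

theorem Pattern.IsRep.not_meet {P : Pattern} {l r : ℕ → ℝ} (h : P.IsRep l r) (i j : ℕ)
    (hij : P.NonAdj i j) : ¬Meet l r i j := by
  rcases hij with ⟨h1, h2, h3⟩ | ⟨h1, h2, h3⟩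
  · exact fun hm => h3 ((h.meet_iff j h2 i h1).1 hm)
  · exact fun hm => h3 ((h.meet_iff i h2 j h1).1 hm.symm)

/-- The vertices of a path that avoids `b` and its neighbours lie on the same side of `b`. -/
theorem Pattern.IsRep.left_iff_left {P : Pattern} {l r : ℕ → ℝ} (h : P.IsRep l r) (b : ℕ)
    (hb : b < P.size) (p : List ℕ) : ∀ x, (∀ y ∈ x :: p, P.NonAdj y b) →
    List.IsChain P.Adj (x :: p) →
    (r x < l b ↔ r ((x :: p).getLast (List.cons_ne_nil _ _)) < l b) := by
  induction p with
  | nil => exact fun _ _ _ => Iff.rfl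
  | cons y p ih =>
    intro x hx hp
    rw [List.isChain_cons_cons] at hp
    rw [List.getLast_cons (List.cons_ne_nil _ _),
      ← ih y (fun z hz => hx z (List.mem_cons_of_mem _ hz)) hp.2]
    exact Graph.left_iff_left (h.le b hb) (h.meet x y hp.1) (h.not_meet x b (hx x (by simp)))
      (h.not_meet y b (hx y (by simp)))

theorem not_isRep {P : Pattern} (hP : P ∈ patterns) (l r : ℕ → ℝ) : ¬P.IsRep l r := by
  intro h
  simp only [patterns, List.mem_cons, List.not_mem_nil, or_false] at hP
  rcases hP with rfl | rfl | rfl | rfl | rfl | rfl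
  · have h01 := h.meet 0 1 (by decide)
    have h12 := h.meet 1 2 (by decide)
    have h23 := h.meet 2 3 (by decide)
    have h03 := h.meet 0 3 (by decide)
    have n02 := h.not_meet 0 2 (by decide)
    have n13 := h.not_meet 1 3 (by decide)
    unfold Meet at *
    rw [not_and_or, not_le, not_le] at n02 n13
    rcases n02 with n02 | n02 <;> rcases n13 with n13 | n13 <;>
      linarith [h01.1, h01.2, h12.1, h12.2, h23.1, h23.2, h03.1, h03.2]
  · have h01 := h.meet 0 1 (by decide)
    have h12 := h.meet 1 2 (by decide)
    have h23 := h.meet 2 3 (by decide)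
    have h34 := h.meet 3 4 (by decide)
    have h04 := h.meet 0 4 (by decide)
    have n02 := h.not_meet 0 2 (by decide)
    have n03 := h.not_meet 0 3 (by decide)
    have n13 := h.not_meet 1 3 (by decide)
    have n14 := h.not_meet 1 4 (by decide)
    have n24 := h.not_meet 2 4 (by decide)
    unfold Meet at *
    rw [not_and_or, not_le, not_le] at n02 n13 n03 n14 n24
    rcases n02 with n02 | n02 <;> rcases n13 with n13 | n13 <;> rcases n24 with n24 | n24 <;>
      rcases n03 with n03 | n03 <;> rcases n14 with n14 | n14 <;>
      linarith [h01.1, h01.2, h12.1, h12.2, h23.1, h23.2, h34.1, h34.2, h04.1, h04.2]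
  -- in the other patterns, `1, 3, 5` is an asteroidal triple
  · exact no_asteroidal_triple (h.le 1 (by decide)) (h.le 3 (by decide)) (h.le 5 (by decide))
      (h.not_meet 1 3 (by decide)) (h.not_meet 1 5 (by decide)) (h.not_meet 3 5 (by decide))
      (h.left_iff_left 1 (by decide) [2, 6, 4, 5] 3 (by decide) (by decide))
      (h.left_iff_left 3 (by decide) [0, 6, 4, 5] 1 (by decide) (by decide))
      (h.left_iff_left 5 (by decide) [0, 6, 2, 3] 1 (by decide) (by decide))
  · exact no_asteroidal_triple (h.le 1 (by decide)) (h.le 3 (by decide)) (h.le 5 (by decide))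
      (h.not_meet 1 3 (by decide)) (h.not_meet 1 5 (by decide)) (h.not_meet 3 5 (by decide))
      (h.left_iff_left 1 (by decide) [2, 4, 5] 3 (by decide) (by decide))
      (h.left_iff_left 3 (by decide) [0, 4, 5] 1 (by decide) (by decide))
      (h.left_iff_left 5 (by decide) [0, 2, 3] 1 (by decide) (by decide))
  · exact no_asteroidal_triple (h.le 1 (by decide)) (h.le 3 (by decide)) (h.le 5 (by decide))
      (h.not_meet 1 3 (by decide)) (h.not_meet 1 5 (by decide)) (h.not_meet 3 5 (by decide))
      (h.left_iff_left 1 (by decide) [4, 5] 3 (by decide) (by decide))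
      (h.left_iff_left 3 (by decide) [0, 5] 1 (by decide) (by decide))
      (h.left_iff_left 5 (by decide) [2, 3] 1 (by decide) (by decide))
  · exact no_asteroidal_triple (h.le 1 (by decide)) (h.le 3 (by decide)) (h.le 5 (by decide))
      (h.not_meet 1 3 (by decide)) (h.not_meet 1 5 (by decide)) (h.not_meet 3 5 (by decide))
      (h.left_iff_left 1 (by decide) [2, 4, 5] 3 (by decide) (by decide))
      (h.left_iff_left 3 (by decide) [0, 4, 5] 1 (by decide) (by decide))
      (h.left_iff_left 5 (by decide) [6, 3] 1 (by decide) (by decide))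

/-- A modulator meets every occurrence of a pattern. -/
theorem exists_mem_modulator {P : Pattern} (hP : P ∈ patterns) {f : ℕ → V} (hf : P.Occurs G f)
    {M : Set V} (hM : IsIntervalModulator G M) : ∃ i < P.size, f i ∈ M := by
  by_contra! hcon
  obtain ⟨τ, -, hτ⟩ := hM
  have hmem : ∀ i, i < P.size → f i ∈ Mᶜ := fun i hi => hcon i hi
  classical
  let e : ℕ → ℝ × ℝ := fun i =>
    if hi : i < P.size then ((τ ⟨f i, hmem i hi⟩).fst, (τ ⟨f i, hmem i hi⟩).snd) else (0, 0)
  refine not_isRep hP (fun i => (e i).1) (fun i => (e i).2) ⟨fun i hi => ?_, fun j hj i hij => ?_⟩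
  · simp only [e, hi, dif_pos]
    exact (τ ⟨f i, hmem i hi⟩).fst_le_snd
  · have hi : i < P.size := hij.trans hj
    obtain ⟨hne, hadj⟩ := hf j hj i hij
    rw [← hadj]
    have := hτ ⟨f i, hmem i hi⟩ ⟨f j, hmem j hj⟩ (fun h => hne (congrArg Subtype.val h))
    rw [comap_adj] at this
    refine Iff.trans ?_ this.symm
    simp only [Meet, e, hi, hj, dif_pos, NonemptyInterval.coe_def, Set.Icc_inter_Icc,
      Set.nonempty_Icc, sup_le_iff, le_inf_iff, NonemptyInterval.fst_le_snd, true_and, and_true]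
    tauto

theorem matching_patterns : ∀ P ∈ patterns, ∀ i < P.size - 4,
    2 * i + 1 < P.size ∧ (2 * i, 2 * i + 1) ∈ P.edges := by
  decide

/-- A vertex cover contains all but at most four vertices of every occurrence of a pattern. -/
theorem size_le_card_inter [DecidableEq V] {P : Pattern} (hP : P ∈ patterns) {f : ℕ → V}
    (hf : P.Occurs G f) {Y : Finset V} (hY : G.IsVertexCover (Y : Set V)) :
    P.size ≤ (Y ∩ (Finset.range P.size).image f).card + 4 := by
  have hm := matching_patterns P hP
  have hinj : ∀ i j, i < P.size → j < P.size → f i = f j → i = j := by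
    intro i j hi hj h
    rcases lt_trichotomy i j with hij | hij | hij
    · exact absurd h (hf j hj i hij).1
    · exact hij
    · exact absurd h.symm (hf i hi j hij).1
  let g : ℕ → ℕ := fun i => if f (2 * i) ∈ Y then 2 * i else 2 * i + 1
  have hg : ∀ i, g i = 2 * i ∨ g i = 2 * i + 1 := fun i => by
    simp only [g]; split_ifs <;> simp
  have hgP : ∀ i < P.size - 4, g i < P.size := fun i hi => by
    have := (hm i hi).1
    rcases hg i with h | h <;> omega
  have hgY : ∀ i < P.size - 4, f (g i) ∈ Y := fun i hi => by
    have hadj := (hf (2 * i + 1) (hm i hi).1 (2 * i) (by omega)).2.2 (hm i hi).2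
    simp only [g]
    split_ifs with h
    · exact h
    · exact_mod_cast (hY hadj).resolve_left (by exact_mod_cast h)
  have : P.size - 4 ≤ (Y ∩ (Finset.range P.size).image f).card := by
    conv_lhs => rw [← Finset.card_range (P.size - 4)]
    refine Finset.card_le_card_of_injOn (fun i => f (g i)) (fun i hi => ?_)
      fun i hi j hj hij => ?_
    · have hi' : i < P.size - 4 := by simpa using hi
      simp only [Finset.coe_inter, Set.mem_inter_iff, Finset.mem_coe, Finset.mem_image,
        Finset.mem_range]
      exact ⟨hgY i hi', g i, hgP i hi', rfl⟩
    · have hi' : i < P.size - 4 := by simpa using hi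
      have hj' : j < P.size - 4 := by simpa using hj
      have := hinj _ _ (hgP i hi') (hgP j hj') hij
      rcases hg i with h | h <;> rcases hg j with h' | h' <;> omega
  omega

/-! ### Local ratio -/

/-- The approximation guarantee for the set `X` with respect to the weights `w`. -/
def Approx (G : SimpleGraph V) (w : V → ℕ) (X : Finset V) : Prop :=
  ∀ Y M : Finset V, G.IsVertexCover (Y : Set V) → IsIntervalModulator G (M : Set V) →
    ∑ v ∈ X, w v ≤ ∑ v ∈ Y, w v + 4 * ∑ v ∈ M, w v

/-- The guarantee survives when the weights of an occurrence of a pattern are raised by `ε`: this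
raises the left hand side by at most `ε * size`, the first sum on the right by at least
`ε * (size - 4)`, and the second one by at least `ε`. -/
theorem Approx.of_occurs [DecidableEq V] {P : Pattern} (hP : P ∈ patterns) {f : ℕ → V}
    (hf : P.Occurs G f) {w w' : V → ℕ} {ε : ℕ}
    (hw : ∀ v, w v = w' v + if v ∈ (Finset.range P.size).image f then ε else 0) {X : Finset V}
    (h : Approx G w' X) : Approx G w X := by
  intro Y M hY hM
  have hsum : ∀ Z : Finset V, ∑ v ∈ Z, w v =
      ∑ v ∈ Z, w' v + (Z ∩ (Finset.range P.size).image f).card * ε := by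
    intro Z
    rw [Finset.sum_congr rfl fun v _ => hw v, Finset.sum_add_distrib, Finset.sum_ite_mem,
      Finset.sum_const, smul_eq_mul]
  have h1 : (X ∩ (Finset.range P.size).image f).card ≤ P.size :=
    (Finset.card_le_card Finset.inter_subset_right).trans
      (Finset.card_image_le.trans (Finset.card_range _).le)
  have h2 := size_le_card_inter hP hf hY
  have h3 : 1 ≤ (M ∩ (Finset.range P.size).image f).card := by
    obtain ⟨i, hi, hiM⟩ := exists_mem_modulator hP hf hM
    exact Finset.card_pos.2 ⟨f i, Finset.mem_inter.2 ⟨hiM,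
      Finset.mem_image.2 ⟨i, Finset.mem_range.2 hi, rfl⟩⟩⟩
  have := h Y M hY hM
  rw [hsum X, hsum Y, hsum M]
  nlinarith [Nat.mul_le_mul_right ε (h1.trans h2), Nat.mul_le_mul_right ε h3]

/-- The complement of an optimal independent set within the support of the weights. -/
theorem approx_compl [Fintype V] [DecidableEq V] {w : V → ℕ} {I : Finset V}
    (hI : ∑ v ∈ I, w v = wis G w (Finset.univ.filter fun v => w v ≠ 0)) : Approx G w Iᶜ := by
  intro Y M hY _
  have h1 : ∑ v ∈ Yᶜ, w v ≤ wis G w (Finset.univ.filter fun v => w v ≠ 0) := by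
    have : ∑ v ∈ Yᶜ, w v = ∑ v ∈ Yᶜ.filter fun v => w v ≠ 0, w v :=
      (Finset.sum_filter_ne_zero _).symm
    rw [this]
    refine le_wis (Finset.filter_subset_filter _ (Finset.subset_univ _)) fun a ha b hb _ hab => ?_
    simp only [Finset.coe_filter, Finset.mem_compl, Set.mem_ofPred_eq] at ha hb
    rcases hY hab with h | h
    · exact ha.1 (by exact_mod_cast h)
    · exact hb.1 (by exact_mod_cast h)
  have h2 := Finset.sum_add_sum_compl Y w
  have h3 := Finset.sum_add_sum_compl I w
  omega

end Graph

/-! ### Programs: truth values, loops, and comprehensions -/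

namespace Bounded

open RAM Graph

/-- A term is read as the proposition that its value is not `0`. -/
def Tm.Holds (n cap : ℕ) (σ : ℕ → ℕ → ℕ) (t : Tm) (η : ℕ → ℕ) : Prop := t.eval n cap σ η ≠ 0

def Tm.zero : Tm := .lit false

def tand (t u : Tm) : Tm := .cond t u .zero

def tor (t u : Tm) : Tm := .cond t (.lit true) u

def tnot (t : Tm) : Tm := .cond t .zero (.lit true)

/-- `a[x]`, for a variable `x`. -/
def cell (a x : ℕ) : Tm := .read a .zero (.var x)

/-- `a[x, y]`, for variables `x` and `y`. -/
def mat (a x y : ℕ) : Tm := .read a (.var x) (.var y)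

/-- `a[0]`. -/
def scalar (a : ℕ) : Tm := .read a .zero .zero

def eqVar (x y : ℕ) : Tm := .op .eq (.var x) (.var y)

/-- `a[x] := t` for all `x`. -/
def fill (a x : ℕ) (t : Tm) : St := .loop x (.set a .zero (.var x) t)

/-- `a[x, y] := t` for all `x` and `y`. -/
def fillMat (a x y : ℕ) (t : Tm) : St := .loop x (.loop y (.set a (.var x) (.var y) t))

/-- `a[0] := t`. -/
def setScalar (a : ℕ) (t : Tm) : St := .set a .zero .zero t

section
variable {n cap : ℕ} {σ : ℕ → ℕ → ℕ} {η : ℕ → ℕ} {t u : Tm} {a x y : ℕ}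

theorem holds_and : (tand t u).Holds n cap σ η ↔ t.Holds n cap σ η ∧ u.Holds n cap σ η := by
  simp only [Tm.Holds, tand, Tm.eval, Tm.zero]
  by_cases h : t.eval n cap σ η = 0 <;> simp [h]

theorem holds_or : (tor t u).Holds n cap σ η ↔ t.Holds n cap σ η ∨ u.Holds n cap σ η := by
  simp only [Tm.Holds, tor, Tm.eval]
  by_cases h : t.eval n cap σ η = 0 <;> simp [h]

theorem holds_not : (tnot t).Holds n cap σ η ↔ ¬t.Holds n cap σ η := by
  simp only [Tm.Holds, tnot, Tm.eval, Tm.zero]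
  by_cases h : t.eval n cap σ η = 0 <;> simp [h]

theorem holds_sup :
    (Tm.sup x t).Holds n cap σ η ↔ ∃ i : Fin n, t.Holds n cap σ (Function.update η x i) := by
  simp only [Tm.Holds, Tm.eval, ← Nat.pos_iff_ne_zero, Finset.lt_sup_iff, Finset.mem_range]
  constructor
  · rintro ⟨i, hi, h⟩
    exact ⟨⟨i, hi⟩, h⟩
  · rintro ⟨i, h⟩
    exact ⟨i, i.2, h⟩

theorem holds_eqVar : (eqVar x y).Holds n cap σ η ↔ η x = η y := by
  by_cases h : η x = η y <;> simp [Tm.Holds, eqVar, Tm.eval, satOp, Op.eval, h]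

theorem holds_cell : (cell a x).Holds n cap σ η ↔ σ a (η x) ≠ 0 := by
  simp [Tm.Holds, cell, Tm.eval, Tm.zero]

theorem holds_mat : (mat a x y).Holds n cap σ η ↔ σ a (η x * n + η y) ≠ 0 := by
  simp [Tm.Holds, mat, Tm.eval]

theorem eval_cell : (cell a x).eval n cap σ η = σ a (η x) := by
  simp [cell, Tm.eval, Tm.zero]

theorem eval_scalar : (scalar a).eval n cap σ η = σ a 0 := by
  simp [scalar, Tm.eval, Tm.zero]

theorem satOp_lt {b c : ℕ} : satOp cap .lt b c ≠ 0 ↔ b < c := by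
  by_cases h : b < c <;> simp [satOp, Op.eval, h]

theorem iter_induction {α : Type} {f : ℕ → α → α} (I : ℕ → α → Prop) {m : ℕ} {s : α} (h0 : I 0 s)
    (h : ∀ i < m, ∀ s, I i s → I (i + 1) (f i s)) : I m (iter f m s) := by
  induction m with
  | zero => exact h0
  | succ m ih => exact h m (by omega) _ (ih fun i hi => h i (by omega))

/-- The arrays that a statement may change. -/
def St.writes : St → List ℕ
  | .skip => []
  | .set a _ _ _ => [a]
  | .seq c d => c.writes ++ d.writes
  | .ite _ c d => c.writes ++ d.writes
  | .loop _ c => c.writes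

theorem St.run_of_notMem : ∀ (c : St) (η : ℕ → ℕ) (σ : ℕ → ℕ → ℕ) (a : ℕ), a ∉ c.writes →
    c.run n cap η σ a = σ a
  | .skip, _, _, _, _ => rfl
  | .set b _ _ _, η, σ, a, h => by
    simp only [St.writes, List.mem_singleton] at h
    simp [St.run, h]
  | .seq c d, η, σ, a, h => by
    simp only [St.writes, List.mem_append, not_or] at h
    simp only [St.run]
    rw [d.run_of_notMem _ _ a h.2, c.run_of_notMem _ _ a h.1]
  | .ite t c d, η, σ, a, h => by
    simp only [St.writes, List.mem_append, not_or] at h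
    simp only [St.run]
    split_ifs
    · exact c.run_of_notMem _ _ a h.1
    · exact d.run_of_notMem _ _ a h.2
  | .loop x c, η, σ, a, h =>
    iter_induction (fun _ (σ' : ℕ → ℕ → ℕ) => σ' a = σ a) rfl fun i _ s hs => by
      rw [c.run_of_notMem _ _ a h, hs]

theorem run_setScalar : (setScalar a t).run n cap η σ =
    Function.update σ a (Function.update (σ a) 0 (t.eval n cap σ η)) := by
  simp [setScalar, St.run, Tm.eval, Tm.zero]

theorem run_setScalar_self : (setScalar a t).run n cap η σ a 0 = t.eval n cap σ η := by
  simp [run_setScalar]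

/-- A comprehension in place is correct if the new value of a cell depends on the array itself only
through the old value of this cell. -/
theorem run_fill (ht : ∀ i < n, ∀ σ' : ℕ → ℕ → ℕ, (∀ b, b ≠ a → σ' b = σ b) → σ' a i = σ a i →
      t.eval n cap σ' (Function.update η x i) = t.eval n cap σ (Function.update η x i))
    {i : ℕ} (hi : i < n) :
    (fill a x t).run n cap η σ a i = t.eval n cap σ (Function.update η x i) := by
  have := iter_induction (f := fun i σ => (St.set a .zero (.var x) t).run n cap
      (Function.update η x i) σ) (m := n) (s := σ)
    (fun k σ' => (∀ b, b ≠ a → σ' b = σ b) ∧ (∀ j, k ≤ j → σ' a j = σ a j) ∧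
      ∀ j < k, σ' a j = t.eval n cap σ (Function.update η x j))
    ⟨fun _ _ => rfl, fun _ _ => rfl, fun j hj => absurd hj (Nat.not_lt_zero j)⟩ ?_
  · exact this.2.2 i hi
  · rintro k hk σ' ⟨h1, h2, h3⟩
    simp only [St.run, Tm.eval, Tm.zero, Bool.toNat_false, zero_mul, zero_add,
      Function.update_self]
    refine ⟨fun b hb => by simp [hb, h1 b hb], fun j hj => ?_, fun j hj => ?_⟩
    · have : j ≠ k := by omega
      simp [this, h2 j (by omega)]
    · by_cases hjk : j = k
      · subst hjk
        simpa using ht j hk σ' h1 (h2 j le_rfl)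
      · simp [hjk, h3 j (by omega)]

theorem address_inj {n i j i' j' : ℕ} (hj : j < n) (hj' : j' < n) (h : i * n + j = i' * n + j') :
    i = i' ∧ j = j' := by
  have h1 : i = i' := by
    have e : (i * n + j) / n = (i' * n + j') / n := by rw [h]
    rwa [mul_comm, mul_comm i', Nat.mul_add_div (by omega), Nat.mul_add_div (by omega),
      Nat.div_eq_of_lt hj, Nat.div_eq_of_lt hj', add_zero, add_zero] at e
  subst h1
  exact ⟨rfl, by omega⟩

theorem run_fillMat (hxy : x ≠ y)
    (ht : ∀ η' : ℕ → ℕ, ∀ σ' : ℕ → ℕ → ℕ, (∀ b, b ≠ a → σ' b = σ b) →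
      t.eval n cap σ' η' = t.eval n cap σ η')
    {i j : ℕ} (hi : i < n) (hj : j < n) : (fillMat a x y t).run n cap η σ a (i * n + j) =
      t.eval n cap σ (Function.update (Function.update η x i) y j) := by
  let v : ℕ → ℕ → ℕ := fun i j => t.eval n cap σ (Function.update (Function.update η x i) y j)
  have := iter_induction (f := fun i σ => (St.loop y (.set a (.var x) (.var y) t)).run n cap
      (Function.update η x i) σ) (m := n) (s := σ)
    (fun k σ' => (∀ b, b ≠ a → σ' b = σ b) ∧ ∀ i < k, ∀ j < n, σ' a (i * n + j) = v i j)
    ⟨fun _ _ => rfl, fun i hi => absurd hi (Nat.not_lt_zero i)⟩ ?_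
  · exact this.2 i hi j hj
  · rintro k hk σ' ⟨h1, h2⟩
    have := iter_induction (f := fun j σ => (St.set a (.var x) (.var y) t).run n cap
        (Function.update (Function.update η x k) y j) σ) (m := n) (s := σ')
      (fun l σ' => (∀ b, b ≠ a → σ' b = σ b) ∧ (∀ i < k, ∀ j < n, σ' a (i * n + j) = v i j) ∧
        ∀ j < l, σ' a (k * n + j) = v k j)
      ⟨h1, h2, fun i hi => absurd hi (Nat.not_lt_zero i)⟩ ?_
    · refine ⟨this.1, fun i hi j hj => ?_⟩
      rcases (Nat.lt_succ_iff.1 hi).lt_or_eq with h | rfl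
      · exact this.2.1 i h j hj
      · exact this.2.2 j hj
    · rintro l hl σ' ⟨h1, h2, h3⟩
      simp only [St.run, Tm.eval, Function.update_self, Function.update_of_ne hxy]
      refine ⟨fun b hb => by simp [hb, h1 b hb], fun i hi j hj => ?_, fun j hj => ?_⟩
      · have : i * n + j ≠ k * n + l := fun h => by
          have := (address_inj hj hl h).1
          omega
        simp [this, h2 i hi j hj]
      · by_cases hjl : j = l
        · subst hjl
          simpa using ht _ σ' h1
        · simp [hjl, h3 j (by omega)]

end

/-! ### Vertex sets, weights and graphs in memory -/

section
variable {n : ℕ}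

/-- The array `m` is the indicator function of `A`. -/
def IsMask (m : ℕ → ℕ) (A : Finset (Fin n)) : Prop := ∀ v : Fin n, m v ≠ 0 ↔ v ∈ A

/-- The matrix `m` describes a family of vertex sets. -/
def IsFamily (m : ℕ → ℕ) (F : Fin n → Finset (Fin n)) : Prop :=
  ∀ i j : Fin n, m (i * n + j) ≠ 0 ↔ j ∈ F i

/-- The matrix `m` is the adjacency matrix of `G`. -/
def IsGraph (m : ℕ → ℕ) (G : SimpleGraph (Fin n)) : Prop :=
  ∀ i j : Fin n, m (i * n + j) ≠ 0 ↔ G.Adj i j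

/-- The array `m` lists the values of `u`. -/
def IsWeight (m : ℕ → ℕ) (u : Fin n → ℕ) : Prop := ∀ v : Fin n, m v = u v

variable {cap : ℕ} {σ : ℕ → ℕ → ℕ} {η : ℕ → ℕ} {t : Tm} {a x y : ℕ}

theorem isMask_fill {A : Finset (Fin n)}
    (ht : ∀ i < n, ∀ σ' : ℕ → ℕ → ℕ, (∀ b, b ≠ a → σ' b = σ b) → σ' a i = σ a i →
      t.eval n cap σ' (Function.update η x i) = t.eval n cap σ (Function.update η x i))
    (h : ∀ i : Fin n, t.Holds n cap σ (Function.update η x i) ↔ i ∈ A) :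
    IsMask ((fill a x t).run n cap η σ a) A := fun i => by
  rw [run_fill ht i.2]
  exact h i

theorem isWeight_fill {u : Fin n → ℕ}
    (ht : ∀ i < n, ∀ σ' : ℕ → ℕ → ℕ, (∀ b, b ≠ a → σ' b = σ b) → σ' a i = σ a i →
      t.eval n cap σ' (Function.update η x i) = t.eval n cap σ (Function.update η x i))
    (h : ∀ i : Fin n, t.eval n cap σ (Function.update η x i) = u i) :
    IsWeight ((fill a x t).run n cap η σ a) u := fun i => by
  rw [run_fill ht i.2]
  exact h i

theorem isFamily_fillMat {F : Fin n → Finset (Fin n)} (hxy : x ≠ y)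
    (ht : ∀ η' : ℕ → ℕ, ∀ σ' : ℕ → ℕ → ℕ, (∀ b, b ≠ a → σ' b = σ b) →
      t.eval n cap σ' η' = t.eval n cap σ η')
    (h : ∀ i j : Fin n,
      t.Holds n cap σ (Function.update (Function.update η x i) y j) ↔ j ∈ F i) :
    IsFamily ((fillMat a x y t).run n cap η σ a) F := fun i j => by
  rw [run_fillMat hxy ht i.2 j.2]
  exact h i j

end

end Bounded

/-! ### Elimination of clique modules -/

namespace Bounded

open RAM Graph

/-- `b ∈ S` and some `c` in the row or set described by the term `r c` is equal or adjacent to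
`b`; here `b` and `c` are the variables `3` and `4`. -/
def nbhdTm (o : ℕ) (r : Tm) : Tm :=
  tand (cell o 3) (.sup 4 (tand r (tor (eqVar 4 3) (mat 0 4 3))))

/-- One `moduleStep` for all rows of the matrix `o + 3` simultaneously. -/
def stepSt (o : ℕ) : St :=
  .seq (fillMat (o + 4) 2 3 (nbhdTm o (mat (o + 3) 2 4)))
  (.seq (fillMat (o + 5) 2 3 (tor (mat (o + 3) 2 3) (tand (mat (o + 4) 2 3)
    (.sup 5 (tand (mat (o + 4) 2 5) (tand (tnot (eqVar 5 3)) (tnot (mat 0 3 5))))))))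
  (fillMat (o + 3) 2 3 (mat (o + 5) 2 3)))

/-- For the vertex set `o`, compute the least clique modules of all its vertices in the matrix
`o + 3`. -/
def closureSt (o : ℕ) : St :=
  .seq (fillMat (o + 3) 2 3 (tand (eqVar 2 3) (cell o 2))) (.loop 1 (stepSt o))

/-- `2` is a vertex whose least clique module is minimal. -/
def goodTm (o : ℕ) : Tm :=
  tand (cell o 2) (tnot (.sup 3 (tand (mat (o + 3) 2 3) (tnot (mat (o + 3) 3 2)))))

/-- Choose a minimal clique module `o + 6` and its closed neighbourhood `o + 7`. -/
def chooseSt (o : ℕ) : St :=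
  .seq (setScalar (o + 9) (.sup 2 (.cond (goodTm o) (.var 2) .zero)))
  (.seq (fill (o + 6) 3 (.read (o + 3) (scalar (o + 9)) (.var 3)))
  (fill (o + 7) 3 (nbhdTm o (cell (o + 6) 4))))

/-- The maximum weight `o + 8` of an independent set in the clique module `o + 6`: for each vertex
`6` of the module, `sub` deals with its non-neighbours. -/
def valueSt (o : ℕ) (sub : St) : St :=
  .seq (setScalar (o + 8) .zero)
  (.loop 6 (.ite (cell (o + 6) 6)
    (.seq (fill (o + 10) 3 (tand (cell (o + 6) 3) (tand (tnot (eqVar 3 6)) (tnot (mat 0 6 3)))))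
    (.seq (fill (o + 11) 3 (cell (o + 1) 3))
    (.seq sub
    (setScalar (o + 8) (.cond (.op .lt (scalar (o + 8)) (.op .add (cell (o + 1) 6) (scalar (o + 12))))
      (.op .add (cell (o + 1) 6) (scalar (o + 12))) (scalar (o + 8)))))))
    .skip))

/-- Account for the clique module `o + 6` and remove it. -/
def removeSt (o : ℕ) : St :=
  .seq (setScalar (o + 2) (.op .add (scalar (o + 2)) (scalar (o + 8))))
  (.seq (fill (o + 1) 3 (.cond (cell (o + 7) 3) (.op .sub (cell (o + 1) 3) (scalar (o + 8)))
    (cell (o + 1) 3)))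
  (fill o 3 (tand (cell o 3) (tnot (cell (o + 6) 3)))))

/-- Compute in `o + 2` the maximum weight of an independent set in the vertex set `o` with respect
to the weights `o + 1`, by successive elimination of minimal clique modules. -/
def elim (o : ℕ) (sub : St) : St :=
  .seq (setScalar (o + 2) .zero)
  (.loop 0 (.seq (closureSt o) (.seq (chooseSt o) (.seq (valueSt o sub) (removeSt o)))))

variable {n cap : ℕ} {G : SimpleGraph (Fin n)} {S : Finset (Fin n)} {σ : ℕ → ℕ → ℕ} {η : ℕ → ℕ}
  {o : ℕ}

/-- The family of sets after `k` rounds of the closure. -/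
noncomputable def rounds (G : SimpleGraph (Fin n)) (S : Finset (Fin n)) (k : ℕ) (a : Fin n) :
    Finset (Fin n) :=
  open Classical in if a ∈ S then (moduleStep G S)^[k] {a} else ∅

theorem rounds_succ (k : ℕ) (a : Fin n) :
    rounds G S (k + 1) a = moduleStep G S (rounds G S k a) := by
  classical
  unfold rounds
  split_ifs
  · rw [Function.iterate_succ_apply']
  · ext b; simp [mem_moduleStep, mem_closedNbhd]

theorem rounds_n (a : Fin n) :
    rounds G S n a = open Classical in if a ∈ S then moduleOf G S a else ∅ := by
  simp [rounds, moduleOf]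

theorem holds_nbhdTm {R : Finset (Fin n)} {r : Tm} (hG : IsGraph (σ 0) G) (hS : IsMask (σ o) S)
    (b : Fin n) (hb : η 3 = b)
    (hr : ∀ c : Fin n, r.Holds n cap σ (Function.update η 4 c) ↔ c ∈ R) :
    (nbhdTm o r).Holds n cap σ η ↔ b ∈ closedNbhd G S R := by
  simp only [nbhdTm, holds_and, holds_cell, holds_sup, holds_or, holds_eqVar, holds_mat, hr,
    mem_closedNbhd, hb, Function.update_self, ne_eq, Nat.reduceEqDiff,
    not_false_eq_true, Function.update_of_ne, Fin.val_inj]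
  rw [← ne_eq, hS b]
  simp only [hG _ b]

theorem run_stepSt {F : Fin n → Finset (Fin n)} (hG : IsGraph (σ 0) G) (hS : IsMask (σ o) S)
    (hF : IsFamily (σ (o + 3)) F) :
    IsFamily ((stepSt o).run n cap η σ (o + 3)) fun a => moduleStep G S (F a) := by
  simp only [stepSt, St.run]
  set σ₁ := (fillMat (o + 4) 2 3 (nbhdTm o (mat (o + 3) 2 4))).run n cap η σ with hσ₁
  have h1 : IsFamily (σ₁ (o + 4)) fun a => closedNbhd G S (F a) := by
    refine isFamily_fillMat (by decide) (fun η' σ' h => ?_) fun i j => ?_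
    · simp [nbhdTm, tand, tor, cell, mat, eqVar, Tm.eval, Tm.zero, h]
    · refine holds_nbhdTm hG hS j (by simp) fun c => ?_
      simp only [holds_mat]
      simpa [Function.update_apply] using hF i c
  have f1 : ∀ b, b ≠ o + 4 → σ₁ b = σ b := fun b hb =>
    St.run_of_notMem _ _ _ _ (by simpa [fillMat, St.writes] using hb)
  set σ₂ := (fillMat (o + 5) 2 3 (tor (mat (o + 3) 2 3) (tand (mat (o + 4) 2 3)
    (.sup 5 (tand (mat (o + 4) 2 5) (tand (tnot (eqVar 5 3)) (tnot (mat 0 3 5)))))))).run n cap η σ₁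
    with hσ₂
  have h2 : IsFamily (σ₂ (o + 5)) fun a => moduleStep G S (F a) := by
    refine isFamily_fillMat (by decide) (fun η' σ' h => ?_) fun i j => ?_
    · simp [tand, tor, tnot, mat, eqVar, Tm.eval, Tm.zero, h]
    · have e0 : σ₁ 0 = σ 0 := f1 0 (by omega)
      have e3 : σ₁ (o + 3) = σ (o + 3) := f1 (o + 3) (by omega)
      simp only [holds_or, holds_and, holds_mat, holds_sup, holds_not, holds_eqVar,
        Function.update_apply, mem_moduleStep, Nat.reduceEqDiff, if_true,
        if_false, e0, e3, Fin.val_inj]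
      rw [hF i j, h1 i j]
      simp only [h1 i _, hG j _, ne_eq]
  have f2 : ∀ b, b ≠ o + 5 → σ₂ b = σ₁ b := fun b hb =>
    St.run_of_notMem _ _ _ _ (by simpa [fillMat, St.writes] using hb)
  refine isFamily_fillMat (by decide) (fun η' σ' h => ?_) fun i j => ?_
  · simp [mat, Tm.eval, h]
  · simp only [holds_mat]
    simpa [Function.update_apply] using h2 i j

theorem run_closureSt_of_ne {b : ℕ} (h3 : b ≠ o + 3) (h4 : b ≠ o + 4) (h5 : b ≠ o + 5) :
    (closureSt o).run n cap η σ b = σ b :=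
  St.run_of_notMem _ _ _ _ (by simp [closureSt, stepSt, fillMat, St.writes, h3, h4, h5])

theorem run_closureSt (hG : IsGraph (σ 0) G) (hS : IsMask (σ o) S) :
    IsFamily ((closureSt o).run n cap η σ (o + 3)) (rounds G S n) := by
  simp only [closureSt, St.run]
  set σ₁ := (fillMat (o + 3) 2 3 (tand (eqVar 2 3) (cell o 2))).run n cap η σ
  have h1 : IsFamily (σ₁ (o + 3)) (rounds G S 0) := by
    refine isFamily_fillMat (by decide) (fun η' σ' h => ?_) fun i j => ?_
    · simp [tand, eqVar, cell, Tm.eval, Tm.zero, h]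
    · simp only [holds_and, holds_eqVar, holds_cell, Function.update_apply, Nat.reduceEqDiff, if_true, if_false, Fin.val_inj]
      rw [hS i, rounds]
      by_cases h : i ∈ S <;> simp [h, eq_comm]
  have f1 : ∀ b, b ≠ o + 3 → σ₁ b = σ b := fun b hb =>
    St.run_of_notMem _ _ _ _ (by simpa [fillMat, St.writes] using hb)
  refine (iter_induction (fun k (σ' : ℕ → ℕ → ℕ) => σ' 0 = σ 0 ∧ σ' o = σ o ∧
    IsFamily (σ' (o + 3)) (rounds G S k)) ⟨f1 0 (by omega), f1 o (by omega), h1⟩ ?_).2.2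
  rintro k _ σ' ⟨e0, eo, hF⟩
  have hw : ∀ b, b ≠ o + 3 → b ≠ o + 4 → b ≠ o + 5 →
      (stepSt o).run n cap (Function.update η 1 k) σ' b = σ' b := fun b h3 h4 h5 =>
    St.run_of_notMem _ _ _ _ (by simp [stepSt, fillMat, St.writes, h3, h4, h5])
  refine ⟨(hw 0 (by omega) (by omega) (by omega)).trans e0,
    (hw o (by omega) (by omega) (by omega)).trans eo, ?_⟩
  have := run_stepSt (n := n) (cap := cap) (η := Function.update η 1 k) (e0 ▸ hG) (eo ▸ hS) hF
  intro i j
  rw [rounds_succ]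
  exact this i j

theorem holds_goodTm (hS : IsMask (σ o) S) (hF : IsFamily (σ (o + 3)) (rounds G S n)) (a : Fin n)
    (ha : η 2 = a) : (goodTm o).Holds n cap σ η ↔ IsGood G S a := by
  simp only [goodTm, holds_and, holds_cell, holds_not, holds_sup, holds_mat, Function.update_self,
    ne_eq, Nat.reduceEqDiff, not_false_eq_true, Function.update_of_ne, ha]
  rw [← ne_eq, hS a]
  simp only [hF a _, hF _ a, rounds_n, IsGood, not_exists, not_and, not_not]
  refine and_congr_right fun haS => ?_
  simp only [haS, if_true]
  refine forall₂_congr fun b hb => ?_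
  rw [if_pos ((isCliqueModule_moduleOf haS).sub hb)]

theorem run_chooseSt_of_ne {b : ℕ} (h6 : b ≠ o + 6) (h7 : b ≠ o + 7) (h9 : b ≠ o + 9) :
    (chooseSt o).run n cap η σ b = σ b :=
  St.run_of_notMem _ _ _ _ (by simp [chooseSt, setScalar, fill, St.writes, h6, h7, h9])

theorem run_chooseSt (hG : IsGraph (σ 0) G) (hS : IsMask (σ o) S)
    (hF : IsFamily (σ (o + 3)) (rounds G S n)) :
    ∃ R, IsMask ((chooseSt o).run n cap η σ (o + 6)) R ∧
      IsMask ((chooseSt o).run n cap η σ (o + 7)) (closedNbhd G S R) ∧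
      (S = ∅ ∧ R = ∅ ∨ IsMinCliqueModule G S R) := by
  let g : ℕ → ℕ := fun i =>
    (Tm.cond (goodTm o) (.var 2) .zero).eval n cap σ (Function.update η 2 i)
  have hg : ∀ a : Fin n, g a = open Classical in if IsGood G S a then (a : ℕ) else 0 := by
    intro a
    have := holds_goodTm (cap := cap) (η := Function.update η 2 a) hS hF a (by simp)
    simp only [g, Tm.eval, Tm.zero, Function.update_self, Bool.toNat_false]
    simp only [Tm.Holds] at this
    by_cases h : IsGood G S a
    · rw [if_pos h, if_pos (this.2 h)]
    · rw [if_neg h, if_neg (fun h' => h (this.1 h'))]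
  set s := (Finset.range n).sup g with hs
  have hrow : ∃ R, (∀ j : Fin n, σ (o + 3) (s * n + j) ≠ 0 ↔ j ∈ R) ∧
      (S = ∅ ∧ R = ∅ ∨ IsMinCliqueModule G S R) := by
    rcases S.eq_empty_or_nonempty with hSe | hSne
    · refine ⟨∅, fun j => ?_, .inl ⟨hSe, rfl⟩⟩
      have hs0 : s = 0 := by
        refine Nat.le_zero.1 (Finset.sup_le fun i hi => ?_)
        have := hg ⟨i, Finset.mem_range.1 hi⟩
        rw [if_neg (fun h => by simpa [hSe] using h.1)] at this
        exact this.le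
      have := hF ⟨0, by have := j.2; omega⟩ j
      rw [rounds_n, if_neg (by simp [hSe])] at this
      rw [hs0]
      exact this
    · obtain ⟨a, ha, hsa⟩ : ∃ a : Fin n, IsGood G S a ∧ s = a := by
        obtain ⟨b, hb⟩ := exists_isGood (G := G) hSne
        obtain ⟨i, hi, hsi⟩ := Finset.exists_mem_eq_sup (Finset.range n)
          ⟨b, Finset.mem_range.2 b.2⟩ g
        have hi' := hg ⟨i, Finset.mem_range.1 hi⟩
        by_cases h : IsGood G S ⟨i, Finset.mem_range.1 hi⟩
        · rw [if_pos h] at hi'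
          exact ⟨_, h, hsi.trans hi'⟩
        · rw [if_neg h] at hi'
          have hb0 : g b ≤ s := Finset.le_sup (Finset.mem_range.2 b.2)
          rw [hg b, if_pos hb] at hb0
          have : s = 0 := hsi.trans hi'
          exact ⟨b, hb, by omega⟩
      refine ⟨moduleOf G S a, fun j => ?_, .inr ha.isMinCliqueModule⟩
      have := hF a j
      rw [rounds_n, if_pos ha.1] at this
      rw [hsa]
      exact this
  obtain ⟨R, hR, hcase⟩ := hrow
  refine ⟨R, ?_⟩
  simp only [chooseSt, St.run]
  set σ₁ := (setScalar (o + 9) (.sup 2 (.cond (goodTm o) (.var 2) .zero))).run n cap η σ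
  have hs1 : σ₁ (o + 9) 0 = s := run_setScalar_self
  have f1 : ∀ b, b ≠ o + 9 → σ₁ b = σ b := fun b hb =>
    St.run_of_notMem _ _ _ _ (by simpa [setScalar, St.writes] using hb)
  set σ₂ := (fill (o + 6) 3 (.read (o + 3) (scalar (o + 9)) (.var 3))).run n cap η σ₁
  have f2 : ∀ b, b ≠ o + 6 → σ₂ b = σ₁ b := fun b hb =>
    St.run_of_notMem _ _ _ _ (by simpa [fill, St.writes] using hb)
  have h2 : IsMask (σ₂ (o + 6)) R := by
    refine isMask_fill (fun i _ σ' h _ => ?_) fun j => ?_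
    · simp [scalar, Tm.eval, Tm.zero, h]
    · simp only [Tm.Holds, Tm.eval, eval_scalar, hs1, Function.update_self]
      rw [f1 _ (by omega)]
      exact hR j
  refine ⟨?_, ?_, hcase⟩
  · rw [St.run_of_notMem _ _ _ _ (by simp [fill, St.writes])]
    exact h2
  · refine isMask_fill (fun i _ σ' h _ => ?_) fun j => ?_
    · simp [nbhdTm, tand, tor, cell, mat, eqVar, Tm.eval, Tm.zero, h]
    · refine holds_nbhdTm ?_ ?_ j (by simp) fun c => ?_
      · rw [f2 _ (by omega), f1 _ (by omega)]; exact hG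
      · rw [f2 _ (by omega), f1 _ (by omega)]; exact hS
      · simp only [holds_cell, Function.update_self]
        exact h2 c

/-- The statement `c` computes in `o + 2` the maximum weight of an independent set in any vertex set
of the class `C`, given in `o`, with respect to weights given in `o + 1`, and leaves the arrays below
`o` alone. -/
structure Solves (n cap : ℕ) (G : SimpleGraph (Fin n)) (o : ℕ) (c : St)
    (C : Finset (Fin n) → Prop) : Prop where
  le_of_mem_writes : ∀ b ∈ c.writes, o ≤ b
  eq_wis : ∀ η σ S u, IsGraph (σ 0) G → IsMask (σ o) S → IsWeight (σ (o + 1)) u → C S →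
    ∑ v, u v ≤ cap → c.run n cap η σ (o + 2) 0 = wis G u S

theorem Solves.run_of_lt {c : St} {C : Finset (Fin n) → Prop} (h : Solves n cap G o c C) {b : ℕ}
    (hb : b < o) : c.run n cap η σ b = σ b :=
  St.run_of_notMem _ _ _ _ fun h' => by have := h.le_of_mem_writes b h'; omega

theorem wis_le_cap {u : Fin n → ℕ} (hu : ∑ v, u v ≤ cap) (A : Finset (Fin n)) :
    wis G u A ≤ cap :=
  (wis_le_sum u A).trans ((Finset.sum_le_sum_of_subset (Finset.subset_univ A)).trans hu)

theorem run_valueSt_of_ne {sub : St} {C : Finset (Fin n) → Prop}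
    (hsub : Solves n cap G (o + 10) sub C) {b : ℕ} (hb : b < o + 10) (h8 : b ≠ o + 8) :
    (valueSt o sub).run n cap η σ b = σ b :=
  St.run_of_notMem _ _ _ _ fun h => by
    simp only [valueSt, setScalar, fill, St.writes, List.mem_append, List.mem_singleton,
      List.not_mem_nil, or_false] at h
    rcases h with h | h | h | h | h
    · omega
    · omega
    · omega
    · have := hsub.le_of_mem_writes b h
      omega
    · omega

theorem run_valueSt {sub : St} {C : Finset (Fin n) → Prop} (hsub : Solves n cap G (o + 10) sub C)
    (hG : IsGraph (σ 0) G) {R : Finset (Fin n)} {u : Fin n → ℕ} (hR : IsMask (σ (o + 6)) R)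
    (hu : IsWeight (σ (o + 1)) u) (hC : ∀ v ∈ R, C (nonNbrs G R v)) (hcap : ∑ v, u v ≤ cap) :
    (valueSt o sub).run n cap η σ (o + 8) 0 = wis G u R := by
  classical
  let f : Fin n → ℕ := fun v => u v + wis G u (nonNbrs G R v)
  have hfle : ∀ v ∈ R, f v ≤ cap := fun v hv =>
    (add_wis_nonNbrs_le u hv).trans (wis_le_cap hcap R)
  simp only [valueSt, St.run]
  refine (iter_induction (fun k (σ' : ℕ → ℕ → ℕ) =>
    (∀ b, b < o + 10 → b ≠ o + 8 → σ' b = σ b) ∧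
    σ' (o + 8) 0 = (R.filter fun v : Fin n => (v : ℕ) < k).sup f) ⟨fun b hb h8 => ?_, ?_⟩ ?_).2.trans ?_
  · exact St.run_of_notMem _ _ _ _ (by simpa [setScalar, St.writes] using h8)
  · rw [run_setScalar_self]
    simp [Tm.zero, Tm.eval]
  · rintro k hk σ' ⟨hfr, hval⟩
    have e6 : σ' (o + 6) = σ (o + 6) := hfr _ (by omega) (by omega)
    have e1 : σ' (o + 1) = σ (o + 1) := hfr _ (by omega) (by omega)
    have hkR : (cell (o + 6) 6).eval n cap σ' (Function.update η 6 k) ≠ 0 ↔ (⟨k, hk⟩ : Fin n) ∈ R := by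
      rw [eval_cell, Function.update_self, e6]
      exact hR ⟨k, hk⟩
    by_cases hkmem : (⟨k, hk⟩ : Fin n) ∈ R
    · rw [if_pos (hkR.2 hkmem)]
      set ηk := Function.update η 6 k
      have hη : ηk 6 = k := by simp [ηk]
      set σ₁ := (fill (o + 10) 3 (tand (cell (o + 6) 3) (tand (tnot (eqVar 3 6))
        (tnot (mat 0 6 3))))).run n cap ηk σ'
      have f1 : ∀ b, b ≠ o + 10 → σ₁ b = σ' b := fun b hb =>
        St.run_of_notMem _ _ _ _ (by simpa [fill, St.writes] using hb)
      have h1 : IsMask (σ₁ (o + 10)) (nonNbrs G R ⟨k, hk⟩) := by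
        refine isMask_fill (fun i _ σ' h _ => ?_) fun j => ?_
        · simp [tand, tnot, cell, mat, eqVar, Tm.eval, Tm.zero, h]
        · simp only [holds_and, holds_cell, holds_not, holds_eqVar, holds_mat, Function.update_self,
            ne_eq, Nat.reduceEqDiff, not_false_eq_true, Function.update_of_ne, hη, mem_nonNbrs]
          rw [← ne_eq, e6, hR j, ← ne_eq, hfr 0 (by omega) (by omega)]
          have : ¬σ 0 (k * n + j) = 0 ↔ G.Adj ⟨k, hk⟩ j := hG ⟨k, hk⟩ j
          rw [this, Fin.ext_iff]
      set σ₂ := (fill (o + 11) 3 (cell (o + 1) 3)).run n cap ηk σ₁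
      have f2 : ∀ b, b ≠ o + 11 → σ₂ b = σ₁ b := fun b hb =>
        St.run_of_notMem _ _ _ _ (by simpa [fill, St.writes] using hb)
      have h2 : IsWeight (σ₂ (o + 11)) u := by
        refine isWeight_fill (fun i _ σ' h _ => ?_) fun j => ?_
        · simp [cell, Tm.eval, Tm.zero, h]
        · rw [eval_cell, Function.update_self, f1 _ (by omega), e1]
          exact hu j
      have h3 := hsub.eq_wis ηk σ₂ (nonNbrs G R ⟨k, hk⟩) u
        (by rw [f2 _ (by omega), f1 _ (by omega), hfr _ (by omega) (by omega)]; exact hG)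
        (by rw [f2 _ (by omega)]; exact h1) h2 (hC _ hkmem) hcap
      have f3 : ∀ b, b < o + 10 → sub.run n cap ηk σ₂ b = σ' b := fun b hb => by
        rw [hsub.run_of_lt hb, f2 _ (by omega), f1 _ (by omega)]
      set σ₃ := sub.run n cap ηk σ₂
      refine ⟨fun b hb h8 => ?_, ?_⟩
      · rw [St.run_of_notMem _ _ _ _ (by simpa [setScalar, St.writes] using h8), f3 b hb,
          hfr b hb h8]
      · have hadd : satOp cap .add (σ₃ (o + 1) k) (σ₃ (o + 12) 0) = f ⟨k, hk⟩ := by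
          rw [h3, f3 _ (by omega), e1]
          have := hu ⟨k, hk⟩
          simp only at this
          rw [this]
          exact min_eq_left (hfle _ hkmem)
        rw [run_setScalar_self]
        simp only [Tm.eval, eval_scalar, eval_cell, hη, hadd]
        rw [f3 _ (by omega), hval]
        have hins : (R.filter fun v : Fin n => (v : ℕ) < k + 1) =
            insert ⟨k, hk⟩ (R.filter fun v : Fin n => (v : ℕ) < k) := by
          ext v
          simp only [Finset.mem_filter, Finset.mem_insert, Fin.ext_iff]
          constructor
          · rintro ⟨h, h'⟩
            by_cases hvk : (v : ℕ) = k
            · exact .inl hvk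
            · exact .inr ⟨h, by omega⟩
          · rintro (h | ⟨h, h'⟩)
            · have : v = ⟨k, hk⟩ := Fin.ext h
              exact ⟨this ▸ hkmem, by omega⟩
            · exact ⟨h, by omega⟩
        rw [hins, Finset.sup_insert]
        by_cases h : (R.filter fun v : Fin n => (v : ℕ) < k).sup f < f ⟨k, hk⟩
        · rw [if_pos (satOp_lt.2 h)]
          exact (max_eq_left h.le).symm
        · rw [if_neg (satOp_lt.not.2 h)]
          exact (max_eq_right (not_lt.1 h)).symm
    · rw [if_neg (fun h => hkmem (hkR.1 h))]
      refine ⟨hfr, hval.trans ?_⟩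
      congr 1
      ext v
      simp only [Finset.mem_filter]
      refine and_congr_right fun hv => ?_
      have : (v : ℕ) ≠ k := fun h => hkmem (by
        have : v = ⟨k, hk⟩ := Fin.ext h
        exact this ▸ hv)
      omega
  · rw [wis_eq_sup]
    congr 1
    ext v
    simp

theorem run_removeSt_of_ne {b : ℕ} (h0 : b ≠ o) (h1 : b ≠ o + 1) (h2 : b ≠ o + 2) :
    (removeSt o).run n cap η σ b = σ b :=
  St.run_of_notMem _ _ _ _ (by simp [removeSt, setScalar, fill, St.writes, h0, h1, h2])

theorem run_removeSt {R N : Finset (Fin n)} {u : Fin n → ℕ} (hS : IsMask (σ o) S)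
    (hR : IsMask (σ (o + 6)) R) (hN : IsMask (σ (o + 7)) N) (hu : IsWeight (σ (o + 1)) u)
    (hcap : σ (o + 2) 0 + σ (o + 8) 0 ≤ cap) :
    IsMask ((removeSt o).run n cap η σ o) (S \ R) ∧
    IsWeight ((removeSt o).run n cap η σ (o + 1))
      (fun v => if v ∈ N then u v - σ (o + 8) 0 else u v) ∧
    (removeSt o).run n cap η σ (o + 2) 0 = σ (o + 2) 0 + σ (o + 8) 0 := by
  simp only [removeSt, St.run]
  set σ₁ := (setScalar (o + 2) (.op .add (scalar (o + 2)) (scalar (o + 8)))).run n cap η σ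
  have f1 : ∀ b, b ≠ o + 2 → σ₁ b = σ b := fun b hb =>
    St.run_of_notMem _ _ _ _ (by simpa [setScalar, St.writes] using hb)
  have h1 : σ₁ (o + 2) 0 = σ (o + 2) 0 + σ (o + 8) 0 := by
    refine run_setScalar_self.trans ?_
    simp only [Tm.eval, eval_scalar, satOp]
    exact min_eq_left hcap
  set σ₂ := (fill (o + 1) 3 (.cond (cell (o + 7) 3) (.op .sub (cell (o + 1) 3) (scalar (o + 8)))
    (cell (o + 1) 3))).run n cap η σ₁
  have f2 : ∀ b, b ≠ o + 1 → σ₂ b = σ₁ b := fun b hb =>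
    St.run_of_notMem _ _ _ _ (by simpa [fill, St.writes] using hb)
  have f3 : ∀ b, b ≠ o → (fill o 3 (tand (cell o 3) (tnot (cell (o + 6) 3)))).run n cap η σ₂ b =
      σ₂ b := fun b hb =>
    St.run_of_notMem _ _ _ _ (by simpa [fill, St.writes] using hb)
  refine ⟨isMask_fill (fun i _ σ' h h' => ?_) fun j => ?_, ?_, ?_⟩
  · simp [tand, tnot, cell, Tm.eval, Tm.zero, h, h']
  · simp only [holds_and, holds_not, holds_cell, Function.update_self, Finset.mem_sdiff]
    rw [f2 _ (by omega), f2 _ (by omega), f1 _ (by omega), f1 _ (by omega), hS j, hR j]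
  · rw [f3 _ (by omega)]
    refine isWeight_fill (fun i _ σ' h h' => ?_) fun j => ?_
    · simp [cell, scalar, Tm.eval, Tm.zero, h, h']
    · simp only [Tm.eval, eval_cell, eval_scalar, Function.update_self]
      rw [f1 _ (by omega), f1 _ (by omega), f1 _ (by omega), hu j]
      by_cases h : j ∈ N
      · rw [if_pos ((hN j).2 h), if_pos h]; rfl
      · rw [if_neg (fun h' => h ((hN j).1 h')), if_neg h]
  · rw [f3 _ (by omega), f2 _ (by omega), h1]

/-- Elimination is correct on a hereditary class of vertex sets if `sub` can deal with the
non-neighbours of any vertex within a minimal clique module. -/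
theorem solves_elim (ho : 0 < o) {sub : St} {C C' : Finset (Fin n) → Prop}
    (hsub : Solves n cap G (o + 10) sub C') (hmono : ∀ A B, A ⊆ B → C B → C A)
    (hC : ∀ A R, C A → IsMinCliqueModule G A R → ∀ v ∈ R, C' (nonNbrs G R v)) :
    Solves n cap G o (elim o sub) C := by
  classical
  refine ⟨fun b hb => ?_, fun η σ S u hG hS hu hCS hcap => ?_⟩
  · simp only [elim, closureSt, stepSt, chooseSt, valueSt, removeSt, setScalar, fill, fillMat,
      St.writes, List.mem_append, List.mem_singleton, List.not_mem_nil, or_false] at hb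
    have : b ∈ sub.writes → o ≤ b := fun h => by
      have := hsub.le_of_mem_writes b h
      omega
    by_cases h : b ∈ sub.writes
    · exact this h
    · simp only [h, false_or] at hb
      omega
  simp only [elim, St.run]
  have f0 : ∀ b, b ≠ o + 2 → (setScalar (o + 2) .zero).run n cap η σ b = σ b := fun b hb =>
    St.run_of_notMem _ _ _ _ (by simpa [setScalar, St.writes] using hb)
  have := iter_induction (m := n)
    (f := fun i σ => (removeSt o).run n cap (Function.update η 0 i)
      ((valueSt o sub).run n cap (Function.update η 0 i) ((chooseSt o).run n cap
        (Function.update η 0 i) ((closureSt o).run n cap (Function.update η 0 i) σ))))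
    (s := (setScalar (o + 2) .zero).run n cap η σ)
    (fun k (σ' : ℕ → ℕ → ℕ) => ∃ A u', IsGraph (σ' 0) G ∧ IsMask (σ' o) A ∧
      IsWeight (σ' (o + 1)) u' ∧ A ⊆ S ∧ A.card ≤ n - k ∧ (∀ v, u' v ≤ u v) ∧
      σ' (o + 2) 0 + wis G u' A = wis G u S) ⟨S, u, ?_, ?_, ?_, subset_rfl, ?_, fun _ => le_rfl, ?_⟩ ?_
  · obtain ⟨A, u', -, -, -, -, hcard, -, h⟩ := this
    have hA : A = ∅ := Finset.card_eq_zero.1 (by omega)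
    rw [hA, wis_empty, add_zero] at h
    exact h
  · rw [f0 0 (by omega)]; exact hG
  · rw [f0 _ (by omega)]; exact hS
  · rw [f0 _ (by omega)]; exact hu
  · simpa using Finset.card_le_univ S
  · rw [run_setScalar_self]
    simp [Tm.zero, Tm.eval]
  · rintro k hk σ₀ ⟨A, u', hG0, hA, hu', hAS, hcard, hle, hval⟩
    set ηk := Function.update η 0 k
    have hcap' : ∑ v, u' v ≤ cap := (Finset.sum_le_sum fun v _ => hle v).trans hcap
    set σ₁ := (closureSt o).run n cap ηk σ₀
    have f1 : ∀ b, b ≠ o + 3 → b ≠ o + 4 → b ≠ o + 5 → σ₁ b = σ₀ b := fun b h3 h4 h5 =>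
      run_closureSt_of_ne h3 h4 h5
    have h1 := run_closureSt (cap := cap) (η := ηk) hG0 hA
    set σ₂ := (chooseSt o).run n cap ηk σ₁
    have f2 : ∀ b, b ≠ o + 6 → b ≠ o + 7 → b ≠ o + 9 → σ₂ b = σ₁ b := fun b h6 h7 h9 =>
      run_chooseSt_of_ne h6 h7 h9
    have g2 : ∀ b, b ≤ o + 2 → σ₂ b = σ₀ b := fun b hb => by
      rw [f2 _ (by omega) (by omega) (by omega), f1 _ (by omega) (by omega) (by omega)]
    obtain ⟨R, hR, hN, hcase⟩ := run_chooseSt (cap := cap) (η := ηk) (σ := σ₁) (S := A) (G := G)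
      (o := o) (by rw [f1 _ (by omega) (by omega) (by omega)]; exact hG0)
      (by rw [f1 _ (by omega) (by omega) (by omega)]; exact hA) h1
    have hRA : R ⊆ A := by
      rcases hcase with ⟨-, rfl⟩ | h
      · exact Finset.empty_subset _
      · exact h.sub
    have hCR : ∀ v ∈ R, C' (nonNbrs G R v) := by
      rcases hcase with ⟨-, rfl⟩ | h
      · simp
      · exact hC A R (hmono A S hAS hCS) h
    have hvalue := run_valueSt (η := ηk) hsub (σ := σ₂) (R := R) (u := u')
      (by rw [g2 _ (by omega)]; exact hG0) hR (by rw [g2 _ (by omega)]; exact hu') hCR hcap'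
    set σ₃ := (valueSt o sub).run n cap ηk σ₂
    have f3 : ∀ b, b < o + 10 → b ≠ o + 8 → σ₃ b = σ₂ b := fun b hb h8 =>
      run_valueSt_of_ne hsub hb h8
    have g3 : ∀ b, b ≤ o + 2 → σ₃ b = σ₀ b := fun b hb => by
      rw [f3 _ (by omega) (by omega), g2 _ hb]
    have hsum : σ₀ (o + 2) 0 + wis G u' R ≤ wis G u S := by
      rw [← hval]
      exact Nat.add_le_add_left (wis_mono hRA) _
    obtain ⟨k1, k2, k3⟩ := run_removeSt (cap := cap) (η := ηk) (σ := σ₃) (o := o) (S := A) (R := R)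
      (N := closedNbhd G A R) (u := u') (by rw [g3 _ (by omega)]; exact hA)
      (by rw [f3 _ (by omega) (by omega)]; exact hR) (by rw [f3 _ (by omega) (by omega)]; exact hN)
      (by rw [g3 _ (by omega)]; exact hu')
      (by rw [g3 _ (by omega), hvalue]; exact hsum.trans (wis_le_cap hcap S))
    rw [hvalue] at k2
    refine ⟨A \ R, _, ?_, k1, k2, Finset.sdiff_subset.trans hAS, ?_, fun v => ?_, ?_⟩
    · rw [run_removeSt_of_ne (by omega) (by omega) (by omega), g3 _ (by omega)]; exact hG0
    · rcases hcase with ⟨rfl, rfl⟩ | h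
      · simp
      · have := Finset.card_sdiff_add_card_eq_card h.sub
        have := h.ne.card_pos
        omega
    · split_ifs
      · exact (Nat.sub_le _ _).trans (hle v)
      · exact hle v
    · rw [k3, hvalue, g3 _ (by omega), ← hval, add_assoc]
      congr 1
      rcases hcase with ⟨rfl, rfl⟩ | h
      · simp
      · exact (h.toIsCliqueModule.wis_eq u').symm

end Bounded

/-! ### The solver for graphs without the patterns -/

namespace Bounded

open RAM Graph

/-- Elimination for vertex sets without holes, where minimal clique modules are singletons. -/
def holeFreeSolver : St := elim 20 (setScalar 32 .zero)

/-- Elimination for vertex sets without the patterns. -/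
def solver : St := elim 10 holeFreeSolver

variable {n cap : ℕ} {G : SimpleGraph (Fin n)} {σ : ℕ → ℕ → ℕ} {η : ℕ → ℕ}

theorem solves_holeFreeSolver : Solves n cap G 20 holeFreeSolver (HoleFree G) := by
  refine solves_elim (C' := fun A => A = ∅) (by omega) ⟨?_, ?_⟩ (fun A B h hB => hB.mono h)
    fun A R hA hR v hv => hR.nonNbrs_eq_empty hA hv
  · simp [setScalar, St.writes]
  · rintro η σ S u - - - rfl -
    refine run_setScalar_self.trans ?_
    simp [Tm.zero, Tm.eval]

theorem solves_solver : Solves n cap G 10 solver (PatternFree G) :=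
  solves_elim (by omega) solves_holeFreeSolver (fun _ _ h hB => hB.mono h)
    fun _ _ hA hR _ hv => hR.holeFree_nonNbrs hA hv

/-! ### Extracting an optimal independent set -/

/-- Store in the scalar `12` the maximum weight of an independent set in the vertex set described by
the term `t` in the variable `3`, with respect to the weights in the array `4`. -/
def callSt (t : Tm) : St := .seq (fill 10 3 t) (.seq (fill 11 3 (cell 4 3)) solver)

/-- The vertex set in the array `7` without the vertex in the variable `7`. -/
def eraseTm : Tm := tand (cell 7 3) (tnot (eqVar 3 7))

/-- The vertex set in the array `7` without the closed neighbourhood of the vertex in the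
variable `7`. -/
def nonNbrsTm : Tm := tand (cell 7 3) (tand (tnot (eqVar 3 7)) (tnot (mat 0 7 3)))

/-- Decide whether the vertex in the variable `7` is taken into the independent set; the scalars `8`
and `9` are the optimal weights with and without it. -/
def decideSt : St :=
  .seq (callSt nonNbrsTm) (.seq (setScalar 8 (.op .add (cell 4 7) (scalar 12)))
  (.seq (callSt eraseTm) (.seq (setScalar 9 (scalar 12))
  (.ite (.op .lt (scalar 8) (scalar 9)) (fill 7 3 eraseTm)
    (.seq (fill 7 3 nonNbrsTm) (.set 3 .zero (.var 7) .zero))))))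

/-- Compute in the array `3` the complement of an independent set of maximum weight within the support
of the weights `4`. The array `7` holds the vertices that can still be taken. -/
def greedySt : St :=
  .seq (fill 7 3 (cell 4 3)) (.seq (fill 3 3 (.lit true)) (.loop 7 (.ite (cell 7 7) decideSt .skip)))

theorem run_callSt_of_lt {t : Tm} {b : ℕ} (hb : b < 10) : (callSt t).run n cap η σ b = σ b := by
  simp only [callSt, St.run]
  rw [solves_solver (G := (⊥ : SimpleGraph (Fin n))).run_of_lt hb,
    St.run_of_notMem _ _ _ _ (by simp [fill, St.writes]; omega),
    St.run_of_notMem _ _ _ _ (by simp [fill, St.writes]; omega)]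

theorem run_callSt {t : Tm} {A : Finset (Fin n)} {w : Fin n → ℕ} (hG : IsGraph (σ 0) G)
    (hw : IsWeight (σ 4) w) (hA : PatternFree G A) (hcap : ∑ v, w v ≤ cap)
    (hloc : ∀ η : ℕ → ℕ, ∀ σ' : ℕ → ℕ → ℕ, (∀ b, b ≠ 10 → σ' b = σ b) →
      t.eval n cap σ' η = t.eval n cap σ η)
    (ht : ∀ j : Fin n, t.Holds n cap σ (Function.update η 3 j) ↔ j ∈ A) :
    (callSt t).run n cap η σ 12 0 = wis G w A := by
  simp only [callSt, St.run]
  set σ₁ := (fill 10 3 t).run n cap η σ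
  have f1 : ∀ b, b ≠ 10 → σ₁ b = σ b := fun b hb =>
    St.run_of_notMem _ _ _ _ (by simpa [fill, St.writes] using hb)
  set σ₂ := (fill 11 3 (cell 4 3)).run n cap η σ₁
  have f2 : ∀ b, b ≠ 11 → σ₂ b = σ₁ b := fun b hb =>
    St.run_of_notMem _ _ _ _ (by simpa [fill, St.writes] using hb)
  refine solves_solver.eq_wis η σ₂ A w ?_ ?_ ?_ hA hcap
  · rw [f2 _ (by omega), f1 _ (by omega)]; exact hG
  · rw [f2 _ (by omega)]
    exact isMask_fill (fun i _ σ' h _ => hloc _ σ' h) ht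
  · refine isWeight_fill (fun i _ σ' h _ => ?_) fun j => ?_
    · simp [cell, Tm.eval, Tm.zero, h]
    · rw [eval_cell, Function.update_self, f1 _ (by omega)]
      exact hw j

theorem holds_eraseTm {A : Finset (Fin n)} {v : Fin n} (hA : IsMask (σ 7) A) (hv : η 7 = v)
    (j : Fin n) : eraseTm.Holds n cap σ (Function.update η 3 j) ↔ j ∈ A.erase v := by
  simp only [eraseTm, holds_and, holds_cell, holds_not, holds_eqVar, Function.update_self, ne_eq,
    Nat.reduceEqDiff, not_false_eq_true, Function.update_of_ne, hv, Finset.mem_erase, Fin.val_inj]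
  rw [← ne_eq, hA j, and_comm]

theorem holds_nonNbrsTm {A : Finset (Fin n)} {v : Fin n} (hG : IsGraph (σ 0) G)
    (hA : IsMask (σ 7) A) (hv : η 7 = v) (j : Fin n) :
    nonNbrsTm.Holds n cap σ (Function.update η 3 j) ↔ j ∈ nonNbrs G A v := by
  simp only [nonNbrsTm, holds_and, holds_cell, holds_not, holds_eqVar, holds_mat,
    Function.update_self, ne_eq, Nat.reduceEqDiff, not_false_eq_true, Function.update_of_ne, hv,
    mem_nonNbrs, Fin.val_inj]
  have : ¬σ 0 (v * n + j) = 0 ↔ G.Adj v j := hG v j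
  rw [← ne_eq, hA j, this]

theorem run_decideSt {A : Finset (Fin n)} {w : Fin n → ℕ} {v : Fin n} (hG : IsGraph (σ 0) G)
    (hw : IsWeight (σ 4) w) (hA : PatternFree G A) (hcap : ∑ v, w v ≤ cap)
    (hmask : IsMask (σ 7) A) (hv : η 7 = v) (hvA : v ∈ A) :
    (decideSt.run n cap η σ 0 = σ 0 ∧ decideSt.run n cap η σ 4 = σ 4) ∧
    ((IsMask (decideSt.run n cap η σ 7) (A.erase v) ∧ decideSt.run n cap η σ 3 = σ 3 ∧
        wis G w A = wis G w (A.erase v)) ∨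
      (IsMask (decideSt.run n cap η σ 7) (nonNbrs G A v) ∧
        decideSt.run n cap η σ 3 = Function.update (σ 3) v 0 ∧
        wis G w A = w v + wis G w (nonNbrs G A v))) := by
  simp only [decideSt, St.run]
  have e1 := run_callSt (t := nonNbrsTm) (η := η) (A := nonNbrs G A v) hG hw
    (hA.mono nonNbrs_subset) hcap
    (fun η σ' h => by
      simp only [nonNbrsTm, tand, tnot, cell, mat, eqVar, Tm.eval, Tm.zero, h 0 (by omega), h 7 (by omega)]
      congr!)
    (holds_nonNbrsTm hG hmask hv)
  have f1 : ∀ b, b < 10 → (callSt nonNbrsTm).run n cap η σ b = σ b := fun b hb => run_callSt_of_lt hb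
  set σ₁ := (callSt nonNbrsTm).run n cap η σ
  have f2 : ∀ b, b ≠ 8 → (setScalar 8 (.op .add (cell 4 7) (scalar 12))).run n cap η σ₁ b = σ₁ b :=
    fun b hb => St.run_of_notMem _ _ _ _ (by simpa [setScalar, St.writes] using hb)
  have e2 : (setScalar 8 (.op .add (cell 4 7) (scalar 12))).run n cap η σ₁ 8 0 =
      w v + wis G w (nonNbrs G A v) := by
    rw [run_setScalar_self]
    simp only [Tm.eval, eval_cell, eval_scalar, e1, hv]
    rw [f1 _ (by omega), hw v]
    exact min_eq_left ((add_wis_nonNbrs_le w hvA).trans (wis_le_cap hcap A))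
  set σ₂ := (setScalar 8 (.op .add (cell 4 7) (scalar 12))).run n cap η σ₁
  have g2 : ∀ b, b < 10 → b ≠ 8 → σ₂ b = σ b := fun b hb h8 => (f2 b h8).trans (f1 b hb)
  have e3 := run_callSt (t := eraseTm) (η := η) (σ := σ₂) (A := A.erase v) (G := G) (w := w)
    (by rw [g2 _ (by omega) (by omega)]; exact hG) (by rw [g2 _ (by omega) (by omega)]; exact hw)
    (hA.mono (Finset.erase_subset v A)) hcap
    (fun η σ' h => by
      simp only [eraseTm, tand, tnot, cell, eqVar, Tm.eval, Tm.zero, h 7 (by omega)]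
      congr!)
    (holds_eraseTm (by rw [g2 _ (by omega) (by omega)]; exact hmask) hv)
  have f3 : ∀ b, b < 10 → (callSt eraseTm).run n cap η σ₂ b = σ₂ b := fun b hb =>
    run_callSt_of_lt hb
  set σ₃ := (callSt eraseTm).run n cap η σ₂
  have f4 : ∀ b, b ≠ 9 → (setScalar 9 (scalar 12)).run n cap η σ₃ b = σ₃ b :=
    fun b hb => St.run_of_notMem _ _ _ _ (by simpa [setScalar, St.writes] using hb)
  have e4 : (setScalar 9 (scalar 12)).run n cap η σ₃ 9 0 = wis G w (A.erase v) := by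
    rw [run_setScalar_self, eval_scalar, e3]
  set σ₄ := (setScalar 9 (scalar 12)).run n cap η σ₃
  have g4 : ∀ b, b < 8 → σ₄ b = σ b := fun b hb => by
    rw [f4 _ (by omega), f3 _ (by omega), g2 _ (by omega) (by omega)]
  have e4' : σ₄ 8 0 = w v + wis G w (nonNbrs G A v) := by
    rw [f4 _ (by omega), f3 _ (by omega), e2]
  have hmax := wis_eq_max (G := G) w hvA
  have hcond : (Tm.op .lt (scalar 8) (scalar 9)).eval n cap σ₄ η ≠ 0 ↔
      w v + wis G w (nonNbrs G A v) < wis G w (A.erase v) := by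
    simp only [Tm.eval, eval_scalar, e4, e4']
    exact satOp_lt
  have hmask' : IsMask (σ₄ 7) A := by rw [g4 _ (by omega)]; exact hmask
  by_cases h : w v + wis G w (nonNbrs G A v) < wis G w (A.erase v)
  · rw [if_pos (hcond.2 h)]
    have f5 : ∀ b, b ≠ 7 → (fill 7 3 eraseTm).run n cap η σ₄ b = σ₄ b :=
      fun b hb => St.run_of_notMem _ _ _ _ (by simpa [fill, St.writes] using hb)
    refine ⟨⟨by rw [f5 _ (by omega), g4 _ (by omega)], by rw [f5 _ (by omega), g4 _ (by omega)]⟩,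
      .inl ⟨?_, by rw [f5 _ (by omega), g4 _ (by omega)], by omega⟩⟩
    refine isMask_fill (fun i _ σ' hb hi => ?_) (holds_eraseTm hmask' hv)
    simp [eraseTm, tand, tnot, cell, eqVar, Tm.eval, Tm.zero, hi]
  · rw [if_neg (hcond.not.2 h)]
    have f5 : ∀ b, b ≠ 7 → (fill 7 3 nonNbrsTm).run n cap η σ₄ b = σ₄ b :=
      fun b hb => St.run_of_notMem _ _ _ _ (by simpa [fill, St.writes] using hb)
    have e5 : IsMask ((fill 7 3 nonNbrsTm).run n cap η σ₄ 7) (nonNbrs G A v) := by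
      refine isMask_fill (fun i _ σ' hb hi => ?_)
        (holds_nonNbrsTm (by rw [g4 _ (by omega)]; exact hG) hmask' hv)
      simp [nonNbrsTm, tand, tnot, cell, mat, eqVar, Tm.eval, Tm.zero, hi, hb]
    set σ₅ := (fill 7 3 nonNbrsTm).run n cap η σ₄
    refine ⟨⟨?_, ?_⟩, .inr ⟨?_, ?_, by omega⟩⟩
    · rw [Function.update_of_ne (by omega), f5 _ (by omega), g4 _ (by omega)]
    · rw [Function.update_of_ne (by omega), f5 _ (by omega), g4 _ (by omega)]
    · rw [Function.update_of_ne (by omega)]; exact e5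
    · rw [Function.update_self, f5 _ (by omega), g4 _ (by omega)]
      simp [Tm.eval, Tm.zero, hv]

theorem run_greedySt {w : Fin n → ℕ} (hG : IsGraph (σ 0) G) (hw : IsWeight (σ 4) w)
    (hS : PatternFree G (Finset.univ.filter fun v => w v ≠ 0)) (hcap : ∑ v, w v ≤ cap) :
    ∃ I : Finset (Fin n), G.IsIndepSet (I : Set (Fin n)) ∧
      ∑ v ∈ I, w v = wis G w (Finset.univ.filter fun v => w v ≠ 0) ∧
      ∀ v : Fin n, greedySt.run n cap η σ 3 v = 1 ↔ v ∉ I := by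
  set S : Finset (Fin n) := Finset.univ.filter fun v => w v ≠ 0 with hSdef
  simp only [greedySt, St.run]
  set σ₁ := (fill 7 3 (cell 4 3)).run n cap η σ
  have f1 : ∀ b, b ≠ 7 → σ₁ b = σ b :=
    fun b hb => St.run_of_notMem _ _ _ _ (by simpa [fill, St.writes] using hb)
  have e1 : IsMask (σ₁ 7) S := by
    refine isMask_fill (fun i _ σ' h _ => ?_) fun j => ?_
    · simp [cell, Tm.eval, Tm.zero, h]
    · rw [Tm.Holds, eval_cell, Function.update_self, hw j]
      simp [hSdef]
  have f2 : ∀ b, b ≠ 3 → (fill 3 3 (.lit true)).run n cap η σ₁ b = σ₁ b :=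
    fun b hb => St.run_of_notMem _ _ _ _ (by simpa [fill, St.writes] using hb)
  have e2 : ∀ v : Fin n, (fill 3 3 (.lit true)).run n cap η σ₁ 3 v = 1 := fun v => by
    rw [run_fill (fun i _ σ' h _ => by simp [Tm.eval]) v.2]
    simp [Tm.eval]
  set σ₂ := (fill 3 3 (.lit true)).run n cap η σ₁
  have := iter_induction (m := n) (s := σ₂)
    (f := fun i σ => if (cell 7 7).eval n cap σ (Function.update η 7 i) ≠ 0 then
      decideSt.run n cap (Function.update η 7 i) σ else σ)
    (fun k (σ' : ℕ → ℕ → ℕ) => σ' 0 = σ 0 ∧ σ' 4 = σ 4 ∧ ∃ I A : Finset (Fin n),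
      IsMask (σ' 7) A ∧ (∀ v : Fin n, σ' 3 v = 1 ↔ v ∉ I) ∧ A ⊆ S ∧ (∀ v ∈ A, k ≤ v) ∧
      (∀ a ∈ I, (a : ℕ) < k) ∧ G.IsIndepSet (I : Set (Fin n)) ∧ (∀ a ∈ I, ∀ b ∈ A, ¬G.Adj a b) ∧
      ∑ v ∈ I, w v + wis G w A = wis G w S) ⟨?_, ?_, ∅, S, ?_, ?_, ?_⟩ ?_
  · obtain ⟨-, -, I, A, -, hI, -, hA, -, hind, -, hval⟩ := this
    have : A = ∅ := Finset.eq_empty_of_forall_notMem fun v hv => by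
      have := hA v hv
      have := v.2
      omega
    rw [this, wis_empty, add_zero] at hval
    exact ⟨I, hind, hval, hI⟩
  · rw [f2 _ (by omega), f1 _ (by omega)]
  · rw [f2 _ (by omega), f1 _ (by omega)]
  · rw [f2 _ (by omega)]; exact e1
  · simpa using e2
  · simp [SimpleGraph.isIndepSet_iff]
  · rintro k hk σ' ⟨h0, h4, I, A, hA, hI, hAS, hAk, hIk, hind, hIA, hval⟩
    set ηk := Function.update η 7 k
    have hηk : ηk 7 = (⟨k, hk⟩ : Fin n) := by simp [ηk]
    have hcond : (cell 7 7).eval n cap σ' ηk ≠ 0 ↔ (⟨k, hk⟩ : Fin n) ∈ A := by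
      rw [eval_cell, hηk]
      exact hA _
    by_cases hkA : (⟨k, hk⟩ : Fin n) ∈ A
    · rw [if_pos (hcond.2 hkA)]
      obtain ⟨⟨g0, g4⟩, hcase⟩ := run_decideSt (η := ηk) (σ := σ') (A := A) (w := w) (G := G)
        (by rw [h0]; exact hG) (by rw [h4]; exact hw) (hS.mono hAS) hcap hA hηk hkA
      refine ⟨g0.trans h0, g4.trans h4, ?_⟩
      rcases hcase with ⟨hm, h3, hwis⟩ | ⟨hm, h3, hwis⟩
      · refine ⟨I, A.erase ⟨k, hk⟩, hm, h3 ▸ hI, (Finset.erase_subset _ _).trans hAS,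
          fun v hv => ?_, fun a ha => (hIk a ha).trans (by omega), hind,
          fun a ha b hb => hIA a ha b (Finset.mem_of_mem_erase hb), hwis ▸ hval⟩
        obtain ⟨hne, hv⟩ := Finset.mem_erase.1 hv
        have := hAk v hv
        have : (v : ℕ) ≠ k := fun h => hne (Fin.ext h)
        omega
      · have hkI : (⟨k, hk⟩ : Fin n) ∉ I := fun h => by
          have := hIk _ h
          simp at this
        refine ⟨insert ⟨k, hk⟩ I, nonNbrs G A ⟨k, hk⟩, hm, fun v => ?_, nonNbrs_subset.trans hAS,
          fun v hv => ?_, fun a ha => ?_, ?_, fun a ha b hb => ?_, ?_⟩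
        · rw [h3]
          by_cases hvk : v = ⟨k, hk⟩
          · subst hvk; simp
          · have : (v : ℕ) ≠ k := fun h => hvk (Fin.ext h)
            rw [Function.update_of_ne (by simpa using this), hI v]
            simp [hvk]
        · obtain ⟨hv, hne, -⟩ := mem_nonNbrs.1 hv
          have := hAk v hv
          have : (v : ℕ) ≠ k := fun h => hne (Fin.ext h)
          omega
        · rcases Finset.mem_insert.1 ha with rfl | ha
          · simp
          · exact (hIk a ha).trans (by omega)
        · rw [Finset.coe_insert]
          refine Set.Pairwise.insert hind fun b hb _ => ?_
          have := hIA b hb _ hkA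
          exact ⟨fun h => this h.symm, this⟩
        · obtain ⟨hb, -, hadj⟩ := mem_nonNbrs.1 hb
          rcases Finset.mem_insert.1 ha with rfl | ha
          · exact hadj
          · exact hIA a ha b hb
        · rw [Finset.sum_insert hkI, ← hval, hwis]
          ring
    · rw [if_neg (hcond.not.2 hkA)]
      refine ⟨h0, h4, I, A, hA, hI, hAS, fun v hv => ?_, fun a ha => (hIk a ha).trans (by omega),
        hind, hIA, hval⟩
      have := hAk v hv
      have : (v : ℕ) ≠ k := fun h => hkA (by
        have : v = ⟨k, hk⟩ := Fin.ext h
        exact this ▸ hv)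
      omega

end Bounded

/-! ### The local ratio phase -/

namespace Graph

variable {V : Type} {G : SimpleGraph V}

/-- `w'` arises from `w` by decreasing weights in such a way that the guarantee for `w'` implies the
one for `w`. -/
structure Reduces (G : SimpleGraph V) (w w' : V → ℕ) : Prop where
  le : ∀ v, w' v ≤ w v
  approx : ∀ X, Approx G w' X → Approx G w X

theorem Reduces.refl (w : V → ℕ) : Reduces G w w := ⟨fun _ => le_rfl, fun _ => id⟩

theorem Reduces.trans {w w' w'' : V → ℕ} (h : Reduces G w w') (h' : Reduces G w' w'') :
    Reduces G w w'' :=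
  ⟨fun v => (h'.le v).trans (h.le v), fun X hX => h.approx X (h'.approx X hX)⟩

end Graph

namespace Bounded

open RAM Graph

/-- Loops over the variables `0, …, m - 1`. -/
def nest : ℕ → St → St
  | 0, c => c
  | m + 1, c => nest m (.loop m c)

def allTm : List Tm → Tm := List.foldr tand (.lit true)

def anyTm : List Tm → Tm := List.foldr tor .zero

/-- The variables `0, 1, …` describe an occurrence of the pattern. -/
def matchTm (P : Pattern) : Tm :=
  allTm ((List.range P.size).flatMap fun j => (List.range j).map fun i =>
    if (i, j) ∈ P.edges then mat 0 i j else tand (tnot (mat 0 i j)) (tnot (eqVar i j)))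

/-- The least weight of the vertices in the variables `0, …, k`. -/
def minTm : ℕ → Tm
  | 0 => cell 4 0
  | k + 1 => .cond (.op .lt (cell 4 (k + 1)) (minTm k)) (cell 4 (k + 1)) (minTm k)

/-- The weight of the vertex in the variable `7`, less the scalar `6` if it is one of the vertices in
the variables `0, …, P.size - 1`. -/
def reducedTm (P : Pattern) : Tm :=
  .cond (anyTm ((List.range P.size).map fun i => eqVar i 7)) (.op .sub (cell 4 7) (scalar 6))
    (cell 4 7)

/-- If the variables describe an occurrence of the pattern, subtract the least weight of its vertices
from all their weights. -/
def patternSt (P : Pattern) : St :=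
  .ite (matchTm P) (.seq (setScalar 6 (minTm (P.size - 1))) (fill 4 7 (reducedTm P))) .skip

def patternsSt : List Pattern → St
  | [] => .skip
  | P :: L => .seq (patternSt P) (patternsSt L)

/-- Treat all occurrences of all patterns; no pattern has more than seven vertices. -/
def localRatioSt : St := nest 7 (patternsSt patterns)

variable {n cap : ℕ} {G : SimpleGraph (Fin n)} {σ : ℕ → ℕ → ℕ} {η : ℕ → ℕ} {P : Pattern}
  {w : Fin n → ℕ}

/-- The rule for nested loops: `Inv` is an invariant, and `Done η` is established by the body in the
environment `η` and never destroyed. -/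
theorem run_nest {Inv : (ℕ → ℕ → ℕ) → Prop} {Done : (ℕ → ℕ) → (ℕ → ℕ → ℕ) → Prop} :
    ∀ (m : ℕ) (c : St) (_ : ∀ η σ, (∀ i < m, η i < n) → Inv σ → Inv (c.run n cap η σ) ∧
      (∀ η', Done η' σ → Done η' (c.run n cap η σ)) ∧
      Done η (c.run n cap η σ)) (η : ℕ → ℕ) (σ : ℕ → ℕ → ℕ), Inv σ →
    Inv ((nest m c).run n cap η σ) ∧
    ∀ η', (∀ i < m, η' i < n) → (∀ i, m ≤ i → η' i = η i) →
      Done η' ((nest m c).run n cap η σ)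
  | 0, c, hc, η, σ, hσ => by
    obtain ⟨h1, -, h3⟩ := hc η σ (fun i hi => absurd hi (Nat.not_lt_zero i)) hσ
    refine ⟨h1, fun η' _ h => ?_⟩
    have : η' = η := funext fun i => h i (Nat.zero_le i)
    exact this ▸ h3
  | m + 1, c, hc, η, σ, hσ => by
    have key : ∀ η σ, (∀ i < m, η i < n) → Inv σ → Inv ((St.loop m c).run n cap η σ) ∧
        (∀ η', Done η' σ → Done η' ((St.loop m c).run n cap η σ)) ∧
        ∀ j < n, Done (Function.update η m j) ((St.loop m c).run n cap η σ) := by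
      intro η σ hη hσ
      refine iter_induction (fun k σ' => Inv σ' ∧ (∀ η', Done η' σ → Done η' σ') ∧
        ∀ j < k, Done (Function.update η m j) σ')
        ⟨hσ, fun _ h => h, fun j hj => absurd hj (Nat.not_lt_zero j)⟩ ?_
      rintro k hk σ' ⟨h1, h2, h3⟩
      have hstep := hc (Function.update η m k) σ' (fun i hi => ?_) h1
      · obtain ⟨g1, g2, g3⟩ := hstep
        refine ⟨g1, fun η' h => g2 _ (h2 _ h), fun j hj => ?_⟩
        rcases (Nat.lt_succ_iff.1 hj).lt_or_eq with h | rfl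
        · exact g2 _ (h3 j h)
        · exact g3
      · by_cases him : i = m
        · subst him; simpa using hk
        · rw [Function.update_of_ne him]; exact hη i (by omega)
    have hnest := run_nest (Done := fun η σ => ∀ j < n, Done (Function.update η m j) σ)
      m (.loop m c) (fun η σ hη hσ => ?_) η σ hσ
    · obtain ⟨h1, h2⟩ := hnest
      refine ⟨h1, fun η' hη' he => ?_⟩
      have := h2 (Function.update η' m (η m)) (fun i hi => ?_) (fun i hi => ?_) (η' m)
        (hη' m (by omega))
      · rwa [Function.update_idem, Function.update_eq_self] at this
      · rw [Function.update_of_ne (by omega)]; exact hη' i (by omega)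
      · by_cases him : i = m
        · subst him; simp
        · rw [Function.update_of_ne him]; exact he i (by omega)
    · obtain ⟨g1, g2, g3⟩ := key η σ hη hσ
      exact ⟨g1, fun η' h j hj => g2 _ (h j hj), g3⟩

theorem holds_allTm {L : List Tm} :
    (allTm L).Holds n cap σ η ↔ ∀ t ∈ L, t.Holds n cap σ η := by
  induction L with
  | nil => simp [allTm, Tm.Holds, Tm.eval]
  | cons t L ih =>
    rw [List.forall_mem_cons, ← ih]
    exact holds_and

theorem holds_anyTm {L : List Tm} :
    (anyTm L).Holds n cap σ η ↔ ∃ t ∈ L, t.Holds n cap σ η := by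
  induction L with
  | nil => simp [anyTm, Tm.Holds, Tm.eval, Tm.zero]
  | cons t L ih =>
    rw [List.exists_mem_cons_iff, ← ih]
    exact holds_or

theorem holds_matchTm (hG : IsGraph (σ 0) G) {f : ℕ → Fin n} (hf : ∀ i < P.size, η i = f i) :
    (matchTm P).Holds n cap σ η ↔ P.Occurs G f := by
  simp only [matchTm, holds_allTm, List.mem_flatMap, List.mem_map, List.mem_range,
    Pattern.Occurs]
  constructor
  · intro h j hj i hi
    have := h _ ⟨j, hj, i, hi, rfl⟩
    split_ifs at this with he
    · rw [holds_mat, hf i (by omega), hf j hj] at this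
      have hadj := (hG (f i) (f j)).1 this
      exact ⟨hadj.ne, by simp [he, hadj]⟩
    · rw [holds_and, holds_not, holds_not, holds_mat, holds_eqVar, hf i (by omega), hf j hj,
        hG (f i) (f j), Fin.val_inj] at this
      exact ⟨this.2, by simp [he, this.1]⟩
  · rintro h t ⟨j, hj, i, hi, rfl⟩
    obtain ⟨hne, hadj⟩ := h j hj i hi
    split_ifs with he
    · rw [holds_mat, hf i (by omega), hf j hj]
      exact (hG (f i) (f j)).2 (hadj.2 he)
    · rw [holds_and, holds_not, holds_not, holds_mat, holds_eqVar, hf i (by omega), hf j hj,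
        hG (f i) (f j), Fin.val_inj]
      exact ⟨fun h => he (hadj.1 h), hne⟩

theorem eval_minTm (k : ℕ) : (∃ i ≤ k, (minTm k).eval n cap σ η = σ 4 (η i)) ∧
    ∀ i ≤ k, (minTm k).eval n cap σ η ≤ σ 4 (η i) := by
  induction k with
  | zero =>
    refine ⟨⟨0, le_rfl, eval_cell⟩, fun i hi => ?_⟩
    obtain rfl : i = 0 := by omega
    exact eval_cell.le
  | succ k ih =>
    obtain ⟨⟨i, hi, hval⟩, hle⟩ := ih
    simp only [minTm, Tm.eval, eval_cell]
    by_cases h : σ 4 (η (k + 1)) < (minTm k).eval n cap σ η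
    · rw [if_pos (satOp_lt.2 h)]
      refine ⟨⟨k + 1, le_rfl, rfl⟩, fun i hi => ?_⟩
      rcases hi.lt_or_eq with hi | rfl
      · exact h.le.trans (hle i (by omega))
      · exact le_rfl
    · rw [if_neg (satOp_lt.not.2 h)]
      refine ⟨⟨i, by omega, hval⟩, fun i hi => ?_⟩
      rcases hi.lt_or_eq with hi | rfl
      · exact hle i (by omega)
      · exact not_lt.1 h

theorem eval_reducedTm : (reducedTm P).eval n cap σ η =
    if ∃ i < P.size, η i = η 7 then σ 4 (η 7) - σ 6 0 else σ 4 (η 7) := by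
  have h : (anyTm ((List.range P.size).map fun i => eqVar i 7)).Holds n cap σ η ↔
      ∃ i < P.size, η i = η 7 := by
    simp [holds_anyTm, holds_eqVar]
  simp only [reducedTm, Tm.eval, eval_cell, eval_scalar]
  exact if_congr h rfl rfl

theorem size_patterns : ∀ P ∈ patterns, 0 < P.size ∧ P.size ≤ 7 := by decide

theorem run_patternSt (hP : P ∈ patterns) (hG : IsGraph (σ 0) G) (hw : IsWeight (σ 4) w)
    {f : ℕ → Fin n} (hf : ∀ i < 7, η i = f i) :
    (patternSt P).run n cap η σ 0 = σ 0 ∧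
    ∃ w', IsWeight ((patternSt P).run n cap η σ 4) w' ∧ Reduces G w w' ∧
      (P.Occurs G f → ∃ i < P.size, w' (f i) = 0) := by
  obtain ⟨hpos, h7⟩ := size_patterns P hP
  have hmatch := holds_matchTm (cap := cap) (P := P) hG fun i hi => hf i (hi.trans_le h7)
  simp only [patternSt, St.run]
  unfold Tm.Holds at hmatch
  by_cases hocc : P.Occurs G f
  swap
  · rw [if_neg (fun h => hocc (hmatch.1 h))]
    exact ⟨rfl, w, hw, .refl w, fun h => absurd h hocc⟩
  rw [if_pos (hmatch.2 hocc)]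
  set ε := (minTm (P.size - 1)).eval n cap σ η with hε
  obtain ⟨⟨i₀, hi₀, hmin⟩, hle⟩ := eval_minTm (n := n) (cap := cap) (σ := σ) (η := η) (P.size - 1)
  set σ₁ := (setScalar 6 (minTm (P.size - 1))).run n cap η σ
  have f1 : ∀ b, b ≠ 6 → σ₁ b = σ b := fun b hb =>
    St.run_of_notMem _ _ _ _ (by simpa [setScalar, St.writes] using hb)
  have e1 : σ₁ 6 0 = ε := run_setScalar_self
  have hεle : ∀ v ∈ (Finset.range P.size).image f, ε ≤ w v := by
    intro v hv
    obtain ⟨i, hi, rfl⟩ := Finset.mem_image.1 hv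
    have hi := Finset.mem_range.1 hi
    have := hle i (by omega)
    rwa [hf i (by omega), hw (f i)] at this
  refine ⟨?_, fun v => if v ∈ (Finset.range P.size).image f then w v - ε else w v, ?_, ⟨?_, ?_⟩, ?_⟩
  · rw [St.run_of_notMem _ _ _ _ (by simp [fill, St.writes]), f1 _ (by omega)]
  · refine isWeight_fill (fun i _ σ' h h' => ?_) fun j => ?_
    · rw [eval_reducedTm, eval_reducedTm, Function.update_self, h', h 6 (by omega)]
    · rw [eval_reducedTm, Function.update_self, e1, f1 _ (by omega), hw j]
      refine if_congr ?_ rfl rfl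
      simp only [Finset.mem_image, Finset.mem_range]
      refine exists_congr fun i => and_congr_right fun hi => ?_
      rw [Function.update_of_ne (by omega), hf i (by omega), Fin.val_inj]
  · intro v
    split_ifs
    · exact Nat.sub_le _ _
    · exact le_rfl
  · intro X hX
    refine Approx.of_occurs hP hocc (ε := ε) (fun v => ?_) hX
    split_ifs with h
    · have := hεle v h
      omega
    · rfl
  · intro _
    refine ⟨i₀, by omega, ?_⟩
    refine (if_pos (Finset.mem_image_of_mem f (Finset.mem_range.2 (by omega)))).trans ?_
    rw [← hε, hf i₀ (by omega), hw (f i₀)] at hmin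
    omega

theorem run_patternsSt {f : ℕ → Fin n} (hf : ∀ i < 7, η i = f i) :
    ∀ (L : List Pattern) (_ : L ⊆ patterns) (σ : ℕ → ℕ → ℕ) (w : Fin n → ℕ)
      (_ : IsGraph (σ 0) G) (_ : IsWeight (σ 4) w),
    (patternsSt L).run n cap η σ 0 = σ 0 ∧
    ∃ w', IsWeight ((patternsSt L).run n cap η σ 4) w' ∧ Reduces G w w' ∧
      ∀ P ∈ L, P.Occurs G f → ∃ i < P.size, w' (f i) = 0
  | [], _, σ, w, _, hw => ⟨rfl, w, hw, .refl w, by simp⟩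
  | P :: L, hL, σ, w, hG, hw => by
    obtain ⟨hPm, hL⟩ := List.cons_subset.1 hL
    obtain ⟨g0, w', hw', hred, hzero⟩ := run_patternSt (cap := cap) hPm hG hw hf
    obtain ⟨k0, w'', hw'', hred', hzero'⟩ := run_patternsSt hf L hL _ w' (g0 ▸ hG) hw'
    refine ⟨k0.trans g0, w'', hw'', hred.trans hred', ?_⟩
    rw [List.forall_mem_cons]
    refine ⟨fun h => ?_, hzero'⟩
    obtain ⟨i, hi, hz⟩ := hzero h
    exact ⟨i, hi, Nat.le_zero.1 (hz ▸ hred'.le (f i))⟩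

theorem run_localRatioSt (hG : IsGraph (σ 0) G) (hw : IsWeight (σ 4) w) :
    localRatioSt.run n cap η σ 0 = σ 0 ∧
    ∃ w', IsWeight (localRatioSt.run n cap η σ 4) w' ∧ Reduces G w w' ∧
      PatternFree G (Finset.univ.filter fun v => w' v ≠ 0) := by
  have hnest := run_nest (n := n) (cap := cap)
    (Inv := fun σ' => σ' 0 = σ 0 ∧ ∃ w', IsWeight (σ' 4) w' ∧ Reduces G w w')
    (Done := fun η σ' => ∀ f : ℕ → Fin n, (∀ i < 7, η i = f i) → ∀ P ∈ patterns, P.Occurs G f →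
      ∃ i < P.size, σ' 4 (f i) = 0) 7 (patternsSt patterns) ?_ η σ ⟨rfl, w, hw, .refl w⟩
  · obtain ⟨⟨h0, w', hw', hred⟩, hdone⟩ := hnest
    refine ⟨h0, w', hw', hred, fun P hP f hf hocc => ?_⟩
    obtain ⟨i, hi, hz⟩ := hdone (fun i => if i < 7 then f i else η i) (fun i hi => by simp [hi])
      (fun i hi => if_neg (not_lt.2 hi)) f (fun i hi => if_pos hi) P hP hocc
    have hmem := (Finset.mem_filter.1 (hf i hi)).2
    rw [hw' (f i)] at hz
    exact hmem hz
  · rintro η σ' hη ⟨h0, w', hw', hred⟩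
    -- `hη` provides a vertex, so that the environment extends to a function into the vertices.
    let f : ℕ → Fin n := fun i => if h : i < 7 then ⟨η i, hη i h⟩ else ⟨η 0, hη 0 (by omega)⟩
    have hf : ∀ i < 7, η i = f i := fun i hi => by simp [f, hi]
    obtain ⟨g0, w'', hw'', hred', hzero⟩ := run_patternsSt (cap := cap) (G := G) hf patterns
      (List.Subset.refl _) σ' w' (h0 ▸ hG) hw'
    refine ⟨⟨g0.trans h0, w'', hw'', hred.trans hred'⟩, fun η' h g hg P hP hocc => ?_,
      fun g hg P hP hocc => ?_⟩
    · obtain ⟨i, hi, hz⟩ := h g hg P hP hocc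
      refine ⟨i, hi, ?_⟩
      rw [hw' (g i)] at hz
      rw [hw'' (g i)]
      exact Nat.le_zero.1 (hz ▸ hred'.le (g i))
    · have hfg : ∀ i < P.size, g i = f i := fun i hi => by
        have hi := hi.trans_le (size_patterns P hP).2
        exact Fin.ext ((hg i hi).symm.trans (hf i hi))
      have hocc' : P.Occurs G f := fun j hj i hi => by
        rw [← hfg j hj, ← hfg i (by omega)]
        exact hocc j hj i hi
      obtain ⟨i, hi, hz⟩ := hzero P hP hocc'
      exact ⟨i, hi, by rw [hfg i hi, hw'' (f i), hz]⟩

/-! ### Integral weights -/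

/-- Compute in the scalar `5` the product of the denominators in the array `2`, and in the array `4`
the weights multiplied by it. -/
def weightsSt : St :=
  .seq (setScalar 5 (.lit true)) (.seq (.loop 0 (setScalar 5 (.op .mul (scalar 5) (cell 2 0))))
    (fill 4 0 (.op .mul (cell 1 0) (.op .div (scalar 5) (cell 2 0)))))

theorem run_weightsSt {num den : Fin n → ℕ} (hnum : IsWeight (σ 1) num)
    (hden : IsWeight (σ 2) den) (hpos : ∀ v, 0 < den v) (hD : ∏ v, den v ≤ cap)
    (hW : ∑ v, num v * ((∏ u, den u) / den v) ≤ cap) :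
    weightsSt.run n cap η σ 0 = σ 0 ∧
    IsWeight (weightsSt.run n cap η σ 4) fun v => num v * ((∏ u, den u) / den v) := by
  refine ⟨St.run_of_notMem _ _ _ _ (by simp [weightsSt, setScalar, fill, St.writes]), ?_⟩
  simp only [weightsSt, St.run]
  have hprod := iter_induction (m := n)
    (f := fun i σ => (setScalar 5 (.op .mul (scalar 5) (cell 2 0))).run n cap
      (Function.update η 0 i) σ) (s := (setScalar 5 (.lit true)).run n cap η σ)
    (fun k (σ' : ℕ → ℕ → ℕ) => (∀ b, b ≠ 5 → σ' b = σ b) ∧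
      σ' 5 0 = ∏ v ∈ Finset.univ.filter fun v : Fin n => (v : ℕ) < k, den v) ⟨fun b hb => ?_, ?_⟩ ?_
  · obtain ⟨f1, e1⟩ := hprod
    set σ₁ := iter (fun i σ => (setScalar 5 (.op .mul (scalar 5) (cell 2 0))).run n cap
      (Function.update η 0 i) σ) n ((setScalar 5 (.lit true)).run n cap η σ)
    have e1 : σ₁ 5 0 = ∏ v, den v := by
      rw [e1]
      congr 1
      ext v
      simp
    refine isWeight_fill (fun i _ σ' h _ => ?_) fun j => ?_
    · simp [cell, scalar, Tm.eval, Tm.zero, h]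
    · simp only [Tm.eval, eval_cell, eval_scalar, Function.update_self, e1, f1 1 (by omega),
        f1 2 (by omega), hnum j, hden j, satOp, Op.eval]
      refine min_eq_left (le_trans ?_ hW)
      exact Finset.single_le_sum (f := fun v => num v * ((∏ u, den u) / den v))
        (fun _ _ => Nat.zero_le _) (Finset.mem_univ j)
  · exact St.run_of_notMem _ _ _ _ (by simpa [setScalar, St.writes] using hb)
  · rw [run_setScalar_self]
    simp [Tm.eval]
  · rintro k hk σ' ⟨f1, e1⟩
    refine ⟨fun b hb => (St.run_of_notMem _ _ _ _
      (by simpa [setScalar, St.writes] using hb)).trans (f1 b hb), ?_⟩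
    rw [run_setScalar_self]
    simp only [Tm.eval, eval_scalar, eval_cell, Function.update_self, e1, f1 2 (by omega), satOp]
    have hk2 : σ 2 k = den ⟨k, hk⟩ := hden ⟨k, hk⟩
    have hins : (Finset.univ.filter fun v : Fin n => (v : ℕ) < k + 1) =
        insert ⟨k, hk⟩ (Finset.univ.filter fun v : Fin n => (v : ℕ) < k) := by
      ext v
      simp only [Finset.mem_filter, Finset.mem_insert, Fin.ext_iff, Finset.mem_univ, true_and]
      omega
    have hmul : (∏ v ∈ Finset.univ.filter (fun v : Fin n => (v : ℕ) < k), den v) * den ⟨k, hk⟩ =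
        ∏ v ∈ Finset.univ.filter fun v : Fin n => (v : ℕ) < k + 1, den v := by
      rw [hins, Finset.prod_insert (by simp), mul_comm]
    rw [hk2, hmul]
    refine min_eq_left (le_trans ?_ hD)
    exact Finset.prod_le_prod_of_subset_of_one_le' (Finset.subset_univ _) fun v _ _ => hpos v

/-- The whole computation. -/
def mainSt : St := .seq weightsSt (.seq localRatioSt greedySt)

theorem run_mainSt {num den : Fin n → ℕ} (hG : IsGraph (σ 0) G) (hnum : IsWeight (σ 1) num)
    (hden : IsWeight (σ 2) den) (hpos : ∀ v, 0 < den v) (hD : ∏ v, den v ≤ cap)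
    (hW : ∑ v, num v * ((∏ u, den u) / den v) ≤ cap) :
    ∃ I : Finset (Fin n), G.IsIndepSet (I : Set (Fin n)) ∧
      Approx G (fun v => num v * ((∏ u, den u) / den v)) Iᶜ ∧
      ∀ v : Fin n, mainSt.run n cap η σ 3 v = 1 ↔ v ∉ I := by
  obtain ⟨h0, h4⟩ := run_weightsSt (cap := cap) (η := η) hnum hden hpos hD hW
  obtain ⟨g0, w', g4, hred, hfree⟩ := run_localRatioSt (cap := cap) (η := η) (h0.symm ▸ hG) h4
  obtain ⟨I, hI, hval, hout⟩ := run_greedySt (cap := cap) (η := η) (G := G) (w := w')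
    (g0.symm ▸ h0.symm ▸ hG) g4 hfree ((Finset.sum_le_sum fun v _ => hred.le v).trans hW)
  exact ⟨I, hI, hred.approx _ (approx_compl hval), hout⟩

end Bounded

/-! ### From rational to integral weights -/

namespace Bounded

open RAM Graph

theorem sum_mul_prod_div_le {ι : Type*} [DecidableEq ι] (a b : ι → ℕ) (s : Finset ι)
    (hb : ∀ v ∈ s, 0 < b v) :
    ∑ v ∈ s, a v * ((∏ u ∈ s, b u) / b v) + ∏ u ∈ s, b u ≤ ∏ u ∈ s, (a u + b u) := by
  induction s using Finset.induction_on with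
  | empty => simp
  | insert x s hx ih =>
    have ih := ih fun v hv => hb v (Finset.mem_insert_of_mem hv)
    rw [Finset.sum_insert hx, Finset.prod_insert hx, Finset.prod_insert hx,
      Nat.mul_div_cancel_left _ (hb x (Finset.mem_insert_self x s))]
    have hsum : ∑ v ∈ s, a v * (b x * (∏ u ∈ s, b u) / b v) =
        b x * ∑ v ∈ s, a v * ((∏ u ∈ s, b u) / b v) := by
      rw [Finset.mul_sum]
      refine Finset.sum_congr rfl fun v hv => ?_
      rw [Nat.mul_div_assoc _ (Finset.dvd_prod_of_mem b hv)]
      ring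
    rw [hsum]
    have h1 : a x * ∏ u ∈ s, b u ≤ a x * ∏ u ∈ s, (a u + b u) :=
      Nat.mul_le_mul_left _ ((Nat.le_add_left _ _).trans ih)
    have h2 := Nat.mul_le_mul_left (b x) ih
    linarith

variable {n : ℕ} {G : SimpleGraph (Fin n)} {w : Fin n → ℚ≥0}

/-- A number that is at least as large as all numbers in the computation, but has few digits. -/
def capOf (w : Fin n → ℚ≥0) : ℕ := ∏ v, ((w v).num + (w v).den + 2)

/-- The weights, multiplied by the product of the denominators. -/
def integralWeight (w : Fin n → ℚ≥0) (v : Fin n) : ℕ := (w v).num * ((∏ u, (w u).den) / (w v).den)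

theorem one_le_capOf : 1 ≤ capOf w := Finset.one_le_prod' fun _ _ => by omega

theorem le_capOf : n ≤ capOf w :=
  calc n ≤ 2 ^ n := Nat.lt_two_pow_self.le
    _ = ∏ _v : Fin n, 2 := by simp
    _ ≤ capOf w := Finset.prod_le_prod' fun _ _ => by omega

theorem factor_le_capOf (v : Fin n) : (w v).num + (w v).den + 2 ≤ capOf w :=
  Finset.single_le_prod' (f := fun v => (w v).num + (w v).den + 2) (fun _ _ => by omega)
    (Finset.mem_univ v)

theorem prod_den_le_capOf : ∏ v, (w v).den ≤ capOf w := Finset.prod_le_prod' fun _ _ => by omega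

theorem sum_integralWeight_le_capOf : ∑ v, integralWeight w v ≤ capOf w :=
  calc ∑ v, integralWeight w v ≤ ∏ v, ((w v).num + (w v).den) :=
        (Nat.le_add_right _ _).trans
          (sum_mul_prod_div_le _ _ Finset.univ fun v _ => (w v).den_pos)
    _ ≤ capOf w := Finset.prod_le_prod' fun _ _ => by omega

/-- A bound for the number of digits in the computation, and for the number of vertices. -/
def bitsOf (w : Fin n → ℚ≥0) : ℕ := 2 * inputSize w + 1

theorem le_inputSize : n ≤ inputSize w :=
  (Nat.le_mul_self n).trans (Nat.le_add_right _ _)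

theorem size_capOf_le : Nat.size (capOf w) ≤ bitsOf w := by
  have hfac : ∀ a b : ℕ, a + b + 2 ≤ 2 ^ (Nat.size a + Nat.size b + 1) := by
    intro a b
    have ha := Nat.lt_size_self a
    have hb := Nat.lt_size_self b
    have h1 : 2 ^ Nat.size a ≤ 2 ^ (Nat.size a + Nat.size b) :=
      Nat.pow_le_pow_right (by norm_num) (by omega)
    have h2 : 2 ^ Nat.size b ≤ 2 ^ (Nat.size a + Nat.size b) :=
      Nat.pow_le_pow_right (by norm_num) (by omega)
    rw [pow_succ]
    omega
  have hle : capOf w ≤ 2 ^ (∑ v, (Nat.size (w v).num + Nat.size (w v).den) + n) :=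
    calc capOf w ≤ ∏ v, 2 ^ (Nat.size (w v).num + Nat.size (w v).den + 1) :=
          Finset.prod_le_prod' fun v _ => hfac _ _
      _ = _ := by rw [Finset.prod_pow_eq_pow_sum, Finset.sum_add_distrib]; simp
  have hn := le_inputSize (w := w)
  rw [Nat.size_le]
  refine hle.trans_lt (Nat.pow_lt_pow_right (by norm_num) ?_)
  have : ∑ v, (Nat.size (w v).num + Nat.size (w v).den) ≤ inputSize w := Nat.le_add_left _ _
  unfold bitsOf
  omega

theorem coe_integralWeight (v : Fin n) :
    (integralWeight w v : ℚ≥0) = w v * ((∏ u, (w u).den : ℕ) : ℚ≥0) := by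
  have hden : ((w v).den : ℚ≥0) ≠ 0 := Nat.cast_ne_zero.2 (w v).den_ne_zero
  have hdvd : (w v).den ∣ ∏ u, (w u).den :=
    Finset.dvd_prod_of_mem (fun u => (w u).den) (Finset.mem_univ v)
  rw [integralWeight, Nat.cast_mul, Nat.cast_div hdvd hden]
  nth_rewrite 3 [← NNRat.num_div_den (w v)]
  field_simp

/-- The guarantee for the integral weights is the one for the rational weights. -/
theorem weight_le_of_approx {X : Finset (Fin n)} (h : Approx G (integralWeight w) X) :
    weight w X ≤ optWVC G w + 4 * optIVD G w := by
  classical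
  obtain ⟨Y, hY, hYval⟩ := Finset.exists_mem_eq_inf'
    (s := (Finset.univ : Finset (Finset (Fin n))).filter fun X : Finset (Fin n) =>
      G.IsVertexCover (X : Set (Fin n))) ⟨Finset.univ, by simp⟩ (weight w)
  obtain ⟨M, hM, hMval⟩ := Finset.exists_mem_eq_inf'
    (s := (Finset.univ : Finset (Finset (Fin n))).filter fun M : Finset (Fin n) =>
      IsIntervalModulator G (M : Set (Fin n)))
    ⟨Finset.univ, by simpa using isIntervalModulator_univ G⟩ (weight w)
  have e1 : optWVC G w = weight w Y := by
    rw [← hYval]; unfold optWVC; congr!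
  have e2 : optIVD G w = weight w M := by
    rw [← hMval]; unfold optIVD; congr!
  rw [e1, e2]
  have hD : (0 : ℚ≥0) < ((∏ u, (w u).den : ℕ) : ℚ≥0) :=
    Nat.cast_pos.2 (Finset.prod_pos fun u _ => (w u).den_pos)
  have hsum : ∀ Z : Finset (Fin n), ((∑ v ∈ Z, integralWeight w v : ℕ) : ℚ≥0) =
      weight w Z * ((∏ u, (w u).den : ℕ) : ℚ≥0) := fun Z => by
    rw [Nat.cast_sum, weight, Finset.sum_mul]
    exact Finset.sum_congr rfl fun v _ => coe_integralWeight v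
  have key : ((∑ v ∈ X, integralWeight w v : ℕ) : ℚ≥0) ≤
      ((∑ v ∈ Y, integralWeight w v + 4 * ∑ v ∈ M, integralWeight w v : ℕ) : ℚ≥0) :=
    Nat.cast_le.2 (h Y M (Finset.mem_filter.1 hY).2 (Finset.mem_filter.1 hM).2)
  rw [Nat.cast_add, Nat.cast_mul, hsum, hsum, hsum, ← mul_assoc, ← add_mul] at key
  exact_mod_cast le_of_mul_le_mul_right key hD

/-! ### The machine program -/

/-- Multiply register `1` by a factor of `capOf`. -/
def capStep : Prog :=
  .assign 1 (.op .mul (.reg 1) (.op .add (.op .add (.read 1 (.reg 3)) (.read 2 (.reg 3))) (.lit 2)))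

/-- Compute `capOf` in register `1`, with the counter `3`. -/
def capProg : Prog := .seq (.assign 1 (.lit 1)) (.seq (.assign 3 (.lit 0)) (countLoop 3 capStep))

def capTime (B : ℕ) : ℕ := unit B + (unit B + (B + 1) * (unit B + unit B + unit B))

theorem polyBounded_capTime : PolyBounded capTime :=
  PolyBounded.unit.add (PolyBounded.unit.add
    ((PolyBounded.id.add (.const 1)).mul ((PolyBounded.unit.add .unit).add .unit)))

theorem bd_inputStore : Bd (capOf w) (inputStore G w) := by
  refine ⟨fun x => ?_, fun a i => ?_⟩
  · simp only [inputStore]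
    split_ifs
    · exact le_capOf
    · exact Nat.zero_le _
  · simp only [inputStore]
    split_ifs
    · exact one_le_capOf
    · exact Nat.zero_le _
    · exact le_trans (by omega) (factor_le_capOf ⟨i, by assumption⟩)
    · exact Nat.zero_le _
    · exact le_trans (by omega) (factor_le_capOf ⟨i, by assumption⟩)
    · exact Nat.zero_le _
    · exact Nat.zero_le _

theorem run_capProg : ∃ s, Run capProg (inputStore G w) (capTime (bitsOf w)) s ∧
    s.reg 0 = n ∧ s.reg 1 = capOf w ∧ s.arr = (inputStore G w).arr ∧ Bd (capOf w) s := by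
  have hB := size_capOf_le (w := w)
  have hn : n ≤ bitsOf w := by
    have := le_inputSize (w := w)
    unfold bitsOf
    omega
  have b₀ := bd_inputStore (G := G) (w := w)
  have b₁ := b₀.setReg (x := 1) (v := 1) one_le_capOf
  have b₂ := b₁.setReg (x := 3) (v := 0) (Nat.zero_le _)
  have r₁ := Run.assign hB b₀ 1 (.lit 1) (by decide)
  have r₂ := Run.assign hB b₁ 3 (.lit 0) (by decide)
  let part : ℕ → ℕ := fun k =>
    ∏ v ∈ Finset.univ.filter fun v : Fin n => (v : ℕ) < k, ((w v).num + (w v).den + 2)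
  obtain ⟨s, r₃, h0, -, h1, ha, hb⟩ := Run.countLoop (c := 3) (body := capStep)
    (τ := unit (bitsOf w)) (I := fun k s => s.reg 0 = n ∧ s.reg 3 = k ∧ s.reg 1 = part k ∧
      s.arr = (inputStore G w).arr ∧ Bd (capOf w) s) hB hn
    (fun k s h => ⟨h.1, h.2.1, h.2.2.2.2⟩)
    (fun k hk s ⟨h0, h3, h1, ha, hb⟩ => by
      have r := Run.assign hB hb 1 (.op .mul (.reg 1)
        (.op .add (.op .add (.read 1 (.reg 3)) (.read 2 (.reg 3))) (.lit 2))) (by decide)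
      have hval : (Expr.op .mul (.reg 1) (.op .add (.op .add (.read 1 (.reg 3))
          (.read 2 (.reg 3))) (.lit 2))).eval s = part (k + 1) := by
        have hins : (Finset.univ.filter fun v : Fin n => (v : ℕ) < k + 1) =
            insert ⟨k, hk⟩ (Finset.univ.filter fun v : Fin n => (v : ℕ) < k) := by
          ext v
          simp only [Finset.mem_filter, Finset.mem_insert, Fin.ext_iff, Finset.mem_univ, true_and]
          omega
        simp only [Expr.eval, Op.eval, h1, h3, ha, part]
        rw [hins, Finset.prod_insert (by simp), mul_comm]
        simp [inputStore, hk]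
      have hpart : part (k + 1) ≤ capOf w :=
        Finset.prod_le_prod_of_subset_of_one_le' (Finset.subset_univ _) fun v _ _ => by omega
      rw [hval] at r
      have b := hb.setReg (x := 1) hpart
      have e0 : (s.setReg 1 (part (k + 1))).reg 0 = n := by
        rw [setReg_reg_ne _ _ (by omega), h0]
      have e3 : (s.setReg 1 (part (k + 1))).reg 3 = k := by
        rw [setReg_reg_ne _ _ (by omega), h3]
      refine ⟨_, r, e0, e3, b, ?_, ?_, ?_, ha, b.setReg ((by omega : k + 1 ≤ n).trans le_capOf)⟩
      · rw [setReg_reg_ne _ _ (by omega), e0]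
      · rw [setReg_reg_self]
      · rw [setReg_reg_ne _ _ (by omega), setReg_reg_self])
    (s := ((inputStore G w).setReg 1 1).setReg 3 0)
    ⟨by simp [Store.setReg, inputStore], by simp [Store.setReg],
      by simp [Store.setReg, part], rfl, b₂⟩
  refine ⟨s, r₁.seq (r₂.seq r₃), h0, ?_, ha, hb⟩
  rw [h1]
  simp [part, capOf]

theorem isGraph_inputStore : IsGraph ((inputStore G w).arr 0) G := by
  intro i j
  simp only [inputStore, if_true, ne_eq, ite_eq_right_iff, one_ne_zero, imp_false, not_not]
  constructor
  · rintro ⟨i', j', h, he⟩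
    obtain ⟨h1, h2⟩ := address_inj j.2 j'.2 he
    rwa [Fin.ext h1, Fin.ext h2]
  · exact fun h => ⟨i, j, h, rfl⟩

end Bounded

open Bounded Graph in
theorem mainTheorem5 :
    ∃ (P : RAM.Prog) (p : Polynomial ℕ),
      ∀ (n : ℕ) (G : SimpleGraph (Fin n)) (w : Fin n → ℚ≥0),
        ∃ (t : ℕ) (s : RAM.Store),
          RAM.Exec P (inputStore G w) t s ∧
          t ≤ p.eval (inputSize w) ∧
          G.IsVertexCover (outputSet n s : Set (Fin n)) ∧
          weight w (outputSet n s) ≤ optWVC G w + 4 * optIVD G w := by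
  obtain ⟨p, hp⟩ := polyBounded_capTime.add mainSt.polyBounded_time
  refine ⟨.seq capProg (mainSt.compile 0), p.comp (2 * Polynomial.X + 1), fun n G w => ?_⟩
  have hn : n ≤ bitsOf w := by
    have := le_inputSize (w := w)
    unfold bitsOf
    omega
  obtain ⟨s₁, r₁, h0, h1, ha, hb⟩ := run_capProg (G := G) (w := w)
  obtain ⟨s, r₂, hs, -, -⟩ := St.compile_spec size_capOf_le hn le_capOf one_le_capOf mainSt 0 s₁ hb
    h0 h1
  obtain ⟨t, ht, hexec⟩ := r₁.seq r₂
  obtain ⟨I, hI, happrox, hout⟩ := run_mainSt (cap := capOf w) (η := envOf s₁) (G := G)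
    (σ := s₁.arr) (num := fun v => (w v).num) (den := fun v => (w v).den)
    (by rw [ha]; exact isGraph_inputStore) (by intro v; simp [ha, inputStore])
    (by intro v; simp [ha, inputStore]) (fun v => (w v).den_pos) prod_den_le_capOf
    sum_integralWeight_le_capOf
  have hset : outputSet n s = Iᶜ := by
    ext v
    rw [outputSet, Finset.mem_filter, hs, hout v]
    simp
  refine ⟨t, s, hexec, ht.trans ((hp (bitsOf w)).trans (le_of_eq ?_)), ?_, ?_⟩
  · simp [Polynomial.eval_comp, bitsOf]
  · rw [hset]
    intro a b hab
    by_contra! h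
    simp only [Finset.coe_compl, Set.mem_compl_iff, not_not] at h
    exact hI h.1 h.2 hab.ne hab
  · rw [hset]
    exact weight_le_of_approx happrox
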